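/- Let $\mathbb H^d=\mathbb R^{2d}\times\mathbb R$ be the Heisenberg group, with points $(z,s)$, $z=(x,y)\in\mathbb R^{d}\times\mathbb R^d$, and group law $(z,s)\cdot(z',s')=(z+z',\,s+s'+z\cdot_\sigma z')$, where $z\cdot_\sigma z':=x'\cdot y-x\cdot y'$; let $L^2(\mathbb H^d)$ be the space of complex square-integrable functions for Lebesgue measure. Put $X_i=\partial_{x^i}+y^i\partial_s$, $Y_i=\partial_{y^i}-x^i\partial_s$ $(1\le i\le d)$ and let $L$ be the closure in $L^2(\mathbb H^d)$ of the operator $L_0=\sum_{i=1}^d(X_i^2+Y_i^2)$ with domain $C_c^\infty(\mathbb H^d)$. Let $v\in L^\infty(\mathbb H^d)$ be real-valued and let $$H=-\tfrac12L+v,\qquad D(H)=D(L).$$ For $\tau\ge 0$ let $S(\tau)$ be the bounded operator on $L^2(\mathbb H^d)$ which on Schwartz functions $\psi\in\mathcal S(\mathbb H^d)=\mathcal S(\mathbb R^{2d+1})$ is given by the oscillatory integral $$[S(\tau)\psi](z,s)=\frac1{(2\pi i)^d}\int^{o}_{\mathbb R^{2d}}e^{i|\zeta|^2/2}\,\psi\bigl(z+\sqrt\tau\,\zeta,\;s+\sqrt\tau\,z\cdot_\sigma\zeta\bigr)\,d\zeta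 ,$$ where $\int^o_{\mathbb R^{2d}}f(\zeta)\,d\zeta:=\lim_{\epsilon\downarrow0}\int_{\mathbb R^{2d}}\phi(\epsilon\zeta)f(\zeta)\,d\zeta$, the limit being required to exist and to be the same for all Schwartz functions $\phi$ on $\mathbb R^{2d}$ with $\phi(0)=1$. Let $e^{-iv\tau}$ denote the operator of multiplication by this function and put $S_v(\tau)=S(\tau)e^{-iv\tau}$. **Theorem.** The operator $H$ is self-adjoint, and there is exactly one strongly continuous one-parameter group $(e^{-iHt})_{t\in\mathbb R}$ of unitary operators on $L^2(\mathbb H^d)$ with generator $-iH$. The oscillatory integrals above exist at every point $(z,s)$, and for every $\tau\ge0$ they define exactly one bounded operator $S(\tau)$ on $L^2(\mathbb H^d)$. The family $(S_v(\tau))_{\tau\ge0}$ is Chernoff equivalent to $(e^{-iH\tau})_{\tau\ge0}$, that is, for all $\psi\in L^2(\mathbb H^d)$ and all $T>0$, $$\lim_{n\to\infty}\ \sup_{\tau\in[0,T]}\bigl\|S_v(\tau/n)^n\psi-e^{-iH\tau}\psi\bigr\|=0 .$$ Moreover, for every $\psi_0\in D(H)$ the map $t\mapsto\psi(t)=e^{-iHt}\psi_0$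 is a classical solution on $\mathbb R$ of $i\,\partial_t\psi=H\psi$, $\psi(0)=\psi_0$: it is continuously differentiable with values in $L^2(\mathbb H^d)$, $\psi(t)\in D(H)$ for all $t\in\mathbb R$, and the equation holds for all $t\in\mathbb R$. -/

import Mathlib

open MeasureTheory Filter Topology
open scoped NNReal ENNReal SchwartzMap

noncomputable section

/-! ## The Heisenberg group, its horizontal vector fields, and its `L²` space -/

/-- The horizontal layer `ℝ^{2d}`, a point being `z = (x, y)` with `x i = z (.inl i)` and
`y i = z (.inr i)`; its norm is Euclidean. -/
abbrev Horiz (d : ℕ) : Type := EuclideanSpace ℝ (Fin d ⊕ Fin d)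

/-- The manifold `ℝ^{2d} × ℝ` underlying the Heisenberg group `ℍ^d`; a point is `(z, s)`.
Its `volume` is Lebesgue measure, which is the Haar measure of the group. -/
abbrev Heis (d : ℕ) : Type := Horiz d × ℝ

/-- The form `z ·_σ z' = x' y - x y'`. -/
def symp {d : ℕ} (z z' : Horiz d) : ℝ :=
  ∑ i : Fin d, (z' (.inl i) * z (.inr i) - z (.inl i) * z' (.inr i))

/-- The group law `(z, s) · (z', s') = (z + z', s + s' + z ·_σ z')` of `ℍ^d`. -/
def heisMul {d : ℕ} (p q : Heis d) : Heis d :=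
  (p.1 + q.1, p.2 + q.2 + symp p.1 q.1)

/-- The left-invariant vector field `X_i = ∂_{x^i} + y^i ∂_s`, as a tangent vector at `p`. -/
def vecX {d : ℕ} (i : Fin d) (p : Heis d) : Heis d :=
  (EuclideanSpace.single (.inl i) 1, p.1 (.inr i))

/-- The left-invariant vector field `Y_i = ∂_{y^i} - x^i ∂_s`, as a tangent vector at `p`. -/
def vecY {d : ℕ} (i : Fin d) (p : Heis d) : Heis d :=
  (EuclideanSpace.single (.inr i) 1, -p.1 (.inl i))

/-- The action of a vector field `w` on a function `f`. -/
def alongField {d : ℕ} (w : Heis d → Heis d) (f : Heis d → ℂ) : Heis d → ℂ :=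
  fun p => fderiv ℝ f p (w p)

/-- The differential expression `∑_i (X_i² + Y_i²)`. -/
def subLap {d : ℕ} (f : Heis d → ℂ) : Heis d → ℂ :=
  fun p => ∑ i : Fin d, (alongField (vecX i) (alongField (vecX i) f) p
    + alongField (vecY i) (alongField (vecY i) f) p)

/-- The complex Hilbert space `L²(ℍ^d)`. -/
abbrev L2 (d : ℕ) : Type := Lp ℂ 2 (volume : Measure (Heis d))

/-- The space `C_c^∞(ℍ^d)` of smooth compactly supported complex functions. -/
def testFun (d : ℕ) : Submodule ℂ (Heis d → ℂ) where
  carrier := {f | ContDiff ℝ ((⊤ : ℕ∞) : WithTop ℕ∞) f ∧ HasCompactSupport f}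
  add_mem' := fun hf hg => ⟨hf.1.add hg.1, hf.2.add hg.2⟩
  zero_mem' := ⟨contDiff_const, HasCompactSupport.zero⟩
  smul_mem' := fun c _ hf => ⟨hf.1.const_smul c, hf.2.smul_left (f := fun _ => c)⟩

theorem contDiff_vecX {d : ℕ} (i : Fin d) :
    ContDiff ℝ ((⊤ : ℕ∞) : WithTop ℕ∞) (vecX i : Heis d → Heis d) := by
  unfold vecX
  fun_prop

theorem contDiff_vecY {d : ℕ} (i : Fin d) :
    ContDiff ℝ ((⊤ : ℕ∞) : WithTop ℕ∞) (vecY i : Heis d → Heis d) := by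
  unfold vecY
  fun_prop

theorem alongField_mem {d : ℕ} {w : Heis d → Heis d}
    (hw : ContDiff ℝ ((⊤ : ℕ∞) : WithTop ℕ∞) w) {f : Heis d → ℂ} (hf : f ∈ testFun d) :
    alongField w f ∈ testFun d := by
  refine ⟨?_, ?_⟩
  · exact (hf.1.fderiv_right (m := ((⊤ : ℕ∞) : WithTop ℕ∞)) le_rfl).clm_apply hw
  · refine (hf.2.fderiv ℝ).mono' (fun p hp => subset_tsupport _ ?_)
    intro h0
    apply hp
    simp only [alongField]
    rw [h0]
    rfl

theorem subLap_mem {d : ℕ} {f : Heis d → ℂ} (hf : f ∈ testFun d) :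
    subLap f ∈ testFun d := by
  have h : subLap f = ∑ i : Fin d, (alongField (vecX i) (alongField (vecX i) f)
      + alongField (vecY i) (alongField (vecY i) f)) := by
    funext p
    simp [subLap, Finset.sum_apply]
  rw [h]
  exact Submodule.sum_mem _ fun i _ => Submodule.add_mem _
    (alongField_mem (contDiff_vecX i) (alongField_mem (contDiff_vecX i) hf))
    (alongField_mem (contDiff_vecY i) (alongField_mem (contDiff_vecY i) hf))

theorem alongField_add {d : ℕ} (w : Heis d → Heis d) {f g : Heis d → ℂ}
    (hf : f ∈ testFun d) (hg : g ∈ testFun d) :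
    alongField w (f + g) = alongField w f + alongField w g := by
  funext p
  simp only [alongField, Pi.add_apply]
  rw [fderiv_add (hf.1.differentiable (by simp) p) (hg.1.differentiable (by simp) p)]
  rfl

theorem alongField_smul {d : ℕ} (w : Heis d → Heis d) (c : ℂ) {f : Heis d → ℂ}
    (hf : f ∈ testFun d) :
    alongField w (c • f) = c • alongField w f := by
  funext p
  simp only [alongField, Pi.smul_apply]
  rw [fderiv_const_smul (hf.1.differentiable (by simp) p)]
  rfl

/-- The sub-Laplacian as a linear map of `C_c^∞(ℍ^d)` into itself. -/
def subLapTest (d : ℕ) : testFun d →ₗ[ℂ] testFun d where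
  toFun f := ⟨subLap f, subLap_mem f.2⟩
  map_add' f g := by
    ext p
    simp only [subLap, Submodule.coe_add, Pi.add_apply]
    rw [← Finset.sum_add_distrib]
    refine Finset.sum_congr rfl fun i _ => ?_
    rw [alongField_add _ f.2 g.2, alongField_add _ f.2 g.2,
      alongField_add _ (alongField_mem (contDiff_vecX i) f.2)
        (alongField_mem (contDiff_vecX i) g.2),
      alongField_add _ (alongField_mem (contDiff_vecY i) f.2)
        (alongField_mem (contDiff_vecY i) g.2)]
    simp only [Pi.add_apply]
    ring
  map_smul' c f := by
    ext p
    simp only [subLap, Submodule.coe_smul, Pi.smul_apply, RingHom.id_apply]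
    rw [Finset.smul_sum]
    refine Finset.sum_congr rfl fun i _ => ?_
    rw [alongField_smul _ c f.2, alongField_smul _ c f.2,
      alongField_smul _ c (alongField_mem (contDiff_vecX i) f.2),
      alongField_smul _ c (alongField_mem (contDiff_vecY i) f.2)]
    simp only [Pi.smul_apply, smul_add]

theorem memLp_testFun {d : ℕ} (f : testFun d) :
    MemLp (f : Heis d → ℂ) 2 (volume : Measure (Heis d)) :=
  f.2.1.continuous.memLp_of_hasCompactSupport f.2.2

/-- The embedding of `C_c^∞(ℍ^d)` in `L²(ℍ^d)`. -/
def testToL2 (d : ℕ) : testFun d →ₗ[ℂ] L2 d where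
  toFun f := (memLp_testFun f).toLp _
  map_add' _ _ := rfl
  map_smul' _ _ := rfl

theorem testToL2_injective (d : ℕ) : Function.Injective (testToL2 d) := by
  intro f g h
  have h' := (MemLp.toLp_eq_toLp_iff (memLp_testFun f) (memLp_testFun g)).1 h
  exact Subtype.ext ((f.2.1.continuous.ae_eq_iff_eq volume g.2.1.continuous).1 h')

/-- The operator `L₀ = ∑_i (X_i² + Y_i²)` in `L²(ℍ^d)` with domain `C_c^∞(ℍ^d)`. -/
def L0 (d : ℕ) : L2 d →ₗ.[ℂ] L2 d where
  domain := LinearMap.range (testToL2 d)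
  toFun := (testToL2 d) ∘ₗ (subLapTest d) ∘ₗ
    (LinearEquiv.ofInjective (testToL2 d) (testToL2_injective d)).symm.toLinearMap

/-- The horizontal Laplacian `L`, the closure of `L₀` in `L²(ℍ^d)`. -/
def horizLap (d : ℕ) : L2 d →ₗ.[ℂ] L2 d := (L0 d).closure

/-! ## Multiplication operators and the Hamiltonian -/

/-- Multiplication by an essentially bounded function, as a bounded operator on `L²(ℍ^d)`. -/
def mulOp {d : ℕ} (g : Heis d → ℂ) (hg : MemLp g ⊤ (volume : Measure (Heis d))) :
    L2 d →L[ℂ] L2 d :=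
  (ContinuousLinearMap.mul ℂ ℂ).holderL volume ⊤ 2 2 (hg.toLp g)

theorem memLp_potential {d : ℕ} (v : Lp ℝ ⊤ (volume : Measure (Heis d))) :
    MemLp (fun p => (v p : ℂ)) ⊤ (volume : Measure (Heis d)) :=
  (Lp.memLp v).ofReal

theorem memLp_phase {d : ℕ} (v : Lp ℝ ⊤ (volume : Measure (Heis d))) (τ : ℝ) :
    MemLp (fun p => Complex.exp (-Complex.I * τ * (v p : ℂ))) ⊤
      (volume : Measure (Heis d)) := by
  refine memLp_top_of_bound ?_ 1 (Eventually.of_forall fun p => ?_)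
  · exact Complex.continuous_exp.comp_aestronglyMeasurable
      ((memLp_potential v).1.const_mul (-Complex.I * τ))
  · rw [Complex.norm_exp]
    simp

/-- The multiplication operator `e^{-ivτ}` on `L²(ℍ^d)`. -/
def phaseOp {d : ℕ} (v : Lp ℝ ⊤ (volume : Measure (Heis d))) (τ : ℝ) : L2 d →L[ℂ] L2 d :=
  mulOp _ (memLp_phase v τ)

/-- The Hamiltonian `H = -L/2 + v` in `L²(ℍ^d)`, with domain `D(H) = D(L)`. -/
def hamiltonian {d : ℕ} (v : Lp ℝ ⊤ (volume : Measure (Heis d))) : L2 d →ₗ.[ℂ] L2 d where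
  domain := (horizLap d).domain
  toFun := (-(1 / 2 : ℂ)) • (horizLap d).toFun +
    (mulOp _ (memLp_potential v)).toLinearMap ∘ₗ (horizLap d).domain.subtype

/-! ## Unitary groups, classical solutions, Chernoff equivalence -/

/-- `U` is the group `U(t) = e^{-iHt}`: a strongly continuous one-parameter group of unitary
operators whose infinitesimal generator (its domain included) is `-iH`. -/
structure IsUnitaryGroupOf {E : Type*} [NormedAddCommGroup E] [InnerProductSpace ℂ E]
    [CompleteSpace E] (H : E →ₗ.[ℂ] E) (U : ℝ → E →L[ℂ] E) : Prop where
  zero : U 0 = 1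
  add : ∀ s t, U (s + t) = U s * U t
  unitary : ∀ t, U t ∈ unitary (E →L[ℂ] E)
  strongly_continuous : ∀ ψ, Continuous fun t => U t ψ
  generator : ∀ ψ χ : E,
    Tendsto (fun t : ℝ => ((t : ℂ)⁻¹) • (U t ψ - ψ)) (𝓝[>] 0) (𝓝 χ) ↔
      ∃ h : ψ ∈ H.domain, χ = -Complex.I • H ⟨ψ, h⟩

/-- `u` is a classical solution on `ℝ` of `i u' = H u`, `u(0) = ψ₀`. -/
def IsClassicalSolution {E : Type*} [NormedAddCommGroup E] [InnerProductSpace ℂ E]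
    (H : E →ₗ.[ℂ] E) (ψ₀ : E) (u : ℝ → E) : Prop :=
  u 0 = ψ₀ ∧ ContDiff ℝ 1 u ∧
    ∀ t, ∃ h : u t ∈ H.domain, Complex.I • deriv u t = H ⟨u t, h⟩

/-- `S` is Chernoff equivalent to `V`: for every vector `f` and every `T > 0`,
`sup_{t ∈ [0,T]} ‖S(t/n)^n f - V(t) f‖ → 0`. The supremum is taken in `[0, ∞]`. -/
def ChernoffEquivalent {B : Type*} [NormedAddCommGroup B] [NormedSpace ℂ B]
    (S V : ℝ≥0 → B →L[ℂ] B) : Prop :=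
  ∀ (f : B) (T : ℝ≥0), 0 < T →
    Tendsto (fun n : ℕ => ⨆ t ∈ Set.Icc 0 T, ‖(S (t / n) ^ n) f - V t f‖ₑ) atTop (𝓝 0)

/-! ## The oscillatory integral operators -/

instance (d : ℕ) : (volume : Measure (Heis d)).HasTemperateGrowth :=
  inferInstanceAs
    ((volume : Measure (Horiz d)).prod (volume : Measure ℝ)).HasTemperateGrowth

/-- The oscillatory integral `∫° f(ζ) dζ` over `ℝ^{2d}` exists and equals `a`: the limits
`lim_{ε ↓ 0} ∫ φ(ε ζ) f(ζ) dζ` exist and equal `a` for all Schwartz functions `φ` with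
`φ(0) = 1`. -/
def HasOscIntegral {d : ℕ} (f : Horiz d → ℂ) (a : ℂ) : Prop :=
  ∀ φ : 𝓢(Horiz d, ℂ), φ 0 = 1 →
    Tendsto (fun ε : ℝ => ∫ ζ : Horiz d, φ (ε • ζ) * f ζ) (𝓝[>] 0) (𝓝 a)

/-- `A` is the bounded operator `S(τ)` on `L²(ℍ^d)`: on each Schwartz function `ψ`,
`(A ψ)(z,s) = (2πi)^{-d} ∫° e^{i|ζ|²/2} ψ(z + √τ ζ, s + √τ z ·_σ ζ) dζ`, the oscillatory
integral existing at every point `(z,s)`. The argument of `ψ` is `(z,s) · (√τ ζ, 0)`. -/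
def IsFeynmanOp {d : ℕ} (τ : ℝ≥0) (A : L2 d →L[ℂ] L2 d) : Prop :=
  ∀ ψ : 𝓢(Heis d, ℂ), ∃ g : Heis d → ℂ,
    (∀ p : Heis d, HasOscIntegral
      (fun ζ : Horiz d => Complex.exp (Complex.I * (‖ζ‖ ^ 2 / 2 : ℝ)) *
        ψ (heisMul p (Real.sqrt τ • ζ, 0)))
      ((2 * Real.pi * Complex.I) ^ d * g p)) ∧
    A (ψ.toLp 2 volume) =ᵐ[volume] g

end

/-! Everything rests on Chernoff's theorem: contractions `S h` with `S 0 = 1` whose difference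
quotients at `h = 0` converge to `-iH` on a core of a self-adjoint `H` satisfy `S (t/n) ^ n →
e^{-itH}`, uniformly for `t` in bounded intervals. Three things have to be supplied:
self-adjointness with an explicit core, contractivity, and consistency on the core.

Self-adjointness. `L₀` is symmetric and nonpositive, by integration by parts. Hence its closure is
self-adjoint once `1 - L₀` has dense range, that is, once a square-integrable distributional
solution of `L f = f` vanishes (`ae_eq_zero_of_weak_solution`). Left convolution with a test
function averages left translates; since `L` is left-invariant it preserves the equation, and it
makes `f` smooth. For smooth `g` a Caccioppoli inequality (`integral_sq_mul_le`) bounds `∫ χ²|g|²`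
by `∑ ∫ (X_j χ)²|g|²`; with cutoffs spread out by the group dilations the right side tends to `0`.
The bounded potential changes neither domain nor self-adjointness, and test functions remain a core.

Contractivity. With `w = z + √τ ζ` the quadratic phase splits into unimodular factors in `z` and in
`w` and a character in `⟨z, w⟩`. A Fourier transform in `s` turns the shift `z ·_σ w` into another
character, and together they give the Fourier transform in `w` at `c z - l J z`, with `c = 1/(2πτ)`.
This map is `√(c² + l²)` times an isometry, so Plancherel's theorem bounds the `L²` norm, with
constant exactly `1` after normalization (`lintegral_feynman_le`).

Consistency. `S(σ)ψ` at `p` is a Fresnel integral of the restriction of `ψ` to the horizontal plane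
through `p`. On the Fourier side it is smooth in `σ`, including at `σ = 0`, with derivative `i/2`
times the Fresnel integral of the flat Laplacian of the restriction, which at `σ = 0` is `Lψ`. That
Laplacian brings in coefficients growing like `‖z‖²`, so weighted `L²` bounds are needed, uniformly
in `σ`. They come from `norm_fst_mul_feynman_le`: commuting a coordinate with `S(σ)` produces a
central derivative with coefficient `z ·_σ e_k`, and these terms cancel in `∑ z_k (z ·_σ e_k) = z
·_σ z = 0`. Thus `S(σ)ψ = ψ + σ (i/2) Lψ + O(σ²)` in `L²`, and with the expansion of the phase the
slope is `-iH`.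

Existence of the group is Stone's theorem, obtained from bounded approximations of `H`; uniqueness
and classical solutions follow by differentiating the group on the domain. -/

set_option linter.unusedSectionVars false

/-! ## Self-adjoint operators and their resolvents -/

section Resolvent

variable {E : Type*} [NormedAddCommGroup E] [InnerProductSpace ℂ E] [CompleteSpace E]

theorem inner_map_eq_of_isSelfAdjoint {H : E →ₗ.[ℂ] E} (hH : IsSelfAdjoint H)
    (x y : H.domain) : inner ℂ (H x) (y : E) = inner ℂ (x : E) (H y) := by
  have h := LinearPMap.adjoint_isFormalAdjoint hH.dense_domain
  rw [LinearPMap.isSelfAdjoint_def.1 hH] at h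
  exact h x y

theorem mem_domain_of_isSelfAdjoint {H : E →ₗ.[ℂ] E} (hH : IsSelfAdjoint H) {y w : E}
    (h : ∀ x : H.domain, inner ℂ w (x : E) = inner ℂ y (H x)) :
    ∃ hy : y ∈ H.domain, H ⟨y, hy⟩ = w := by
  have h1 : ∃ hy : y ∈ H.adjoint.domain, H.adjoint ⟨y, hy⟩ = w :=
    ⟨LinearPMap.mem_adjoint_domain_of_exists y ⟨w, h⟩,
      LinearPMap.adjoint_apply_eq hH.dense_domain _ h⟩
  rwa [LinearPMap.isSelfAdjoint_def.1 hH] at h1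

/-- A closed symmetric operator `A` with dense domain for which `1 + c A` is onto for some real
`c ≠ 0` is self-adjoint, provided `1 + c A` is injective on the domain of the adjoint by symmetry. -/
theorem isSelfAdjoint_of_surjective {A : E →ₗ.[ℂ] E} (hd : Dense (A.domain : Set E))
    (hs : ∀ x y : A.domain, inner ℂ (A x) (y : E) = inner ℂ (x : E) (A y)) {c : ℝ} (hc : c ≠ 0)
    (hsurj : ∀ f : E, ∃ x : A.domain, (x : E) + (c : ℂ) • A x = f) : IsSelfAdjoint A := by
  rw [LinearPMap.isSelfAdjoint_def]
  have hle : A ≤ A.adjoint := LinearPMap.IsFormalAdjoint.le_adjoint hd hs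
  have hc' : (c : ℂ) ≠ 0 := by exact_mod_cast hc
  refine le_antisymm ?_ hle
  have hadj := LinearPMap.adjoint_isFormalAdjoint hd
  have key : ∀ y : A.adjoint.domain, ∃ x : A.domain, (x : E) = y := by
    intro y
    -- An `x` in the domain of `A` with the same image under `1 + c A*`. As `c` is real, `y - x` is
    -- orthogonal to the range of `1 + c A`, which is everything, and so vanishes.
    obtain ⟨x, hx⟩ := hsurj ((y : E) + (c : ℂ) • A.adjoint y)
    refine ⟨x, ?_⟩
    obtain ⟨z, hz⟩ := hsurj ((y : E) - x)
    have h1 : inner ℂ ((y : E) - x) ((z : E) + (c : ℂ) • A z) = 0 := by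
      have e1 : inner ℂ ((y : E) - x) ((z : E) + (c : ℂ) • A z) =
          inner ℂ ((y : E) + (c : ℂ) • A.adjoint y) (z : E)
            - inner ℂ ((x : E) + (c : ℂ) • A x) (z : E) := by
        simp only [inner_add_right, inner_add_left, inner_smul_right, inner_smul_left,
          inner_sub_left, Complex.conj_ofReal]
        rw [hadj y z, hs x z]; ring
      rw [e1, hx, sub_self]
    rw [hz, inner_self_eq_zero, sub_eq_zero] at h1
    exact h1.symm
  refine ⟨fun y hy => ?_, ?_⟩
  · obtain ⟨x, hx⟩ := key ⟨y, hy⟩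
    simp only at hx
    exact hx ▸ x.2
  · intro y x hyx
    exact (hle.2 hyx.symm).symm

/-- A closed operator `A` for which `1 + c A` is bounded below and has dense range maps its domain
onto the whole space. -/
theorem exists_add_smul_eq {A : E →ₗ.[ℂ] E} (hA : A.IsClosed) {c : ℂ} (hc : c ≠ 0)
    (hb : ∀ x : A.domain, ‖(x : E)‖ ≤ ‖(x : E) + c • A x‖)
    (hd : ∀ y : E, (∀ x : A.domain, inner ℂ ((x : E) + c • A x) y = 0) → y = 0) (f : E) :
    ∃ x : A.domain, (x : E) + c • A x = f := by
  set T : A.domain →ₗ[ℂ] E := A.domain.subtype + c • A.toFun with hT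
  have hTa : ∀ x : A.domain, T x = (x : E) + c • A x := fun x => rfl
  have hdense : (LinearMap.range T).topologicalClosure = ⊤ := by
    rw [Submodule.topologicalClosure_eq_top_iff, Submodule.eq_bot_iff]
    intro y hy
    refine hd y fun x => ?_
    rw [← hTa]
    exact (Submodule.mem_orthogonal _ _).1 hy _ ⟨x, rfl⟩
  have hf : f ∈ closure (LinearMap.range T : Set E) := by
    have : f ∈ (LinearMap.range T).topologicalClosure := hdense ▸ Submodule.mem_top
    exact this
  obtain ⟨g, hg, hgf⟩ := mem_closure_iff_seq_limit.1 hf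
  choose x hx using hg
  -- The lower bound makes preimages of a Cauchy sequence Cauchy; closedness of `A` then identifies
  -- the limit.
  have hcau : CauchySeq (fun n => (x n : E)) := by
    rw [Metric.cauchySeq_iff']
    intro ε hε
    obtain ⟨N, hN⟩ := Metric.cauchySeq_iff'.1 hgf.cauchySeq ε hε
    refine ⟨N, fun n hn => lt_of_le_of_lt ?_ (hN n hn)⟩
    rw [dist_eq_norm, dist_eq_norm, ← hx, ← hx, ← map_sub, hTa]
    exact hb (x n - x N)
  obtain ⟨x₀, hx₀⟩ := cauchySeq_tendsto_of_complete hcau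
  have hAx : Tendsto (fun n => A (x n)) atTop (𝓝 (c⁻¹ • (f - x₀))) := by
    have : (fun n => A (x n)) = fun n => c⁻¹ • (g n - x n) := by
      funext n
      rw [← hx, hTa, add_sub_cancel_left, smul_smul, inv_mul_cancel₀ hc, one_smul]
    rw [this]
    exact (hgf.sub hx₀).const_smul _
  have hmem : (x₀, c⁻¹ • (f - x₀)) ∈ A.graph :=
    hA.mem_of_tendsto (hx₀.prodMk_nhds hAx) (Eventually.of_forall fun n => A.mem_graph (x n))
  obtain ⟨y, hy1, hy2⟩ := (LinearPMap.mem_graph_iff A).1 hmem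
  refine ⟨y, ?_⟩
  simp only at hy1 hy2
  rw [hy1, hy2, smul_smul, mul_inv_cancel₀ hc, one_smul, add_sub_cancel]

/-- `J` is the everywhere defined contractive inverse of `1 + c A`. -/
structure IsResolvent (A : E →ₗ.[ℂ] E) (c : ℂ) (J : E →L[ℂ] E) : Prop where
  norm_le : ∀ f, ‖J f‖ ≤ ‖f‖
  mem : ∀ f, J f ∈ A.domain
  right_inv : ∀ f, J f + c • A ⟨J f, mem f⟩ = f
  left_inv : ∀ x : A.domain, J ((x : E) + c • A x) = x

theorem exists_isResolvent {A : E →ₗ.[ℂ] E} {c : ℂ}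
    (hb : ∀ x : A.domain, ‖(x : E)‖ ≤ ‖(x : E) + c • A x‖)
    (hs : ∀ f : E, ∃ x : A.domain, (x : E) + c • A x = f) : ∃ J, IsResolvent A c J := by
  set T : A.domain →ₗ[ℂ] E := A.domain.subtype + c • A.toFun with hT
  have hTa : ∀ x : A.domain, T x = (x : E) + c • A x := fun x => rfl
  have hinj : Function.Injective T := by
    rw [injective_iff_map_eq_zero]
    intro x hx
    have := hb x
    rw [← hTa, hx, norm_zero] at this
    exact Subtype.ext (norm_le_zero_iff.1 this)
  set e : A.domain ≃ₗ[ℂ] E := LinearEquiv.ofBijective T ⟨hinj, hs⟩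
  have he : ∀ f, T (e.symm f) = f := fun f => e.apply_symm_apply f
  have he' : ∀ x, e.symm (T x) = x := fun x => e.symm_apply_apply x
  refine ⟨(A.domain.subtype ∘ₗ e.symm.toLinearMap).mkContinuous 1 fun f => ?_, ?_, ?_, ?_, ?_⟩
  · have := hb (e.symm f)
    rw [← hTa, he] at this
    simpa using this
  · intro f
    have := hb (e.symm f)
    rw [← hTa, he] at this
    simpa using this
  · intro f
    exact (e.symm f).2
  · intro f
    exact he f
  · intro x
    change ((e.symm (T x) : A.domain) : E) = x
    rw [he']

/-- Symmetry makes `⟨x, H x⟩` real, so the cross term, the real part of `i t ⟨x, H x⟩`, vanishes. -/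
theorem norm_sq_add_smul_of_isSelfAdjoint {H : E →ₗ.[ℂ] E}
    (hs : ∀ x y : H.domain, inner ℂ (H x) (y : E) = inner ℂ (x : E) (H y)) (t : ℝ)
    (x : H.domain) :
    ‖(x : E) + (Complex.I * t) • H x‖ ^ 2 = ‖(x : E)‖ ^ 2 + t ^ 2 * ‖H x‖ ^ 2 := by
  have hre : (inner ℂ (x : E) (H x)).im = 0 := by
    have h := inner_conj_symm (𝕜 := ℂ) (x : E) (H x)
    rw [hs x x] at h
    exact Complex.conj_eq_iff_im.1 h
  rw [@norm_add_sq ℂ, norm_smul, inner_smul_right]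
  simp [hre, mul_pow]

theorem norm_le_norm_add_smul {H : E →ₗ.[ℂ] E}
    (hs : ∀ x y : H.domain, inner ℂ (H x) (y : E) = inner ℂ (x : E) (H y)) (t : ℝ)
    (x : H.domain) : ‖(x : E)‖ ≤ ‖(x : E) + (Complex.I * t) • H x‖ := by
  have h := norm_sq_add_smul_of_isSelfAdjoint hs t x
  have : ‖(x : E)‖ ^ 2 ≤ ‖(x : E) + (Complex.I * t) • H x‖ ^ 2 := by
    rw [h]; nlinarith [mul_nonneg (sq_nonneg t) (sq_nonneg ‖H x‖)]
  exact le_of_sq_le_sq this (norm_nonneg _)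

/-- A vector `y` orthogonal to the range of `1 + itH` lies in the domain of `H* = H` and satisfies
`itHy = y`. The Pythagorean identity then reads `4‖y‖² = 2‖y‖²`, so `y = 0` and the range is dense.
-/
theorem exists_resolvent_of_isSelfAdjoint {H : E →ₗ.[ℂ] E} (hH : IsSelfAdjoint H) {t : ℝ}
    (ht : t ≠ 0) : ∃ J, IsResolvent H (Complex.I * t) J := by
  have hs := inner_map_eq_of_isSelfAdjoint hH
  have hb := norm_le_norm_add_smul hs t
  have hc : Complex.I * (t : ℂ) ≠ 0 := mul_ne_zero Complex.I_ne_zero (by exact_mod_cast ht)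
  refine exists_isResolvent hb (exists_add_smul_eq hH.isClosed hc hb fun y hy => ?_)
  have h1 : ∀ x : H.domain,
      inner ℂ ((Complex.I * t)⁻¹ • y) (x : E) = inner ℂ y (H x) := by
    intro x
    have h2 := hy x
    rw [← inner_conj_symm, map_eq_zero, inner_add_right, inner_smul_right] at h2
    rw [inner_smul_left]
    have h3 : (starRingEnd ℂ) (Complex.I * (t : ℂ))⁻¹ = -(Complex.I * (t : ℂ))⁻¹ := by
      simp
    rw [h3, neg_mul, neg_eq_iff_eq_neg, inv_mul_eq_iff_eq_mul₀ hc]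
    linear_combination h2
  obtain ⟨hy1, hy2⟩ := mem_domain_of_isSelfAdjoint hH h1
  have h4 := norm_sq_add_smul_of_isSelfAdjoint hs t ⟨y, hy1⟩
  rw [hy2, smul_smul, mul_inv_cancel₀ hc, one_smul, ← two_smul ℝ, norm_smul, norm_smul,
    norm_inv, norm_mul, Complex.norm_I, Complex.norm_real, one_mul, mul_pow, mul_pow, inv_pow,
    ← mul_assoc, Real.norm_eq_abs t, sq_abs t, mul_inv_cancel₀ (pow_ne_zero 2 ht)] at h4
  norm_num at h4
  have h5 : ‖y‖ ^ 2 = 0 := by linarith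
  exact norm_eq_zero.1 (pow_eq_zero_iff (two_ne_zero) |>.1 h5)

namespace IsResolvent

variable {A : E →ₗ.[ℂ] E} {c c' : ℂ} {J J' : E →L[ℂ] E}

theorem map_apply (h : IsResolvent A c J) (hc : c ≠ 0) (x : A.domain) :
    A ⟨J x, h.mem x⟩ = J (A x) := by
  have h1 := h.right_inv x
  have h2 := h.left_inv x
  rw [map_add, map_smul] at h2
  have : c • A ⟨J x, h.mem x⟩ = c • J (A x) := by
    have := h1.trans h2.symm
    exact add_left_cancel this
  exact smul_right_injective E hc this

/-- `J'` commutes with `A` on the domain, so `(1 + c A) J' J f = J' (1 + c A) J f = J' f`; now apply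
`J`. -/
theorem commute (h : IsResolvent A c J) (h' : IsResolvent A c' J') (hc : c' ≠ 0) (f : E) :
    J (J' f) = J' (J f) := by
  have h1 := h'.map_apply hc ⟨J f, h.mem f⟩
  have h2 := h.left_inv ⟨J' (J f), h'.mem _⟩
  simp only at h1
  rw [h1] at h2
  simp only at h2
  rw [← h2, ← map_smul, ← map_add, h.right_inv]

theorem inner_eq (hs : ∀ x y : A.domain, inner ℂ (A x) (y : E) = inner ℂ (x : E) (A y))
    (h : IsResolvent A c J) (h' : IsResolvent A (starRingEnd ℂ c) J') (f g : E) :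
    inner ℂ (J f) g = inner ℂ f (J' g) := by
  conv_lhs => rw [← h'.right_inv g]
  conv_rhs => rw [← h.right_inv f]
  rw [inner_add_right, inner_add_left, inner_smul_right, inner_smul_left,
    hs ⟨J f, h.mem f⟩ ⟨J' g, h'.mem g⟩]

end IsResolvent

end Resolvent

/-! ## Stone's theorem -/

section BoundedGroup

variable {E : Type*} [NormedAddCommGroup E] [InnerProductSpace ℂ E] [CompleteSpace E]

/-- The group `e^{-itB}` of a bounded operator `B`. -/
noncomputable def expGroup (B : E →L[ℂ] E) (t : ℝ) : E →L[ℂ] E :=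
  NormedSpace.exp (t • (-Complex.I • B))

theorem expGroup_zero (B : E →L[ℂ] E) : expGroup B 0 = 1 := by
  simp [expGroup]

theorem expGroup_add (B : E →L[ℂ] E) (s t : ℝ) :
    expGroup B (s + t) = expGroup B s * expGroup B t := by
  let +nondep : NormedAlgebra ℚ (E →L[ℂ] E) := .restrictScalars ℚ ℂ _
  unfold expGroup
  rw [add_smul]
  exact NormedSpace.exp_add_of_commute
    ((Commute.refl (-Complex.I • B)).smul_left s |>.smul_right t)

theorem expGroup_add_of_commute {B C : E →L[ℂ] E} (h : Commute B C) (t : ℝ) :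
    expGroup (B + C) t = expGroup B t * expGroup C t := by
  let +nondep : NormedAlgebra ℚ (E →L[ℂ] E) := .restrictScalars ℚ ℂ _
  unfold expGroup
  rw [smul_add, smul_add]
  exact NormedSpace.exp_add_of_commute
    ((((h.smul_left (-Complex.I)).smul_right (-Complex.I)).smul_left t).smul_right t)

theorem hasDerivAt_expGroup (B : E →L[ℂ] E) (x : E) (t : ℝ) :
    HasDerivAt (fun t => expGroup B t x) (expGroup B t (-Complex.I • B x)) t := by
  have h := (hasDerivAt_exp_smul_const (𝕂 := ℝ) (-Complex.I • B) t)
  exact ((ContinuousLinearMap.apply ℂ E x).restrictScalars ℝ).hasFDerivAt.comp_hasDerivAt t h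

theorem star_expGroup {B : E →L[ℂ] E} (hB : IsSelfAdjoint B) (t : ℝ) :
    star (expGroup B t) = expGroup B (-t) := by
  unfold expGroup
  rw [NormedSpace.star_exp, star_smul, star_smul, hB.star_eq]
  simp

theorem inner_expGroup {B : E →L[ℂ] E} (hB : IsSelfAdjoint B) (t : ℝ) (x y : E) :
    inner ℂ (expGroup B t x) y = inner ℂ x (expGroup B (-t) y) := by
  rw [← star_expGroup hB, ContinuousLinearMap.star_eq_adjoint,
    ContinuousLinearMap.adjoint_inner_right]

theorem norm_expGroup {B : E →L[ℂ] E} (hB : IsSelfAdjoint B) (t : ℝ) (x : E) :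
    ‖expGroup B t x‖ = ‖x‖ := by
  have h : ‖expGroup B t x‖ ^ 2 = ‖x‖ ^ 2 := by
    rw [← @inner_self_eq_norm_sq ℂ, ← @inner_self_eq_norm_sq ℂ, inner_expGroup hB,
      ← mul_apply_eq_comp, ← expGroup_add, neg_add_cancel, expGroup_zero]
    rfl
  exact (sq_eq_sq₀ (norm_nonneg _) (norm_nonneg _)).1 h

theorem norm_expGroup_sub_le {B : E →L[ℂ] E} (hB : IsSelfAdjoint B) (t : ℝ) (x : E) :
    ‖expGroup B t x - x‖ ≤ |t| * ‖B x‖ := by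
  have h := Convex.norm_image_sub_le_of_norm_hasDerivWithin_le (s := Set.univ) (x := (0 : ℝ))
    (y := t) (C := ‖B x‖)
    (fun s _ => (hasDerivAt_expGroup B x s).hasDerivWithinAt)
    (fun s _ => by rw [norm_expGroup hB, norm_smul]; simp) convex_univ trivial trivial
  simpa [expGroup_zero, mul_comm] using h

/-- The derivative in `t` is `-i (e^{-isB} - 1) B x`; splitting `B x = (B x - y) + y` bounds it. The
estimate involves `B` only through `B x` and `B y`, not through `‖B‖`, so it survives the passage to
an unbounded limit; `y` stands in for `B x`, which need not stay in the domain then. -/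
theorem norm_expGroup_sub_add_le {B : E →L[ℂ] E} (hB : IsSelfAdjoint B) (t : ℝ) (x y : E) :
    ‖expGroup B t x - x + (t * Complex.I) • B x‖ ≤ |t| * (2 * ‖B x - y‖ + |t| * ‖B y‖) := by
  have hd : ∀ s ∈ Set.uIcc 0 t, HasDerivWithinAt
      (fun s : ℝ => expGroup B s x + (s * Complex.I) • B x)
      (expGroup B s (-Complex.I • B x) + Complex.I • B x) (Set.uIcc 0 t) s := by
    intro s _
    have h1 : HasDerivAt (fun s : ℝ => (s * Complex.I) • B x) (Complex.I • B x) s := by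
      have := ((Complex.ofRealCLM.hasDerivAt (x := s)).mul_const Complex.I).smul_const (B x)
      simpa using this
    exact ((hasDerivAt_expGroup B x s).add h1).hasDerivWithinAt
  have hb : ∀ s ∈ Set.uIcc 0 t, ‖expGroup B s (-Complex.I • B x) + Complex.I • B x‖ ≤
      2 * ‖B x - y‖ + |t| * ‖B y‖ := by
    intro s hs
    have e : expGroup B s (-Complex.I • B x) + Complex.I • B x =
        -Complex.I • (expGroup B s (B x - y) - (B x - y) + (expGroup B s y - y)) := by
      simp only [map_smul, map_sub]
      module
    have hst : |s| ≤ |t| := by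
      simpa using Set.abs_sub_left_of_mem_uIcc hs
    rw [e, norm_smul, norm_neg, Complex.norm_I, one_mul]
    refine (norm_add_le _ _).trans (add_le_add ((norm_sub_le _ _).trans ?_) ?_)
    · rw [norm_expGroup hB]; linarith
    · exact (norm_expGroup_sub_le hB s y).trans (by gcongr)
  have h := Convex.norm_image_sub_le_of_norm_hasDerivWithin_le hd hb (convex_uIcc 0 t)
    Set.left_mem_uIcc Set.right_mem_uIcc
  simp only [expGroup_zero, Complex.ofReal_zero, zero_mul, zero_smul, add_zero,
    one_apply_eq_self, sub_zero, Real.norm_eq_abs] at h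
  rw [mul_comm |t|]
  convert h using 2
  abel

end BoundedGroup

section Stone

variable {E : Type*} [NormedAddCommGroup E] [InnerProductSpace ℂ E] [CompleteSpace E]

/-- On the domain `J x - x = -c J (H x)`, which is `O(c)`; contractivity extends the limit by
density. -/
theorem tendsto_resolvent {H : E →ₗ.[ℂ] E} (hd : Dense (H.domain : Set E)) {c : ℕ → ℂ}
    (hc : Tendsto c atTop (𝓝 0))
    {J : ℕ → E →L[ℂ] E}
    (hJ : ∀ n, IsResolvent H (c n) (J n)) (f : E) : Tendsto (fun n => J n f) atTop (𝓝 f) := by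
  rw [Metric.tendsto_atTop]
  intro ε hε
  obtain ⟨x, hx, hxf⟩ := Metric.dense_iff.1 hd f (ε / 3) (by positivity)
  rw [Metric.mem_ball, dist_eq_norm] at hx
  have h1 : Tendsto (fun n => ‖c n‖ * ‖H ⟨x, hxf⟩‖) atTop (𝓝 0) := by
    simpa using hc.norm.mul_const ‖H ⟨x, hxf⟩‖
  obtain ⟨N, hN⟩ := eventually_atTop.1 (h1.eventually_lt_const (show 0 < ε / 3 by positivity))
  refine ⟨N, fun n hn => ?_⟩
  have h2 : ‖J n x - x‖ ≤ ‖c n‖ * ‖H ⟨x, hxf⟩‖ := by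
    have h3 := (hJ n).left_inv ⟨x, hxf⟩
    rw [map_add, map_smul] at h3
    have h4 : J n x - x = -(c n • J n (H ⟨x, hxf⟩)) := by
      rw [show J n x = x - c n • J n (H ⟨x, hxf⟩) from eq_sub_of_add_eq h3]
      abel
    rw [h4, norm_neg, norm_smul]
    gcongr
    exact (hJ n).norm_le _
  have e : J n f - f = (J n x - x) - (J n (x - f) - (x - f)) := by
    rw [map_sub]; abel
  rw [dist_eq_norm, e]
  have h5 := (hJ n).norm_le (x - f)
  have h6 := norm_sub_le (J n x - x) (J n (x - f) - (x - f))
  have h7 := norm_sub_le (J n (x - f)) (x - f)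
  have h8 := hN n hn
  linarith

/-- Bounded self-adjoint approximations of a self-adjoint operator. -/
theorem exists_bounded_approximation {H : E →ₗ.[ℂ] E} (hH : IsSelfAdjoint H) :
    ∃ B : ℕ → E →L[ℂ] E, (∀ n, IsSelfAdjoint (B n)) ∧ (∀ m n, Commute (B m) (B n)) ∧
      ∀ x : H.domain, Tendsto (fun n => B n x) atTop (𝓝 (H x)) := by
  have hs := inner_map_eq_of_isSelfAdjoint hH
  have hp : ∀ n : ℕ, ((n : ℝ) + 1)⁻¹ ≠ 0 := fun n => by positivity
  choose J hJ using fun n : ℕ => exists_resolvent_of_isSelfAdjoint hH (hp n)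
  choose K hK using fun n : ℕ => exists_resolvent_of_isSelfAdjoint hH (neg_ne_zero.2 (hp n))
  set c : ℕ → ℂ := fun n => Complex.I * (((n : ℝ) + 1)⁻¹ : ℝ) with hc
  have hc0 : ∀ n, c n ≠ 0 := fun n =>
    mul_ne_zero Complex.I_ne_zero (by exact_mod_cast hp n)
  have hck : ∀ n : ℕ, Complex.I * ((-((n : ℝ) + 1)⁻¹ : ℝ) : ℂ) = -c n := fun n => by
    simp [hc]
  have hconj : ∀ n, (starRingEnd ℂ) (c n) = -c n := fun n => by
    simp only [hc, map_mul, Complex.conj_I, Complex.conj_ofReal, neg_mul]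
  have hK' : ∀ n, IsResolvent H (-c n) (K n) := fun n => hck n ▸ hK n
  have hct : Tendsto c atTop (𝓝 0) := by
    have h1 : Tendsto (fun n : ℕ => ((n : ℝ) + 1)⁻¹) atTop (𝓝 0) := by
      simpa using tendsto_one_div_add_atTop_nhds_zero_nat (𝕜 := ℝ)
    have h2 : Tendsto (fun n : ℕ => ((((n : ℝ) + 1)⁻¹ : ℝ) : ℂ)) atTop (𝓝 ((0 : ℝ) : ℂ)) :=
      (Complex.continuous_ofReal.tendsto 0).comp h1
    simpa only [Complex.ofReal_zero, mul_zero] using h2.const_mul Complex.I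
  -- Since `J = (1 + cH)⁻¹` and `K = (1 - cH)⁻¹`, this is `H (1 - c²H²)⁻¹` with `-c² = (n+1)⁻² > 0`.
  -- It is self-adjoint because `J` and `K` are adjoint to each other and `c` is imaginary. On the
  -- domain it equals `(K + J) H / 2`.
  refine ⟨fun n => (2 * c n)⁻¹ • (K n - J n), fun n => ?_, fun m n => ?_, fun x => ?_⟩
  · rw [ContinuousLinearMap.isSelfAdjoint_iff_isSymmetric]
    intro f g
    have h1 := IsResolvent.inner_eq hs (hJ n) (by rw [hconj]; exact hK' n) f g
    have h2 := IsResolvent.inner_eq hs (hK' n)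
      (by rw [map_neg, hconj, neg_neg]; exact hJ n) f g
    change inner ℂ ((2 * c n)⁻¹ • (K n f - J n f)) g = inner ℂ f ((2 * c n)⁻¹ • (K n g - J n g))
    rw [inner_smul_left, inner_smul_right, inner_sub_left, inner_sub_right, h1, h2,
      map_inv₀, map_mul, hconj]
    simp only [map_ofNat]
    ring
  · refine (Commute.smul_left (Commute.smul_right ?_ _) _)
    have comm : ∀ {a b : ℂ} {P Q : E →L[ℂ] E}, IsResolvent H a P → IsResolvent H b Q → b ≠ 0 →
        Commute P Q := fun hP hQ hb => ContinuousLinearMap.ext fun f => hP.commute hQ hb f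
    exact ((comm (hK' m) (hK' n) (neg_ne_zero.2 (hc0 n))).sub_right
      (comm (hK' m) (hJ n) (hc0 n))).sub_left ((comm (hJ m) (hK' n) (neg_ne_zero.2 (hc0 n))).sub_right
      (comm (hJ m) (hJ n) (hc0 n)))
  · have h1 : ∀ n, ((2 * c n)⁻¹ • (K n - J n)) (x : E) =
        (1 / 2 : ℂ) • (K n (H x) + J n (H x)) := by
      intro n
      have hj := (hJ n).left_inv x
      have hk := (hK' n).left_inv x
      rw [map_add, map_smul] at hj hk
      have hcn : K n x - J n x = c n • (K n (H x) + J n (H x)) := by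
        have e1 : K n (x : E) = x - (-c n) • K n (H x) := eq_sub_of_add_eq hk
        have e2 : J n (x : E) = x - c n • J n (H x) := eq_sub_of_add_eq hj
        rw [e1, e2]; module
      change (2 * c n)⁻¹ • (K n x - J n x) = _
      rw [hcn, smul_smul]
      congr 1
      have := hc0 n
      field_simp
    have hJt := tendsto_resolvent hH.dense_domain hct hJ (H x)
    have hKt := tendsto_resolvent hH.dense_domain (by simpa using hct.neg) hK' (H x)
    simp only [h1]
    have := (hKt.add hJt).const_smul (1 / 2 : ℂ)
    convert this using 2
    module

/-- Commutation gives `e^{-itB} = e^{-itC} e^{-it(B-C)}`, whose first factor is isometric. -/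
theorem norm_expGroup_sub_expGroup_le {B C : E →L[ℂ] E} (hB : IsSelfAdjoint B)
    (hC : IsSelfAdjoint C) (h : Commute B C) (t : ℝ) (x : E) :
    ‖expGroup B t x - expGroup C t x‖ ≤ |t| * ‖B x - C x‖ := by
  have h1 : expGroup B t = expGroup C t * expGroup (B - C) t := by
    rw [← expGroup_add_of_commute (h.symm.sub_right (Commute.refl C))]
    congr 1
    abel
  have h2 : expGroup B t x - expGroup C t x = expGroup C t (expGroup (B - C) t x - x) := by
    rw [map_sub, h1]; rfl
  rw [h2, norm_expGroup hC]
  exact norm_expGroup_sub_le (hB.sub hC) t x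

/-- Stone's theorem: a self-adjoint operator generates a unitary group. -/
theorem exists_isUnitaryGroupOf {H : E →ₗ.[ℂ] E} (hH : IsSelfAdjoint H) :
    ∃ U : ℝ → E →L[ℂ] E, IsUnitaryGroupOf H U := by
  obtain ⟨B, hB, hcomm, hlim⟩ := exists_bounded_approximation hH
  have hdense := hH.dense_domain
  have hcau : ∀ (t : ℝ) (f : E), CauchySeq fun n => expGroup (B n) t f := by
    intro t f
    rw [Metric.cauchySeq_iff]
    intro ε hε
    obtain ⟨x, hx, hxD⟩ := Metric.dense_iff.1 hdense f (ε / 3) (by positivity)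
    rw [Metric.mem_ball, dist_eq_norm] at hx
    obtain ⟨N, hN⟩ := Metric.cauchySeq_iff.1 (hlim ⟨x, hxD⟩).cauchySeq (ε / 3 / (|t| + 1))
      (by positivity)
    refine ⟨N, fun m hm n hn => ?_⟩
    have h1 := norm_expGroup_sub_expGroup_le (hB m) (hB n) (hcomm m n) t x
    have h2 : |t| * ‖B m x - B n x‖ ≤ ε / 3 := by
      have h3 := (hN m hm n hn).le
      rw [dist_eq_norm, le_div_iff₀ (by positivity)] at h3
      simp only at h3
      nlinarith [norm_nonneg (B m x - B n x), abs_nonneg t]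
    have e : expGroup (B m) t f - expGroup (B n) t f =
        (expGroup (B m) t x - expGroup (B n) t x) - (expGroup (B m) t (x - f)
          - expGroup (B n) t (x - f)) := by
      simp only [map_sub]; abel
    rw [dist_eq_norm, e]
    have h4 := norm_sub_le (expGroup (B m) t x - expGroup (B n) t x)
      (expGroup (B m) t (x - f) - expGroup (B n) t (x - f))
    have h5 := norm_sub_le (expGroup (B m) t (x - f)) (expGroup (B n) t (x - f))
    rw [norm_expGroup (hB m), norm_expGroup (hB n)] at h5
    linarith
  choose u hu using fun t f => cauchySeq_tendsto_of_complete (hcau t f)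
  set U : ℝ → E →L[ℂ] E := fun t =>
    continuousLinearMapOfTendsto (fun n => expGroup (B n) t) (tendsto_pi_nhds.2 (hu t))
  have hU : ∀ t f, Tendsto (fun n => expGroup (B n) t f) atTop (𝓝 (U t f)) := hu
  have hnorm : ∀ t f, ‖U t f‖ = ‖f‖ := fun t f =>
    tendsto_nhds_unique (hU t f).norm (by simp only [norm_expGroup (hB _)]; exact tendsto_const_nhds)
  have hzero : U 0 = 1 := ContinuousLinearMap.ext fun f =>
    tendsto_nhds_unique (hU 0 f) (by simp only [expGroup_zero]; exact tendsto_const_nhds)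
  have hadd : ∀ s t, U (s + t) = U s * U t := by
    intro s t
    refine ContinuousLinearMap.ext fun f => tendsto_nhds_unique (hU (s + t) f) ?_
    have h1 := hU s (U t f)
    have h2 : Tendsto (fun n => expGroup (B n) s (expGroup (B n) t f - U t f)) atTop (𝓝 0) := by
      rw [tendsto_zero_iff_norm_tendsto_zero]
      simp only [norm_expGroup (hB _)]
      exact tendsto_iff_norm_sub_tendsto_zero.1 (hU t f)
    have h3 := h1.add h2
    rw [add_zero] at h3
    refine h3.congr fun n => ?_
    rw [← map_add, expGroup_add]
    simp
  have hinner : ∀ t f g, inner ℂ (U t f) g = inner ℂ f (U (-t) g) := fun t f g =>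
    tendsto_nhds_unique ((hU t f).inner tendsto_const_nhds)
      (by simp only [inner_expGroup (hB _)]; exact tendsto_const_nhds.inner (hU (-t) g))
  have hstar : ∀ t, star (U t) = U (-t) := by
    intro t
    refine ContinuousLinearMap.ext fun g => ext_inner_left ℂ fun f => ?_
    rw [ContinuousLinearMap.star_eq_adjoint, ContinuousLinearMap.adjoint_inner_right, hinner]
  have hderiv : ∀ (x : H.domain) (t : ℝ) (y : H.domain), ‖U t x - x + (t * Complex.I) • H x‖ ≤
      |t| * (2 * ‖H x - y‖ + |t| * ‖H y‖) := by
    intro x t y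
    refine le_of_tendsto_of_tendsto'
      ((((hU t x).sub_const (x : E)).add ((hlim x).const_smul (t * Complex.I : ℂ))).norm)
      (((((hlim x).sub_const (y : E)).norm.const_mul 2).add
        ((hlim y).norm.const_mul |t|)).const_mul |t|)
      fun n => norm_expGroup_sub_add_le (hB n) t x y
  have hgen : ∀ x : H.domain, Tendsto (fun t : ℝ => ((t : ℂ)⁻¹) • (U t x - x)) (𝓝[≠] 0)
      (𝓝 (-Complex.I • H x)) := by
    intro x
    rw [Metric.tendsto_nhdsWithin_nhds]
    intro ε hε
    -- `H x` need not lie in the domain, so a nearby `y` of the domain replaces it; `2‖H x - y‖ <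
    -- ε/2`, and the other half of `ε` pays for `|t| ‖H y‖`.
    obtain ⟨y, hy, hyD⟩ := Metric.dense_iff.1 hdense (H x) (ε / 4) (by positivity)
    rw [Metric.mem_ball, dist_eq_norm, norm_sub_rev] at hy
    refine ⟨ε / 2 / (‖H ⟨y, hyD⟩‖ + 1), by positivity, fun {t} ht0 ht => ?_⟩
    have ht0' : (t : ℂ) ≠ 0 := by exact_mod_cast ht0
    have h1 := hderiv x t ⟨y, hyD⟩
    rw [dist_zero_right, Real.norm_eq_abs, lt_div_iff₀ (by positivity)] at ht
    have e : ((t : ℂ)⁻¹) • (U t x - x) - (-Complex.I • H x) =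
        ((t : ℂ)⁻¹) • (U t x - x + (t * Complex.I) • H x) := by
      rw [smul_add, smul_smul, ← mul_assoc, inv_mul_cancel₀ ht0', one_mul, neg_smul, sub_neg_eq_add]
    have habs : 0 < |t| := abs_pos.2 ht0
    rw [dist_eq_norm, e, norm_smul, norm_inv, Complex.norm_real, Real.norm_eq_abs,
      inv_mul_lt_iff₀ habs]
    refine h1.trans_lt ((mul_lt_mul_iff_right₀ habs).2 ?_)
    nlinarith [norm_nonneg (H ⟨y, hyD⟩)]
  refine ⟨U, hzero, hadd, fun t => ?_, fun f => ?_, fun ψ χ => ⟨fun h => ?_, ?_⟩⟩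
  · rw [Unitary.mem_iff, hstar, ← hadd, ← hadd]
    simp [hzero]
  · have hle : ∀ (x : H.domain) t, ‖U t x - x‖ ≤ |t| * ‖H x‖ := fun x t =>
      le_of_tendsto_of_tendsto' ((hU t x).sub_const (x : E)).norm ((hlim x).norm.const_mul |t|)
        fun n => norm_expGroup_sub_le (hB n) t x
    rw [Metric.continuous_iff]
    intro s ε hε
    obtain ⟨x, hx, hxD⟩ := Metric.dense_iff.1 hdense f (ε / 3) (by positivity)
    rw [Metric.mem_ball, dist_eq_norm] at hx
    refine ⟨ε / 3 / (‖H ⟨x, hxD⟩‖ + 1), by positivity, fun t ht => ?_⟩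
    rw [dist_eq_norm, Real.norm_eq_abs, lt_div_iff₀ (by positivity)] at ht
    have e : U t f - U s f = U s ((U (t - s) x - x) - (U (t - s) (x - f) - (x - f))) := by
      have : U t = U s * U (t - s) := by rw [← hadd]; congr 1; ring
      rw [this]
      simp only [map_sub, mul_apply_eq_comp]
      abel
    rw [dist_eq_norm, e, hnorm]
    have h1 := hle ⟨x, hxD⟩ (t - s)
    have h2 := norm_sub_le (U (t - s) x - x) (U (t - s) (x - f) - (x - f))
    have h3 := norm_sub_le (U (t - s) (x - f)) (x - f)
    rw [hnorm] at h3
    simp only at h1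
    nlinarith [norm_nonneg (H ⟨x, hxD⟩), abs_nonneg (t - s)]
  -- The generator is no larger than `-iH`: paired with `x` in the domain, the quotient of `ψ` at
  -- `t` becomes the quotient of `x` at `-t`, so `ψ` is in the domain of the adjoint of `H`, which
  -- is `H`.
  · have h1 : ∀ x : H.domain, inner ℂ (Complex.I • χ) (x : E) = inner ℂ ψ (H x) := by
      intro x
      have h2 : Tendsto (fun t : ℝ => inner ℂ (((t : ℂ)⁻¹) • (U t ψ - ψ)) (x : E)) (𝓝[>] 0)
          (𝓝 (inner ℂ χ (x : E))) := h.inner tendsto_const_nhds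
      have hneg : Tendsto (fun t : ℝ => -t) (𝓝[>] 0) (𝓝[≠] 0) := by
        refine tendsto_nhdsWithin_iff.2 ⟨?_, ?_⟩
        · have : Tendsto (fun t : ℝ => -t) (𝓝 0) (𝓝 0) := by
            simpa using (continuous_neg (G := ℝ)).tendsto 0
          exact this.mono_left nhdsWithin_le_nhds
        · filter_upwards [self_mem_nhdsWithin] with t ht
          simpa using ne_of_gt ht
      have h3 := (((hgen x).comp hneg).const_smul (-1 : ℂ))
      have h4 : Tendsto (fun t : ℝ => inner ℂ (((t : ℂ)⁻¹) • (U t ψ - ψ)) (x : E)) (𝓝[>] 0)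
          (𝓝 (inner ℂ ψ ((-1 : ℂ) • -Complex.I • H x))) := by
        refine (tendsto_const_nhds.inner h3).congr fun t => ?_
        simp only [Function.comp_apply, inner_smul_left, inner_smul_right, inner_sub_left,
          inner_sub_right, hinner, map_inv₀, Complex.conj_ofReal, Complex.ofReal_neg, inv_neg]
        ring
      have h5 := tendsto_nhds_unique h2 h4
      rw [inner_smul_left, h5, inner_smul_right, inner_smul_right, Complex.conj_I]
      linear_combination (-inner ℂ ψ (H x)) * Complex.I_mul_I
    obtain ⟨h2, h3⟩ := mem_domain_of_isSelfAdjoint hH h1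
    refine ⟨h2, ?_⟩
    rw [h3, smul_smul, neg_mul, Complex.I_mul_I, neg_neg, one_smul]
  · rintro ⟨h, rfl⟩
    exact (hgen ⟨ψ, h⟩).mono_left (nhdsWithin_mono _ fun t ht => ne_of_gt ht)

end Stone

/-! ### Unitary groups on the domain of the generator: invariance, derivatives, uniqueness -/

namespace IsUnitaryGroupOf

variable {E : Type*} [NormedAddCommGroup E] [InnerProductSpace ℂ E] [CompleteSpace E]
variable {H : E →ₗ.[ℂ] E} {U V : ℝ → E →L[ℂ] E}

theorem norm_apply (h : IsUnitaryGroupOf H U) (t : ℝ) (x : E) : ‖U t x‖ = ‖x‖ :=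
  ContinuousLinearMap.norm_map_of_mem_unitary (h.unitary t) x

theorem add_apply (h : IsUnitaryGroupOf H U) (s t : ℝ) (x : E) : U (s + t) x = U s (U t x) := by
  rw [h.add]; rfl

theorem commute_apply (h : IsUnitaryGroupOf H U) (s t : ℝ) (x : E) :
    U s (U t x) = U t (U s x) := by
  rw [← h.add_apply, add_comm, h.add_apply]

theorem tendsto_generator (h : IsUnitaryGroupOf H U) (x : H.domain) :
    Tendsto (fun t : ℝ => ((t : ℂ)⁻¹) • (U t x - x)) (𝓝[>] 0) (𝓝 (-Complex.I • H x)) :=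
  (h.generator _ _).2 ⟨x.2, rfl⟩

/-- `U t` commutes with the difference quotients, so those of `U t x` converge too, and convergence
characterizes the domain. -/
theorem map_mem (h : IsUnitaryGroupOf H U) (t : ℝ) (x : H.domain) :
    ∃ hx : U t x ∈ H.domain, H ⟨U t x, hx⟩ = U t (H x) := by
  have h1 := ((U t).continuous.tendsto _).comp (h.tendsto_generator x)
  have h2 : Tendsto (fun s : ℝ => ((s : ℂ)⁻¹) • (U s (U t x) - U t x)) (𝓝[>] 0)
      (𝓝 (U t (-Complex.I • H x))) := by
    refine h1.congr fun s => ?_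
    rw [Function.comp_apply, map_smul, map_sub, h.commute_apply]
  obtain ⟨hx, hx2⟩ := (h.generator _ _).1 h2
  refine ⟨hx, ?_⟩
  rw [map_smul] at hx2
  exact (smul_right_injective E (neg_ne_zero.2 Complex.I_ne_zero) hx2).symm

theorem hasDerivAt (h : IsUnitaryGroupOf H U) (x : H.domain) (t : ℝ) :
    HasDerivAt (fun t => U t x) (-Complex.I • U t (H x)) t := by
  have key : Tendsto (fun s : ℝ => (s⁻¹ : ℝ) • (U s x - x)) (𝓝[>] 0) (𝓝 (-Complex.I • H x)) := by
    refine (h.tendsto_generator x).congr fun s => ?_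
    rw [← Complex.ofReal_inv]
    rfl
  rw [hasDerivAt_iff_tendsto_slope_zero, ← nhdsLT_sup_nhdsGT, ← map_smul]
  refine Tendsto.sup ?_ ?_
  -- The generator only gives the right derivative at `0`. For `s < 0` the quotient at `t` is `U (t
  -- + s)` applied to the quotient at `-s > 0`, and `U` is isometric and strongly continuous.
  · have hneg : Tendsto (fun s : ℝ => -s) (𝓝[<] 0) (𝓝[>] 0) := by
      refine tendsto_nhdsWithin_iff.2 ⟨?_, ?_⟩
      · have : Tendsto (fun t : ℝ => -t) (𝓝 0) (𝓝 0) := by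
          simpa using (continuous_neg (G := ℝ)).tendsto 0
        exact this.mono_left nhdsWithin_le_nhds
      · filter_upwards [self_mem_nhdsWithin] with s hs
        simpa using hs
    have h1 := key.comp hneg
    have h2 : Tendsto (fun s : ℝ => U (t + s) (-Complex.I • H x)) (𝓝[<] 0)
        (𝓝 (U t (-Complex.I • H x))) := by
      have hc : Continuous fun s : ℝ => U (t + s) (-Complex.I • H x) :=
        (h.strongly_continuous _).comp (continuous_const.add continuous_id)
      have := hc.tendsto 0
      rw [add_zero] at this
      exact this.mono_left nhdsWithin_le_nhds
    have h3 : Tendsto (fun s : ℝ => U (t + s) ((-s)⁻¹ • (U (-s) x - x) - -Complex.I • H x))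
        (𝓝[<] 0) (𝓝 0) := by
      rw [tendsto_zero_iff_norm_tendsto_zero]
      simp only [h.norm_apply]
      exact tendsto_iff_norm_sub_tendsto_zero.1 h1
    have h4 := h3.add h2
    rw [zero_add] at h4
    refine h4.congr fun s => ?_
    have e : U (t + s) (U (-s) x) = U t x := by
      rw [← h.add_apply]; congr 2; ring
    simp only [map_sub]
    rw [sub_add_cancel, ContinuousLinearMap.map_smul_of_tower, map_sub, e, inv_neg, neg_smul, ← smul_neg, neg_sub]
  · refine (((U t).continuous.tendsto _).comp key).congr fun s => ?_
    simp only [Function.comp_apply]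
    rw [h.add_apply, ← map_sub, ContinuousLinearMap.map_smul_of_tower]

theorem isClassicalSolution (h : IsUnitaryGroupOf H U) {x : E} (hx : x ∈ H.domain) :
    IsClassicalSolution H x (fun t => U t x) := by
  have hd := h.hasDerivAt ⟨x, hx⟩
  refine ⟨by simp [h.zero], ?_, fun t => ?_⟩
  · rw [contDiff_one_iff_deriv]
    refine ⟨fun t => (hd t).differentiableAt, ?_⟩
    have : deriv (fun t => U t x) = fun t => -Complex.I • U t (H ⟨x, hx⟩) :=
      funext fun t => (hd t).deriv
    rw [this]
    exact (h.strongly_continuous _).const_smul _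
  · obtain ⟨h1, h2⟩ := h.map_mem t ⟨x, hx⟩
    refine ⟨h1, ?_⟩
    rw [h2, (hd t).deriv, smul_smul, mul_neg, Complex.I_mul_I, neg_neg, one_smul]

/-- For `x` in the domain, symmetry of `H` makes the derivative of `‖U t x - V t x‖²` vanish, and
the value at `t = 0` is zero; density does the rest. -/
theorem eq_of_isSelfAdjoint (hH : IsSelfAdjoint H) (h : IsUnitaryGroupOf H U)
    (h' : IsUnitaryGroupOf H V) : U = V := by
  have hs := inner_map_eq_of_isSelfAdjoint hH
  funext t
  refine ContinuousLinearMap.ext fun f => ?_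
  have key : ∀ x : H.domain, U t x = V t x := by
    intro x
    have hder : ∀ t, HasDerivAt (fun t => inner ℂ (U t x - V t x) (U t x - V t x)) 0 t := by
      intro t
      have h1 := (h.hasDerivAt x t).sub (h'.hasDerivAt x t)
      have h2 := h1.inner ℂ h1
      obtain ⟨hu, hu'⟩ := h.map_mem t x
      obtain ⟨hv, hv'⟩ := h'.map_mem t x
      have h3 := hs (⟨U t x, hu⟩ - ⟨V t x, hv⟩) (⟨U t x, hu⟩ - ⟨V t x, hv⟩)
      rw [LinearPMap.map_sub, hu', hv'] at h3
      refine h2.congr_deriv ?_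
      have e : -Complex.I • U t (H x) - -Complex.I • V t (H x) =
          -Complex.I • (U t (H x) - V t (H x)) := (smul_sub _ _ _).symm
      simp only [Pi.sub_apply]
      rw [e, inner_smul_left, inner_smul_right]
      simp only [Submodule.coe_sub] at h3
      rw [h3, map_neg, Complex.conj_I]
      ring
    have hconst := is_const_of_deriv_eq_zero (fun t => (hder t).differentiableAt)
      (fun t => (hder t).deriv) t 0
    simp only [h.zero, h'.zero, sub_self, inner_zero_left] at hconst
    exact sub_eq_zero.1 (inner_self_eq_zero.1 hconst)
  exact congrFun (Continuous.ext_on hH.dense_domain (U t).continuous (V t).continuous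
    fun x hx => key ⟨x, hx⟩) f

theorem norm_sub_sub_le (h : IsUnitaryGroupOf H U) (x : H.domain) {t δ : ℝ} (ht : 0 ≤ t)
    (hδ : ∀ s ∈ Set.Icc 0 t, ‖U s (H x) - H x‖ ≤ δ) :
    ‖U t x - x + (t * Complex.I) • H x‖ ≤ t * δ := by
  have hd : ∀ s ∈ Set.Icc 0 t, HasDerivWithinAt
      (fun s : ℝ => U s x + (s * Complex.I) • H x)
      (-Complex.I • U s (H x) + Complex.I • H x) (Set.Icc 0 t) s := by
    intro s _
    have h1 : HasDerivAt (fun s : ℝ => (s * Complex.I) • H x) (Complex.I • H x) s := by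
      have := ((Complex.ofRealCLM.hasDerivAt (x := s)).mul_const Complex.I).smul_const (H x)
      simpa using this
    exact ((h.hasDerivAt x s).add h1).hasDerivWithinAt
  have hb : ∀ s ∈ Set.Icc 0 t, ‖-Complex.I • U s (H x) + Complex.I • H x‖ ≤ δ := by
    intro s hs
    have e : -Complex.I • U s (H x) + Complex.I • H x = -Complex.I • (U s (H x) - H x) := by
      module
    rw [e, norm_smul, norm_neg, Complex.norm_I, one_mul]
    exact hδ s hs
  have h3 := Convex.norm_image_sub_le_of_norm_hasDerivWithin_le hd hb (convex_Icc 0 t)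
    (Set.left_mem_Icc.2 ht) (Set.right_mem_Icc.2 ht)
  simp only [h.zero, Complex.ofReal_zero, zero_mul, zero_smul, add_zero,
    one_apply_eq_self, sub_zero, Real.norm_eq_abs, abs_of_nonneg ht] at h3
  rw [mul_comm t]
  convert h3 using 2
  abel

theorem map_resolvent (h : IsUnitaryGroupOf H U) {c : ℂ} {R : E →L[ℂ] E} (hR : IsResolvent H c R)
    (t : ℝ) (f : E) : R (U t f) = U t (R f) := by
  obtain ⟨h1, h2⟩ := h.map_mem t ⟨R f, hR.mem f⟩
  have h3 := hR.left_inv ⟨U t (R f), h1⟩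
  simp only at h2 h3
  rw [h2, ← map_smul, ← map_add, hR.right_inv] at h3
  exact h3

end IsUnitaryGroupOf

/-! ## Chernoff's theorem -/

section Chernoff

variable {E : Type*} [NormedAddCommGroup E] [InnerProductSpace ℂ E] [CompleteSpace E]

/-- The resolvent at `1` of the difference quotient `h⁻¹ (S - 1)` of a contraction `S`. -/
theorem exists_contraction_resolvent {S : E →L[ℂ] E} (hS : ∀ x, ‖S x‖ ≤ ‖x‖) {h : ℝ}
    (hh : 0 < h) : ∃ J : E →L[ℂ] E, (∀ x, ‖J x‖ ≤ ‖x‖) ∧ (∀ x, J (S x) = S (J x)) ∧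
      ∀ x, J x - ((h : ℂ)⁻¹) • J (S x - x) = x := by
  have hh' : (h : ℂ) ≠ 0 := by exact_mod_cast hh.ne'
  set T : E →L[ℂ] E := 1 - (h : ℂ)⁻¹ • (S - 1) with hT
  have hTa : ∀ x, T x = x - (h : ℂ)⁻¹ • (S x - x) := fun x => rfl
  have hSn : ‖S‖ ≤ 1 := S.opNorm_le_bound zero_le_one fun x => by simpa using hS x
  have hh1 : ((1 + h : ℝ) : ℂ) ≠ 0 := by exact_mod_cast (by positivity : (1 + h : ℝ) ≠ 0)
  have hunit : IsUnit T := by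
    have h1 : ‖(((1 + h : ℝ) : ℂ)⁻¹) • S‖ < 1 := by
      rw [norm_smul, norm_inv, Complex.norm_real, Real.norm_of_nonneg (by positivity),
        inv_mul_lt_iff₀ (by positivity)]
      linarith
    have h2 := isUnit_one_sub_of_norm_lt_one h1
    -- Factoring out `(1 + h)/h` leaves a Neumann series in `S/(1 + h)`, of norm below `1`.
    have h3 : T = (((1 + h : ℝ) : ℂ) * (h : ℂ)⁻¹) • (1 - (((1 + h : ℝ) : ℂ)⁻¹) • S) := by
      rw [smul_sub (((1 + h : ℝ) : ℂ) * (h : ℂ)⁻¹) 1, smul_smul]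
      have e1 : ((1 + h : ℝ) : ℂ) * (h : ℂ)⁻¹ * (((1 + h : ℝ) : ℂ)⁻¹) = (h : ℂ)⁻¹ := by
        field_simp
      have e2 : ((1 + h : ℝ) : ℂ) * (h : ℂ)⁻¹ = (h : ℂ)⁻¹ + 1 := by
        push_cast
        field_simp
      rw [e1, e2, hT]
      module
    rw [h3]
    exact h2.smul (Units.mk0 _ (mul_ne_zero hh1 (inv_ne_zero hh')))
  have hcomm : Commute T S := by
    rw [hT]
    exact (Commute.one_left S).sub_left
      (((Commute.refl S).sub_left (Commute.one_left S)).smul_left _)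
  have hbound : ∀ x, ‖x‖ ≤ ‖T x‖ := by
    intro x
    have e : T x = ((1 + h⁻¹ : ℝ) : ℂ) • x - (h : ℂ)⁻¹ • S x := by
      rw [hTa]
      push_cast
      module
    have h1 := norm_sub_norm_le (((1 + h⁻¹ : ℝ) : ℂ) • x) ((h : ℂ)⁻¹ • S x)
    rw [← e, norm_smul, norm_smul, norm_inv, Complex.norm_real, Complex.norm_real,
      Real.norm_of_nonneg (by positivity), Real.norm_of_nonneg hh.le] at h1
    have h2 : h⁻¹ * ‖S x‖ ≤ h⁻¹ * ‖x‖ := by gcongr; exact hS x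
    linarith
  have hTJ : ∀ x, T (Ring.inverse T x) = x := fun x =>
    congrArg (fun A : E →L[ℂ] E => A x) (Ring.mul_inverse_cancel T hunit)
  have hJT : ∀ x, Ring.inverse T (T x) = x := fun x =>
    congrArg (fun A : E →L[ℂ] E => A x) (Ring.inverse_mul_cancel T hunit)
  refine ⟨Ring.inverse T, fun x => ?_, fun x => ?_, fun x => ?_⟩
  · simpa only [hTJ] using hbound (Ring.inverse T x)
  · have h1 : T (S (Ring.inverse T x)) = S x := by
      have := congrArg (fun A : E →L[ℂ] E => A (Ring.inverse T x)) hcomm.eq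
      simp only [mul_apply_eq_comp] at this
      rw [this, hTJ]
    rw [← h1, hJT]
  · rw [← map_smul, ← map_sub, ← hTa, hJT]

/-- Equibounded operators that converge pointwise converge uniformly on compact sets, by a finite
net. This is applied to orbits of the group over `[0, T]`, and is what makes Chernoff's limit
locally uniform in time. -/
theorem eventually_forall_norm_le_of_isCompact {ι : Type*} {l : Filter ι} {D : ι → E →L[ℂ] E}
    {C : ℝ} (hC : ∀ᶠ i in l, ∀ x, ‖D i x‖ ≤ C * ‖x‖)
    (hD : ∀ x, Tendsto (fun i => D i x) l (𝓝 0)) {K : Set E} (hK : IsCompact K) {ε : ℝ}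
    (hε : 0 < ε) : ∀ᶠ i in l, ∀ x ∈ K, ‖D i x‖ ≤ ε := by
  obtain ⟨s, _, hsf, hs⟩ := hK.finite_cover_balls (e := ε / 2 / (|C| + 1)) (by positivity)
  have h1 : ∀ᶠ i in l, ∀ y ∈ s, ‖D i y‖ ≤ ε / 2 := by
    rw [hsf.eventually_all]
    intro y _
    have := (tendsto_zero_iff_norm_tendsto_zero.1 (hD y)).eventually_lt_const
      (show 0 < ε / 2 by positivity)
    exact this.mono fun i hi => hi.le
  filter_upwards [h1, hC] with i hi hCi x hx
  obtain ⟨y, hy, hxy⟩ := Set.mem_iUnion₂.1 (hs hx)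
  rw [Metric.mem_ball, dist_eq_norm, lt_div_iff₀ (by positivity)] at hxy
  have h2 := hi y hy
  have h3 := hCi (x - y)
  rw [map_sub] at h3
  have h4 := norm_sub_norm_le (D i x) (D i y)
  have h5 : C * ‖x - y‖ ≤ |C| * ‖x - y‖ := by gcongr; exact le_abs_self C
  nlinarith [norm_nonneg (x - y)]

variable {H : E →ₗ.[ℂ] E} {U : ℝ → E →L[ℂ] E} {R : E →L[ℂ] E}

/-- One step of the telescoping estimate in Chernoff's theorem. -/
theorem norm_resolvent_step_le (hU : IsUnitaryGroupOf H U) (hR : IsResolvent H Complex.I R)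
    {S J : E →L[ℂ] E} {h δ₁ δ₂ : ℝ} (hh : 0 < h) (hJ : ∀ x, ‖J x‖ ≤ ‖x‖)
    (hJ' : ∀ x, J x - ((h : ℂ)⁻¹) • J (S x - x) = x) {g : E} (h1 : ‖J g - R g‖ ≤ δ₁)
    (h2 : ∀ s ∈ Set.Icc 0 h, ‖U s (R g - g) - (R g - g)‖ ≤ δ₂) :
    ‖J (S (R g) - U h (R g))‖ ≤ h * (δ₁ + δ₂) := by
  have hh' : (h : ℂ) ≠ 0 := by exact_mod_cast hh.ne'
  have hA : R g - g = -Complex.I • H ⟨R g, hR.mem g⟩ := by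
    rw [neg_smul, eq_neg_iff_add_eq_zero, sub_add_eq_add_sub, sub_eq_zero]
    exact hR.right_inv g
  have h3 := hU.norm_sub_sub_le ⟨R g, hR.mem g⟩ (t := h) (δ := δ₂) hh.le (by
    intro s hs
    have h4 := h2 s hs
    rw [hA, map_smul, ← smul_sub, norm_smul, norm_neg, Complex.norm_I, one_mul] at h4
    exact h4)
  simp only at h3
  have hA' : ((h : ℂ) * Complex.I) • H ⟨R g, hR.mem g⟩ = -((h : ℂ) • (R g - g)) := by
    rw [hA, smul_smul, ← neg_smul]
    congr 1
    ring
  rw [hA', ← sub_eq_add_neg] at h3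
  have h5 : J (S (R g) - R g) = (h : ℂ) • (J (R g) - R g) := by
    have h6 := hJ' (R g)
    rw [sub_eq_iff_eq_add, ← sub_eq_iff_eq_add'] at h6
    rw [h6, smul_smul, mul_inv_cancel₀ hh', one_smul]
  -- With `A = -iH`: `J (S - 1) = h (J - 1)`, `A R g = R g - g`, and `U h R g - R g` is `h A R g` up
  -- to the error bounded in `h3`. The terms `h J R g` cancel, leaving `h (J - R) g` and the error.
  have e : J (S (R g) - U h (R g)) =
      (h : ℂ) • (J g - R g) - J (U h (R g) - R g - (h : ℂ) • (R g - g)) := by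
    have e1 : S (R g) - U h (R g) = (S (R g) - R g) - (U h (R g) - R g - (h : ℂ) • (R g - g))
        - (h : ℂ) • (R g - g) := by abel
    rw [e1, map_sub, map_sub, h5, map_smul, map_sub J (R g) g]
    module
  rw [e]
  have h7 := hJ (U h (R g) - R g - (h : ℂ) • (R g - g))
  refine (norm_sub_le _ _).trans ?_
  rw [norm_smul, Complex.norm_real, Real.norm_of_nonneg hh.le]
  nlinarith

/-- Telescoping: `J` commutes with the contraction `S`, so the one-step errors add up and a single
`J` in front suffices. The bound `δ₁` is needed along the whole orbit of `f`; `δ₂` only at `f`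
itself, because the isometric `U` commutes with `R` and with itself. -/
theorem norm_resolvent_pow_sub_le (hU : IsUnitaryGroupOf H U) (hR : IsResolvent H Complex.I R)
    {S J : E →L[ℂ] E} {h δ₁ δ₂ T : ℝ} (hh : 0 < h) (hS : ∀ x, ‖S x‖ ≤ ‖x‖)
    (hJ : ∀ x, ‖J x‖ ≤ ‖x‖) (hJS : ∀ x, J (S x) = S (J x))
    (hJ' : ∀ x, J x - ((h : ℂ)⁻¹) • J (S x - x) = x) {f : E}
    (h1 : ∀ s ∈ Set.Icc 0 T, ‖J (U s f) - R (U s f)‖ ≤ δ₁)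
    (h2 : ∀ s ∈ Set.Icc 0 h, ‖U s (R f - f) - (R f - f)‖ ≤ δ₂) (n : ℕ) (hn : n * h ≤ T) :
    ‖J ((S ^ n) (R f) - U (n * h) (R f))‖ ≤ n * h * (δ₁ + δ₂) := by
  induction n with
  | zero => simp [hU.zero]
  | succ n ih =>
    simp only [Nat.cast_add, Nat.cast_one] at hn ⊢
    have hn' : n * h ≤ T := by nlinarith
    have h3 := norm_resolvent_step_le hU hR (S := S) hh hJ hJ' (g := U (n * h) f) (δ₂ := δ₂)
      (h1 _ ⟨by positivity, hn'⟩) (by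
        intro s hs
        rw [hU.map_resolvent hR, ← map_sub, hU.commute_apply, ← map_sub, hU.norm_apply]
        exact h2 s hs)
    rw [hU.map_resolvent hR] at h3
    have e : (S ^ (n + 1)) (R f) - U ((n + 1) * h) (R f) =
        S ((S ^ n) (R f) - U (n * h) (R f)) +
          (S (U (n * h) (R f)) - U h (U (n * h) (R f))) := by
      rw [pow_succ', add_mul, one_mul, add_comm ((n : ℝ) * h), hU.add_apply, map_sub,
        mul_apply_eq_comp]
      abel
    rw [e, map_add, hJS]
    refine (norm_add_le _ _).trans ?_
    have h4 := hS (J ((S ^ n) (R f) - U (n * h) (R f)))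
    have h5 := ih hn'
    linarith

/-- The resolvents of the difference quotients converge strongly. -/
theorem tendsto_contraction_resolvent (hR : IsResolvent H Complex.I R) {ι : Type*} {l : Filter ι}
    {S J : ι → E →L[ℂ] E} {h : ι → ℝ} (hJ : ∀ᶠ i in l, ∀ x, ‖J i x‖ ≤ ‖x‖)
    (hJ' : ∀ᶠ i in l, ∀ x, J i x - ((h i : ℂ)⁻¹) • J i (S i x - x) = x) {P : Set H.domain}
    (hP : ∀ x : H.domain, ∀ ε > 0, ∃ y ∈ P, ‖(x : E) - y‖ < ε ∧ ‖H x - H y‖ < ε)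
    (hcons : ∀ y ∈ P, Tendsto (fun i => ((h i : ℂ)⁻¹) • (S i (y : E) - y)) l
      (𝓝 (-Complex.I • H y))) (f : E) : Tendsto (fun i => J i f - R f) l (𝓝 0) := by
  rw [Metric.tendsto_nhds]
  intro ε hε
  obtain ⟨y, hyP, hy1, hy2⟩ := hP ⟨R f, hR.mem f⟩ (ε / 8) (by positivity)
  simp only at hy1
  -- For `y` in the core and close to `R f`, the vector `f' = (1 + iH) y` is close to `f` and `R f'
  -- = y`. Then `J f' - y` is `J` applied to the consistency error at `y`.
  set f' : E := (y : E) + Complex.I • H y with hf'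
  have hff' : ‖f - f'‖ ≤ ε / 4 := by
    have e : f - f' = (R f - y) + Complex.I • (H ⟨R f, hR.mem f⟩ - H y) := by
      conv_lhs => rw [← hR.right_inv f]
      rw [hf']
      module
    rw [e]
    refine (norm_add_le _ _).trans ?_
    rw [norm_smul, Complex.norm_I, one_mul]
    linarith
  have hc := (tendsto_iff_norm_sub_tendsto_zero.1 (hcons y hyP)).eventually_lt_const
    (show 0 < ε / 4 by positivity)
  filter_upwards [hJ, hJ', hc] with i h1 h2 h3
  have h4 : J i f' - R f' =
      J i (((h i : ℂ)⁻¹) • (S i (y : E) - y) - -Complex.I • H y) := by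
    have h5 : R f' = y := hR.left_inv y
    have h6 := h2 y
    rw [h5, hf']
    simp only [map_sub, map_smul, map_add] at h6 ⊢
    linear_combination (norm := module) h6
  have e : J i f - R f = (J i f' - R f') + (J i (f - f') - R (f - f')) := by
    simp only [map_sub]; abel
  rw [dist_zero_right, e]
  have h7 := h1 (((h i : ℂ)⁻¹) • (S i (y : E) - y) - -Complex.I • H y)
  have h8 := norm_add_le (J i f' - R f') (J i (f - f') - R (f - f'))
  have h9 := norm_sub_le (J i (f - f')) (R (f - f'))
  have h10 := h1 (f - f')
  have h11 := hR.norm_le (f - f')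
  rw [h4] at h8 ⊢
  linarith

/-- **Chernoff's theorem** for unitary groups. -/
theorem chernoffEquivalent (hH : IsSelfAdjoint H) (hU : IsUnitaryGroupOf H U)
    {S : ℝ≥0 → E →L[ℂ] E} (hS0 : S 0 = 1) (hS : ∀ h x, ‖S h x‖ ≤ ‖x‖) {P : Set H.domain}
    (hP : ∀ x : H.domain, ∀ ε > 0, ∃ y ∈ P, ‖(x : E) - y‖ < ε ∧ ‖H x - H y‖ < ε)
    (hcons : ∀ y ∈ P, Tendsto (fun h : ℝ≥0 => (((h : ℝ) : ℂ)⁻¹) • (S h (y : E) - y)) (𝓝[>] 0)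
      (𝓝 (-Complex.I • H y))) : ChernoffEquivalent S (fun t => U t) := by
  obtain ⟨R, hR⟩ := exists_resolvent_of_isSelfAdjoint hH one_ne_zero
  rw [Complex.ofReal_one, mul_one] at hR
  have hex : ∀ h : ℝ≥0, ∃ J : E →L[ℂ] E, 0 < h → (∀ x, ‖J x‖ ≤ ‖x‖) ∧
      (∀ x, J (S h x) = S h (J x)) ∧ ∀ x, J x - (((h : ℝ) : ℂ)⁻¹) • J (S h x - x) = x := by
    intro h
    rcases eq_or_ne h 0 with rfl | h0
    · exact ⟨0, fun h => absurd h (lt_irrefl 0)⟩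
    · obtain ⟨J, hJ⟩ := exists_contraction_resolvent (hS h)
        (show (0 : ℝ) < h by exact_mod_cast pos_iff_ne_zero.2 h0)
      exact ⟨J, fun _ => hJ⟩
  choose J hJ using hex
  have hpos : ∀ᶠ h : ℝ≥0 in 𝓝[>] 0, 0 < h := self_mem_nhdsWithin
  have hD : ∀ f, Tendsto (fun h => (J h - R) f) (𝓝[>] 0) (𝓝 0) := fun f =>
    tendsto_contraction_resolvent hR (hpos.mono fun h hh => (hJ h hh).1)
      (hpos.mono fun h hh => (hJ h hh).2.2) hP hcons f
  have hDb : ∀ᶠ h in 𝓝[>] 0, ∀ x, ‖(J h - R) x‖ ≤ 2 * ‖x‖ := hpos.mono fun h hh x => by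
    have h1 := norm_sub_le (J h x) (R x)
    have h2 := (hJ h hh).1 x
    have h3 := hR.norm_le x
    simp only [sub_apply]
    linarith
  intro ψ T hT
  have hTR : (0 : ℝ) < T := by exact_mod_cast hT
  -- it is enough to control small time steps
  suffices hmain : ∀ ε > 0, ∀ᶠ h : ℝ≥0 in 𝓝[>] 0, ∀ n : ℕ, n * (h : ℝ) ≤ T →
      ‖(S h ^ n) ψ - U (n * h) ψ‖ ≤ ε by
    rw [ENNReal.tendsto_nhds_zero]
    intro ε hε
    -- A finite positive bound below `ε`, which may be infinite.
    obtain ⟨ε', hε'0, hε'⟩ := ENNReal.lt_iff_exists_nnreal_btwn.1 hε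
    have hε'0' : (0 : ℝ) < ε' := by exact_mod_cast hε'0
    have h1 := hmain ε' hε'0'
    rw [eventually_nhdsWithin_iff, Metric.eventually_nhds_iff] at h1
    obtain ⟨δ, hδ, h2⟩ := h1
    obtain ⟨N, hN⟩ := exists_nat_gt ((T : ℝ) / δ)
    filter_upwards [eventually_ge_atTop (max N 1)] with n hn
    have hnN : (N : ℝ) ≤ n := by exact_mod_cast (le_max_left _ _).trans hn
    have hn1 : (0 : ℝ) < n := by exact_mod_cast (le_max_right N 1).trans hn
    refine iSup₂_le fun t ht => le_trans ?_ hε'.le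
    rcases eq_or_ne t 0 with rfl | ht0
    · simp [hS0, hU.zero]
    have htpos : 0 < t := pos_iff_ne_zero.2 ht0
    have hnt : (n : ℝ) * ((t / n : ℝ≥0) : ℝ) = t := by
      push_cast
      field_simp
    have htT : (t : ℝ) ≤ T := by exact_mod_cast ht.2
    have h3 := @h2 (t / n) (by
      rw [NNReal.dist_eq]
      push_cast
      rw [sub_zero, abs_of_nonneg (by positivity), div_lt_iff₀ hn1]
      rw [div_lt_iff₀ hδ] at hN
      nlinarith) (by
        refine Set.mem_Ioi.2 (div_pos htpos ?_)
        exact_mod_cast hn1) n (hnt.trans_le htT)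
    rw [hnt] at h3
    rw [← ofReal_norm, ← ENNReal.ofReal_coe_nnreal]
    exact ENNReal.ofReal_le_ofReal h3
  have hpow : ∀ h n x, ‖(S h ^ n) x‖ ≤ ‖x‖ := by
    intro h n
    induction n with
    | zero => simp
    | succ n ih =>
      intro x
      rw [pow_succ', mul_apply_eq_comp]
      exact (hS h _).trans (ih x)
  -- vectors in the range of the squared resolvent
  have hrange : ∀ f : E, ∀ ε > 0, ∀ᶠ h : ℝ≥0 in 𝓝[>] 0, ∀ n : ℕ, n * (h : ℝ) ≤ T →
      ‖(S h ^ n) (R (R f)) - U (n * h) (R (R f))‖ ≤ ε := by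
    intro f ε hε
    have hK : ∀ g : E, IsCompact ((fun s => U s g) '' Set.Icc (0 : ℝ) T) := fun g =>
      isCompact_Icc.image (hU.strongly_continuous g)
    have h1 := eventually_forall_norm_le_of_isCompact hDb hD (hK f)
      (show 0 < ε / 4 / T by positivity)
    have h2 := eventually_forall_norm_le_of_isCompact hDb hD (hK (R f))
      (show 0 < ε / 4 by positivity)
    have hcont : Tendsto (fun s => U s (R f - f) - (R f - f)) (𝓝 0) (𝓝 0) := by
      have := ((hU.strongly_continuous (R f - f)).sub continuous_const).tendsto 0
        (f := fun s => U s (R f - f) - (R f - f))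
      simpa [hU.zero] using this
    obtain ⟨δ, hδ, h3⟩ := Metric.eventually_nhds_iff.1
      ((tendsto_zero_iff_norm_tendsto_zero.1 hcont).eventually_lt_const
        (show 0 < ε / 4 / T by positivity))
    have h4 : ∀ᶠ h : ℝ≥0 in 𝓝[>] 0, (h : ℝ) < δ := by
      have : Tendsto (fun h : ℝ≥0 => (h : ℝ)) (𝓝[>] 0) (𝓝 ((0 : ℝ≥0) : ℝ)) :=
        (NNReal.continuous_coe.tendsto 0).mono_left nhdsWithin_le_nhds
      exact this.eventually_lt_const (by simpa using hδ)
    filter_upwards [hpos, h1, h2, h4] with h hh h1 h2 h4 n hn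
    have hh' : (0 : ℝ) < h := by exact_mod_cast hh
    obtain ⟨hJ1, hJ2, hJ3⟩ := hJ h hh
    have h5 := norm_resolvent_pow_sub_le hU hR hh' (hS h) hJ1 hJ2 hJ3 (f := f)
      (δ₁ := ε / 4 / T) (δ₂ := ε / 4 / T) (fun s hs => h1 _ ⟨s, hs, rfl⟩)
      (fun s hs => (h3 (by
        rw [Real.dist_eq, sub_zero, abs_of_nonneg hs.1]
        exact hs.2.trans_lt h4)).le) n hn
    have h6 : n * (h : ℝ) * (ε / 4 / T + ε / 4 / T) ≤ ε / 2 := by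
      calc n * (h : ℝ) * (ε / 4 / T + ε / 4 / T) ≤ T * (ε / 4 / T + ε / 4 / T) := by gcongr
        _ = ε / 2 := by field_simp; norm_num
    have hJpow : ∀ x, J h ((S h ^ n) x) = (S h ^ n) (J h x) := by
      have : ∀ m x, J h ((S h ^ m) x) = (S h ^ m) (J h x) := by
        intro m
        induction m with
        | zero => simp
        | succ m ih =>
          intro x
          rw [pow_succ', mul_apply_eq_comp, hJ2, ih]
          rfl
      exact this n
    -- The outer `R` is exchanged for `J h`, to which the telescoped estimate applies. The price is
    -- `J h - R` at `R f` and at `U (n h) (R f)`, both points of a compact orbit.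
    have e : (S h ^ n) (R (R f)) - U (n * h) (R (R f)) =
        J h ((S h ^ n) (R f) - U (n * h) (R f)) - (S h ^ n) ((J h - R) (R f)) +
          (J h - R) (U (n * h) (R f)) := by
      simp only [sub_apply, map_sub, hJpow, hU.map_resolvent hR]
      abel
    have h7 := h2 _ ⟨0, ⟨le_rfl, hTR.le⟩, rfl⟩
    simp only [hU.zero, one_apply_eq_self] at h7
    have h8 := h2 _ ⟨n * h, ⟨by positivity, hn⟩, rfl⟩
    have h9 := hpow h n ((J h - R) (R f))
    rw [e]
    refine (norm_add_le _ _).trans ?_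
    have h10 := norm_sub_le (J h ((S h ^ n) (R f) - U (n * h) (R f)))
      ((S h ^ n) ((J h - R) (R f)))
    simp only at h8
    linarith
  intro ε hε
  obtain ⟨x, hx, hxD⟩ := Metric.dense_iff.1 hH.dense_domain ψ (ε / 8) (by positivity)
  -- The range of `R²` is dense: `x = R ((1 + iH) x)`, so `R y` is close to `x`, and `y` is itself
  -- in the range of `R`.
  obtain ⟨y, hy, hyD⟩ := Metric.dense_iff.1 hH.dense_domain (x + Complex.I • H ⟨x, hxD⟩) (ε / 8)
    (by positivity)
  rw [Metric.mem_ball, dist_eq_norm] at hx hy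
  have hRx : R (x + Complex.I • H ⟨x, hxD⟩) = x := hR.left_inv ⟨x, hxD⟩
  have hRy : R (y + Complex.I • H ⟨y, hyD⟩) = y := hR.left_inv ⟨y, hyD⟩
  have hxy : ‖R y - x‖ < ε / 8 := by
    conv_lhs => rw [← hRx, ← map_sub]
    exact (hR.norm_le _).trans_lt hy
  have hψ : ‖R y - ψ‖ ≤ ε / 4 := by
    have e : R y - ψ = (R y - x) + (x - ψ) := by abel
    rw [e]
    exact (norm_add_le _ _).trans (by linarith)
  have h1 := hrange (y + Complex.I • H ⟨y, hyD⟩) (ε / 2) (by positivity)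
  rw [hRy] at h1
  filter_upwards [h1] with h h1 n hn
  have e : (S h ^ n) ψ - U (n * h) ψ = ((S h ^ n) (R y) - U (n * h) (R y)) -
      ((S h ^ n) (R y - ψ) - U (n * h) (R y - ψ)) := by
    simp only [map_sub]; abel
  rw [e]
  have h2 := hpow h n (R y - ψ)
  have h3 := hU.norm_apply (n * h) (R y - ψ)
  have h4 := norm_sub_le ((S h ^ n) (R y - ψ)) (U (n * h) (R y - ψ))
  have h5 := norm_sub_le ((S h ^ n) (R y) - U (n * h) (R y))
    ((S h ^ n) (R y - ψ) - U (n * h) (R y - ψ))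
  have h6 := h1 n hn
  linarith

end Chernoff

/-! ## Essential self-adjointness and bounded perturbations -/

section Perturbation

variable {E : Type*} [NormedAddCommGroup E] [InnerProductSpace ℂ E] [CompleteSpace E]

/-- Elements of the domain of the closure are limits of elements of the domain, in the graph
norm. -/
theorem exists_seq_of_mem_closure {A : E →ₗ.[ℂ] E} (hA : A.IsClosable) (x : A.closure.domain) :
    ∃ u : ℕ → A.domain, Tendsto (fun n => (u n : E)) atTop (𝓝 x) ∧
      Tendsto (fun n => A (u n)) atTop (𝓝 (A.closure x)) := by
  have h1 : ((x : E), A.closure x) ∈ closure (A.graph : Set (E × E)) := by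
    have h2 := A.closure.mem_graph x
    rw [← hA.graph_closure_eq_closure_graph] at h2
    exact h2
  obtain ⟨w, hw, hlim⟩ := mem_closure_iff_seq_limit.1 h1
  choose u hu1 hu2 using fun n => (LinearPMap.mem_graph_iff A).1 (hw n)
  refine ⟨u, ?_, ?_⟩
  · simp only [hu1]
    exact (continuous_fst.tendsto _).comp hlim
  · simp only [hu2]
    exact (continuous_snd.tendsto _).comp hlim

/-- The adjoint is a closed extension. -/
theorem isClosable_of_symmetric {A : E →ₗ.[ℂ] E} (hd : Dense (A.domain : Set E))
    (hs : ∀ x y : A.domain, inner ℂ (A x) (y : E) = inner ℂ (x : E) (A y)) : A.IsClosable :=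
  LinearPMap.IsClosable.leIsClosable (LinearPMap.adjoint_isClosed hd).isClosable
    (LinearPMap.IsFormalAdjoint.le_adjoint hd hs)

/-- A densely defined symmetric operator `A ≤ 0` for which `1 - A` has dense range is essentially
self-adjoint. -/
theorem isSelfAdjoint_closure {A : E →ₗ.[ℂ] E} (hd : Dense (A.domain : Set E))
    (hs : ∀ x y : A.domain, inner ℂ (A x) (y : E) = inner ℂ (x : E) (A y))
    (hneg : ∀ x : A.domain, (inner ℂ (x : E) (A x)).re ≤ 0)
    (hr : ∀ y : E, (∀ x : A.domain, inner ℂ ((x : E) - A x) y = 0) → y = 0) :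
    IsSelfAdjoint A.closure := by
  have hA := isClosable_of_symmetric hd hs
  have hd' : Dense (A.closure.domain : Set E) := hd.mono A.le_closure.1
  have hs' : ∀ x y : A.closure.domain,
      inner ℂ (A.closure x) (y : E) = inner ℂ (x : E) (A.closure y) := by
    intro x y
    obtain ⟨u, hu, hu'⟩ := exists_seq_of_mem_closure hA x
    obtain ⟨w, hw, hw'⟩ := exists_seq_of_mem_closure hA y
    refine tendsto_nhds_unique (hu'.inner hw) ?_
    simp only [hs]
    exact hu.inner hw'
  have hneg' : ∀ x : A.closure.domain, (inner ℂ (x : E) (A.closure x)).re ≤ 0 := by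
    intro x
    obtain ⟨u, hu, hu'⟩ := exists_seq_of_mem_closure hA x
    exact le_of_tendsto ((Complex.continuous_re.tendsto _).comp (hu.inner hu'))
      (Eventually.of_forall fun n => hneg (u n))
  refine isSelfAdjoint_of_surjective hd' hs' (c := -1) (by norm_num) fun f => ?_
  refine exists_add_smul_eq hA.closure_isClosed (by norm_num) (fun x => ?_) (fun y hy => ?_) f
  -- `‖x‖² ≤ Re ⟨x, (1 - A) x⟩` because `A ≤ 0`; then Cauchy–Schwarz.
  · have h1 : ‖(x : E)‖ ^ 2 ≤ ‖(x : E)‖ * ‖(x : E) + ((-1 : ℝ) : ℂ) • A.closure x‖ := by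
      have h2 := (Complex.re_le_norm _).trans
        (norm_inner_le_norm (𝕜 := ℂ) (x : E) ((x : E) + ((-1 : ℝ) : ℂ) • A.closure x))
      rw [inner_add_right, inner_smul_right, Complex.add_re, inner_self_eq_norm_sq_to_K] at h2
      have h3 := hneg' x
      norm_cast at h2
      simp at h2
      norm_cast at h2
      simp at h2
      rw [show ((-1 : ℝ) : ℂ) • A.closure x = -A.closure x by simp]
      linarith
    rcases eq_or_lt_of_le (norm_nonneg (x : E)) with h0 | h0
    · rw [← h0]; exact norm_nonneg _
    · rw [sq] at h1
      exact le_of_mul_le_mul_left h1 h0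
  · refine hr y fun x => ?_
    have h1 := hy ⟨x, A.le_closure.1 x.2⟩
    have h2 : A x = A.closure ⟨x, A.le_closure.1 x.2⟩ := A.le_closure.2 rfl
    rw [← h2] at h1
    simpa [sub_eq_add_neg] using h1

/-- A real multiple of a self-adjoint operator plus a bounded self-adjoint operator. -/
theorem isSelfAdjoint_smul_add {A B : E →ₗ.[ℂ] E} (hA : IsSelfAdjoint A) {V : E →L[ℂ] E}
    (hV : ∀ x y, inner ℂ (V x) y = inner ℂ x (V y)) {c : ℝ} (hc : c ≠ 0)
    (hdom : B.domain = A.domain)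
    (hB : ∀ (x : E) (h : x ∈ B.domain) (h' : x ∈ A.domain),
      B ⟨x, h⟩ = (c : ℂ) • A ⟨x, h'⟩ + V x) : IsSelfAdjoint B := by
  have hs := inner_map_eq_of_isSelfAdjoint hA
  have hc' : (c : ℂ) ≠ 0 := by exact_mod_cast hc
  have hd : Dense (B.domain : Set E) := hdom ▸ hA.dense_domain
  have hsB : B.IsFormalAdjoint B := by
    rintro ⟨x, hx⟩ ⟨y, hy⟩
    rw [hB x hx (hdom ▸ hx), hB y hy (hdom ▸ hy)]
    simp only [inner_add_left, inner_add_right, inner_smul_left, inner_smul_right,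
      Complex.conj_ofReal, hV]
    rw [hs ⟨x, hdom ▸ hx⟩ ⟨y, hdom ▸ hy⟩]
  have hle : B ≤ B.adjoint := LinearPMap.IsFormalAdjoint.le_adjoint hd hsB
  rw [LinearPMap.isSelfAdjoint_def]
  refine le_antisymm ?_ hle
  refine ⟨fun y hy => ?_, fun y x hyx => (hle.2 hyx.symm).symm⟩
  have hadj := LinearPMap.adjoint_isFormalAdjoint hd ⟨y, hy⟩
  -- The relation `B = c A + V`, solved for `A` and paired with `y`, puts `y` in the domain of the
  -- adjoint of `A`.
  obtain ⟨h1, -⟩ := mem_domain_of_isSelfAdjoint hA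
    (y := y) (w := (c : ℂ)⁻¹ • (B.adjoint ⟨y, hy⟩ - V y)) (by
      intro x
      have h2 := hadj ⟨x, hdom.symm ▸ x.2⟩
      rw [hB x (hdom.symm ▸ x.2) x.2, inner_add_right, inner_smul_right] at h2
      simp only at h2
      rw [inner_smul_left, inner_sub_left, h2, hV, map_inv₀, Complex.conj_ofReal]
      simp only [Subtype.coe_eta]
      field_simp
      ring)
  exact hdom.symm ▸ h1

end Perturbation

open scoped ContDiff

/-! ## Geometry of the Heisenberg group -/

section Geometry

variable {d : ℕ}

instance : (volume : Measure (Heis d)).IsAddHaarMeasure :=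
  inferInstanceAs ((volume : Measure (Horiz d)).prod (volume : Measure ℝ)).IsAddHaarMeasure

/-- The complex structure `J` with `z ·_σ w = ⟪J z, w⟫`. -/
noncomputable def sympJ (d : ℕ) : Horiz d →L[ℝ] Horiz d :=
  LinearMap.toContinuousLinearMap
    { toFun := fun z => WithLp.toLp 2 (Sum.elim (fun i => z (.inr i)) (fun i => -z (.inl i)))
      map_add' := fun z w => by
        ext i
        rcases i with i | i <;> simp [add_comm]
      map_smul' := fun c z => by
        ext i
        rcases i with i | i <;> simp }

theorem sympJ_inl (z : Horiz d) (i : Fin d) : sympJ d z (.inl i) = z (.inr i) := rfl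

theorem sympJ_inr (z : Horiz d) (i : Fin d) : sympJ d z (.inr i) = -z (.inl i) := rfl

theorem symp_eq_inner (z w : Horiz d) : symp z w = inner ℝ (sympJ d z) w := by
  simp only [symp, PiLp.inner_apply, Fintype.sum_sum_type, sympJ_inl, sympJ_inr,
    RCLike.inner_apply, conj_trivial, ← Finset.sum_add_distrib]
  refine Finset.sum_congr rfl fun i _ => ?_
  ring

theorem norm_sympJ (z : Horiz d) : ‖sympJ d z‖ = ‖z‖ := by
  rw [EuclideanSpace.norm_eq, EuclideanSpace.norm_eq]
  congr 1
  simp only [Fintype.sum_sum_type, sympJ_inl, sympJ_inr, norm_neg]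
  ring

theorem symp_swap (z w : Horiz d) : symp z w = -symp w z := by
  simp only [symp, ← Finset.sum_neg_distrib]
  refine Finset.sum_congr rfl fun i _ => ?_
  ring

theorem symp_self (z : Horiz d) : symp z z = 0 := by
  have := symp_swap z z
  linarith

theorem symp_add_right (z w w' : Horiz d) : symp z (w + w') = symp z w + symp z w' := by
  simp only [symp_eq_inner, inner_add_right]

theorem symp_add_left (z z' w : Horiz d) : symp (z + z') w = symp z w + symp z' w := by
  simp only [symp_eq_inner, map_add, inner_add_left]

theorem symp_smul_left (c : ℝ) (z w : Horiz d) : symp (c • z) w = c * symp z w := by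
  simp only [symp_eq_inner, map_smul, real_inner_smul_left]

theorem symp_neg_right (z w : Horiz d) : symp z (-w) = -symp z w := by
  simp only [symp_eq_inner, inner_neg_right]

theorem symp_neg_left (z w : Horiz d) : symp (-z) w = -symp z w := by
  simp only [symp_eq_inner, map_neg, inner_neg_left]

theorem symp_sub_right (z w w' : Horiz d) : symp z (w - w') = symp z w - symp z w' := by
  simp only [symp_eq_inner, inner_sub_right]

theorem abs_symp_le (z w : Horiz d) : |symp z w| ≤ ‖z‖ * ‖w‖ := by
  rw [symp_eq_inner, ← norm_sympJ z]
  exact abs_real_inner_le_norm _ _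

theorem contDiff_symp {F : Type*} [NormedAddCommGroup F] [NormedSpace ℝ F] {n : WithTop ℕ∞}
    {f g : F → Horiz d} (hf : ContDiff ℝ n f) (hg : ContDiff ℝ n g) :
    ContDiff ℝ n fun x => symp (f x) (g x) := by
  simp only [symp_eq_inner]
  exact ((sympJ d).contDiff.comp hf).inner ℝ hg

theorem continuous_symp {X : Type*} [TopologicalSpace X] {f g : X → Horiz d} (hf : Continuous f)
    (hg : Continuous g) : Continuous fun x => symp (f x) (g x) := by
  simp only [symp_eq_inner]
  exact ((sympJ d).continuous.comp hf).inner hg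

/-- The group inverse. -/
def heisInv (p : Heis d) : Heis d := (-p.1, -p.2)

theorem heisMul_inv_cancel_left (q p : Heis d) : heisMul q (heisMul (heisInv q) p) = p := by
  simp only [heisMul, heisInv, symp_neg_left, symp_add_right, symp_neg_right, symp_self]
  ext1
  · simp
  · simp only; ring

theorem heisMul_inv_cancel_left' (q p : Heis d) : heisMul (heisInv q) (heisMul q p) = p := by
  simp only [heisMul, heisInv, symp_neg_left, symp_add_right, symp_self]
  ext1
  · simp
  · simp only; ring

theorem contDiff_heisMul {F : Type*} [NormedAddCommGroup F] [NormedSpace ℝ F] {n : WithTop ℕ∞}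
    {f g : F → Heis d} (hf : ContDiff ℝ n f) (hg : ContDiff ℝ n g) :
    ContDiff ℝ n fun x => heisMul (f x) (g x) :=
  (hf.fst.add hg.fst).prodMk ((hf.snd.add hg.snd).add (contDiff_symp hf.fst hg.fst))

theorem continuous_heisMul {X : Type*} [TopologicalSpace X] {f g : X → Heis d} (hf : Continuous f)
    (hg : Continuous g) : Continuous fun x => heisMul (f x) (g x) :=
  (hf.fst.add hg.fst).prodMk ((hf.snd.add hg.snd).add (continuous_symp hf.fst hg.fst))

theorem continuous_heisInv : Continuous (heisInv : Heis d → Heis d) :=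
  continuous_fst.neg.prodMk continuous_snd.neg

/-- A translation in `z` combined with a translation in `s` whose amount depends on `z` only. -/
theorem measurePreserving_heisMul (q : Heis d) : MeasurePreserving (heisMul q) := by
  have h : MeasurePreserving (fun p : Horiz d × ℝ => (q.1 + p.1, q.2 + p.2 + symp q.1 p.1))
      ((volume : Measure (Horiz d)).prod (volume : Measure ℝ))
      ((volume : Measure (Horiz d)).prod (volume : Measure ℝ)) := by
    refine (measurePreserving_add_left (volume : Measure (Horiz d)) q.1).skew_product
      (g := fun z s => q.2 + s + symp q.1 z) ?_ (Eventually.of_forall fun z => ?_)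
    · refine Continuous.measurable ?_
      exact (continuous_const.add continuous_snd).add (continuous_symp continuous_const continuous_fst)
    · have : (fun s : ℝ => q.2 + s + symp q.1 z) = fun s => (q.2 + symp q.1 z) + s := by
        funext s; ring
      rw [this]
      exact (measurePreserving_add_left (volume : Measure ℝ) _).map_eq
  exact h

/-! ### Horizontal vector fields -/

/-- The left-invariant horizontal vector field with value `v` at the origin. -/
def hvec (v : Horiz d) (p : Heis d) : Heis d := (v, symp p.1 v)

/-- The standard basis of the horizontal layer. -/
noncomputable abbrev hbasis (j : Fin d ⊕ Fin d) : Horiz d := EuclideanSpace.single j 1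

theorem vecX_eq_hvec (i : Fin d) : vecX i = hvec (hbasis (d := d) (.inl i)) := by
  funext p
  ext1
  · rfl
  · simp [vecX, hvec, symp, PiLp.single_apply]

theorem vecY_eq_hvec (i : Fin d) : vecY i = hvec (hbasis (d := d) (.inr i)) := by
  funext p
  ext1
  · rfl
  · simp [vecY, hvec, symp, PiLp.single_apply]

theorem subLap_eq_sum (f : Heis d → ℂ) (p : Heis d) :
    subLap f p = ∑ j, alongField (hvec (hbasis j)) (alongField (hvec (hbasis j)) f) p := by
  simp only [subLap, Fintype.sum_sum_type, vecX_eq_hvec, vecY_eq_hvec, Finset.sum_add_distrib]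

theorem contDiff_hvec (v : Horiz d) {n : WithTop ℕ∞} : ContDiff ℝ n (hvec v) :=
  contDiff_const.prodMk (contDiff_symp contDiff_fst contDiff_const)

theorem contDiff_alongField {w : Heis d → Heis d} (hw : ContDiff ℝ ∞ w) {f : Heis d → ℂ}
    (hf : ContDiff ℝ ∞ f) : ContDiff ℝ ∞ (alongField w f) :=
  (hf.fderiv_right (m := ∞) le_rfl).clm_apply hw

theorem alongField_mul (w : Heis d → Heis d) {f g : Heis d → ℂ} (hf : ContDiff ℝ ∞ f)
    (hg : ContDiff ℝ ∞ g) (p : Heis d) :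
    alongField w (fun p => f p * g p) p = alongField w f p * g p + f p * alongField w g p := by
  simp only [alongField]
  rw [fderiv_fun_mul (hf.differentiable (by simp) p) (hg.differentiable (by simp) p)]
  simp only [add_apply, smul_apply, smul_eq_mul]
  ring

theorem mul_mem_testFun {f g : Heis d → ℂ} (hf : ContDiff ℝ ∞ f) (hg : g ∈ testFun d) :
    (fun p => f p * g p) ∈ testFun d :=
  ⟨hf.mul hg.1, hg.2.mul_left⟩

theorem integrable_of_mem_testFun {f : Heis d → ℂ} (hf : f ∈ testFun d) : Integrable f :=
  hf.1.continuous.integrable_of_hasCompactSupport hf.2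

theorem integral_alongField_const (w : Heis d) {f : Heis d → ℂ} (hf : f ∈ testFun d) :
    ∫ p, alongField (fun _ => w) f p = 0 := by
  have h := integral_mul_fderiv_eq_neg_fderiv_mul_of_integrable (𝕜 := ℂ)
    (μ := (volume : Measure (Heis d))) (f := fun _ => (1 : ℂ)) (g := f) (v := w)
    (by simp) (by
      simp only [one_mul]
      exact integrable_of_mem_testFun (alongField_mem (w := fun _ => w) contDiff_const hf))
    (by simpa using integrable_of_mem_testFun hf) (fun x _ => by fun_prop)
    (fun x _ => hf.1.differentiable (by simp) x)
  simpa [alongField] using h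

/-- The field is divergence free: the coefficient `z ·_σ v` of `∂_s` does not depend on `s`, so it
can be moved inside that derivative. -/
theorem integral_alongField_hvec (v : Horiz d) {f : Heis d → ℂ} (hf : f ∈ testFun d) :
    ∫ p, alongField (hvec v) f p = 0 := by
  set c : Heis d → ℂ := fun p => ((symp p.1 v : ℝ) : ℂ) with hc
  have hcs : ContDiff ℝ ∞ c :=
    Complex.ofRealCLM.contDiff.comp (contDiff_symp contDiff_fst contDiff_const)
  have hcf := mul_mem_testFun hcs hf
  have hc0 : ∀ p, alongField (fun _ => ((0 : Horiz d), (1 : ℝ))) c p = 0 := by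
    intro p
    have h1 : c = Complex.ofRealCLM.comp
        (-(innerSL ℝ (sympJ d v)).comp (ContinuousLinearMap.fst ℝ (Horiz d) ℝ)) := by
      funext p
      simp only [hc]
      rw [symp_swap, symp_eq_inner]
      simp
    rw [alongField, h1, ContinuousLinearMap.fderiv]
    simp
  have e : alongField (hvec v) f = fun p => alongField (fun _ => (v, (0 : ℝ))) f p +
      alongField (fun _ => ((0 : Horiz d), (1 : ℝ))) (fun p => c p * f p) p := by
    funext p
    rw [alongField_mul _ hcs hf.1, hc0, zero_mul, zero_add]
    simp only [alongField, hvec, hc]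
    rw [← Complex.real_smul, ← map_smul, ← map_add]
    simp
  rw [e, integral_add, integral_alongField_const _ hf, integral_alongField_const _ hcf, add_zero]
  · exact integrable_of_mem_testFun (alongField_mem contDiff_const hf)
  · exact integrable_of_mem_testFun (alongField_mem contDiff_const hcf)

/-- Integration by parts along a horizontal field. -/
theorem integral_alongField_mul (v : Horiz d) {f g : Heis d → ℂ} (hf : ContDiff ℝ ∞ f)
    (hg : g ∈ testFun d) :
    ∫ p, alongField (hvec v) f p * g p = -∫ p, f p * alongField (hvec v) g p := by
  have h1 := integral_alongField_hvec v (mul_mem_testFun hf hg)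
  simp only [alongField_mul _ hf hg.1] at h1
  rw [integral_add] at h1
  · exact eq_neg_of_add_eq_zero_left h1
  · exact integrable_of_mem_testFun
      (mul_mem_testFun (contDiff_alongField (contDiff_hvec v) hf) hg)
  · exact integrable_of_mem_testFun
      (mul_mem_testFun hf (alongField_mem (contDiff_hvec v) hg))

theorem integral_subLap_mul {f g : Heis d → ℂ} (hf : ContDiff ℝ ∞ f) (hg : g ∈ testFun d) :
    ∫ p, subLap g p * f p =
      -∑ j, ∫ p, alongField (hvec (hbasis j)) f p * alongField (hvec (hbasis j)) g p := by
  simp only [subLap_eq_sum, Finset.sum_mul]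
  rw [integral_finsetSum, ← Finset.sum_neg_distrib]
  · refine Finset.sum_congr rfl fun j _ => ?_
    rw [integral_alongField_mul _ hf (alongField_mem (contDiff_hvec _) hg), neg_neg]
    simp only [mul_comm]
  · intro j _
    have := integrable_of_mem_testFun (mul_mem_testFun hf (alongField_mem (contDiff_hvec (hbasis j))
      (alongField_mem (contDiff_hvec (hbasis j)) hg)))
    simpa only [mul_comm] using this

/-- Left invariance: the differential of left translation by `q` carries the field at `p` to the
field at `q · p`. -/
theorem alongField_comp_heisMul (v : Horiz d) (q : Heis d) {f : Heis d → ℂ}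
    (hf : ContDiff ℝ ∞ f) :
    alongField (hvec v) (fun p => f (heisMul q p)) =
      fun p => alongField (hvec v) f (heisMul q p) := by
  funext p
  simp only [alongField]
  have h1 : HasFDerivAt (heisMul q) ((ContinuousLinearMap.fst ℝ (Horiz d) ℝ).prod
      (ContinuousLinearMap.snd ℝ (Horiz d) ℝ +
        (innerSL ℝ (sympJ d q.1)).comp (ContinuousLinearMap.fst ℝ (Horiz d) ℝ))) p := by
    unfold heisMul
    refine HasFDerivAt.prodMk (hasFDerivAt_fst.const_add _)
      ((hasFDerivAt_snd.const_add _).add ?_)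
    simp only [symp_eq_inner]
    exact ((innerSL ℝ (sympJ d q.1)).comp (ContinuousLinearMap.fst ℝ (Horiz d) ℝ)).hasFDerivAt
  have h2 := ((hf.differentiable (by simp) (heisMul q p)).hasFDerivAt.comp p h1).fderiv
  have h3 : (fun p => f (heisMul q p)) = f ∘ heisMul q := rfl
  rw [h3, h2]
  simp only [ContinuousLinearMap.comp_apply]
  congr 1
  simp [hvec, heisMul, symp_eq_inner, inner_add_left, add_comm]

theorem comp_heisMul_mem (q : Heis d) {f : Heis d → ℂ} (hf : f ∈ testFun d) :
    (fun p => f (heisMul q p)) ∈ testFun d := by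
  refine ⟨hf.1.comp (contDiff_heisMul contDiff_const contDiff_id), ?_⟩
  refine HasCompactSupport.intro (hf.2.isCompact.image
    (continuous_heisMul (continuous_const (y := heisInv q)) continuous_id)) fun p hp => ?_
  by_contra h
  refine hp ⟨heisMul q p, subset_tsupport _ h, ?_⟩
  exact heisMul_inv_cancel_left' q p

theorem subLap_comp_heisMul (q : Heis d) {f : Heis d → ℂ} (hf : ContDiff ℝ ∞ f) (p : Heis d) :
    subLap (fun p => f (heisMul q p)) p = subLap f (heisMul q p) := by
  simp only [subLap_eq_sum]
  refine Finset.sum_congr rfl fun j _ => ?_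
  rw [alongField_comp_heisMul _ _ hf,
    alongField_comp_heisMul _ _ (contDiff_alongField (contDiff_hvec _) hf)]

end Geometry

/-! ## Uniqueness of square-integrable solutions of `L g = g` -/

section Energy

variable {d : ℕ}

theorem ofReal_mem_testFun {χ : Heis d → ℝ} (hχ : ContDiff ℝ ∞ χ) (hs : HasCompactSupport χ) :
    (fun p => (χ p : ℂ)) ∈ testFun d :=
  ⟨Complex.ofRealCLM.contDiff.comp hχ, hs.comp_left Complex.ofReal_zero⟩

theorem alongField_ofReal (w : Heis d → Heis d) {χ : Heis d → ℝ} (hχ : ContDiff ℝ ∞ χ)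
    (p : Heis d) : alongField w (fun p => (χ p : ℂ)) p = (fderiv ℝ χ p (w p) : ℝ) := by
  have h := (Complex.ofRealCLM.hasFDerivAt (x := χ p)).comp p
    (hχ.differentiable (by simp) p).hasFDerivAt
  have h2 : (fun p => (χ p : ℂ)) = Complex.ofRealCLM ∘ χ := rfl
  rw [alongField, h2, h.fderiv]
  rfl

theorem contDiff_conj {f : Heis d → ℂ} (hf : ContDiff ℝ ∞ f) :
    ContDiff ℝ ∞ fun p => (starRingEnd ℂ) (f p) :=
  Complex.conjCLE.contDiff.comp hf

theorem conj_mem_testFun {f : Heis d → ℂ} (hf : f ∈ testFun d) :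
    (fun p => (starRingEnd ℂ) (f p)) ∈ testFun d :=
  ⟨contDiff_conj hf.1, hf.2.comp_left (map_zero _)⟩

theorem alongField_conj (w : Heis d → Heis d) {f : Heis d → ℂ} (hf : ContDiff ℝ ∞ f) :
    alongField w (fun p => (starRingEnd ℂ) (f p)) =
      fun p => (starRingEnd ℂ) (alongField w f p) := by
  funext p
  have h := (Complex.conjCLE.toContinuousLinearMap.hasFDerivAt (x := f p)).comp p
    (hf.differentiable (by simp) p).hasFDerivAt
  have h2 : (fun p => (starRingEnd ℂ) (f p)) = Complex.conjCLE.toContinuousLinearMap ∘ f := rfl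
  rw [alongField, h2, h.fderiv]
  rfl

theorem subLap_conj {f : Heis d → ℂ} (hf : ContDiff ℝ ∞ f) (p : Heis d) :
    subLap (fun p => (starRingEnd ℂ) (f p)) p = (starRingEnd ℂ) (subLap f p) := by
  simp only [subLap_eq_sum, map_sum]
  refine Finset.sum_congr rfl fun j _ => ?_
  rw [alongField_conj _ hf, alongField_conj _ (contDiff_alongField (contDiff_hvec _) hf)]

/-- Completing the square. For `a = X_j g`, `b = g`, `x = χ`, `y = X_j χ` the left side is `Re (X_j
g · X_j (χ² ḡ))` and the first square is `|X_j (χ g)|²`. -/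
theorem re_mul_conj_identity (a b : ℂ) (x y : ℝ) :
    (a * (x * (x * (starRingEnd ℂ) a + y * (starRingEnd ℂ) b) + y * (x * (starRingEnd ℂ) b))).re =
      ‖(x : ℂ) * a + y * b‖ ^ 2 - y ^ 2 * ‖b‖ ^ 2 := by
  rw [← Complex.normSq_eq_norm_sq, ← Complex.normSq_eq_norm_sq]
  simp [Complex.normSq_apply]
  ring

/-- The Caccioppoli inequality for solutions of `L g = g`. -/
theorem integral_sq_mul_le {g : Heis d → ℂ} (hg : ContDiff ℝ ∞ g)
    (hw : ∀ φ ∈ testFun d, ∫ p, g p * (φ p - subLap φ p) = 0) {χ : Heis d → ℝ}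
    (hχ : ContDiff ℝ ∞ χ) (hs : HasCompactSupport χ) :
    ∫ p, χ p ^ 2 * ‖g p‖ ^ 2 ≤
      ∑ j, ∫ p, (fderiv ℝ χ p (hvec (hbasis j) p)) ^ 2 * ‖g p‖ ^ 2 := by
  have hχc := ofReal_mem_testFun hχ hs
  set c : Heis d → ℂ := fun p => (χ p : ℂ) with hc
  set u : Heis d → ℂ := fun p => c p * (starRingEnd ℂ) (g p) with hu
  have hut : u ∈ testFun d := by
    have := mul_mem_testFun (contDiff_conj hg) hχc
    simpa only [hu, mul_comm] using this
  -- The weak equation is tested against `χ² ḡ`.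
  set φ : Heis d → ℂ := fun p => c p * u p with hφ
  have hφt : φ ∈ testFun d := mul_mem_testFun hχc.1 hut
  have h1 : ∫ p, g p * φ p = ∫ p, subLap φ p * g p := by
    have h2 := hw φ hφt
    simp only [mul_sub] at h2
    rw [integral_sub (integrable_of_mem_testFun (mul_mem_testFun hg hφt))
      (integrable_of_mem_testFun (mul_mem_testFun hg (subLap_mem hφt))), sub_eq_zero] at h2
    rw [h2]
    simp only [mul_comm]
  rw [integral_subLap_mul hg hφt] at h1
  set D : Fin d ⊕ Fin d → Heis d → ℝ := fun j p => fderiv ℝ χ p (hvec (hbasis j) p) with hD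
  have h3 : ∀ j p, (alongField (hvec (hbasis j)) g p * alongField (hvec (hbasis j)) φ p).re =
      ‖(χ p : ℂ) * alongField (hvec (hbasis j)) g p + D j p * g p‖ ^ 2 - D j p ^ 2 * ‖g p‖ ^ 2 := by
    intro j p
    rw [← re_mul_conj_identity, hφ, alongField_mul _ hχc.1 hut.1, hu,
      alongField_mul _ hχc.1 (contDiff_conj hg), alongField_conj _ hg, hc, alongField_ofReal _ hχ]
    congr 1
    simp only [hD]
    ring
  have hint : ∀ j, Integrable fun p =>
      alongField (hvec (hbasis j)) g p * alongField (hvec (hbasis j)) φ p := fun j =>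
    integrable_of_mem_testFun (mul_mem_testFun (contDiff_alongField (contDiff_hvec _) hg)
      (alongField_mem (contDiff_hvec _) hφt))
  have h4 : ∫ p, χ p ^ 2 * ‖g p‖ ^ 2 = (∫ p, g p * φ p).re := by
    have e : ∀ p, g p * φ p = ((χ p ^ 2 * ‖g p‖ ^ 2 : ℝ) : ℂ) := by
      intro p
      push_cast
      rw [← Complex.mul_conj']
      simp only [hφ, hu, hc]
      ring
    simp only [e]
    rw [integral_complex_ofReal, Complex.ofReal_re]
  rw [h4, h1, Complex.neg_re, Complex.re_sum, ← Finset.sum_neg_distrib]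
  refine Finset.sum_le_sum fun j _ => ?_
  have h5 : (∫ p, alongField (hvec (hbasis j)) g p * alongField (hvec (hbasis j)) φ p).re =
      ∫ p, (alongField (hvec (hbasis j)) g p * alongField (hvec (hbasis j)) φ p).re :=
    (integral_re (hint j)).symm
  have hDs : Integrable fun p => D j p ^ 2 * ‖g p‖ ^ 2 := by
    have hDc : Continuous (D j) :=
      ((hχ.fderiv_right (m := ∞) le_rfl).clm_apply (contDiff_hvec (hbasis j))).continuous
    refine Continuous.integrable_of_hasCompactSupport
      ((hDc.pow 2).mul (hg.continuous.norm.pow 2)) ?_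
    have : HasCompactSupport (D j) := by
      refine (hs.fderiv ℝ).mono' (fun p hp => subset_tsupport _ ?_)
      intro h0
      apply hp
      simp only [hD]
      rw [h0]
      rfl
    exact (this.comp_left (g := fun x : ℝ => x ^ 2) (by simp)).mul_right
  rw [h5, ← integral_neg]
  refine integral_mono (hint j).re.neg hDs fun p => ?_
  simp only
  rw [h3]
  nlinarith [sq_nonneg ‖(χ p : ℂ) * alongField (hvec (hbasis j)) g p + D j p * g p‖]

/-- The dilations of the Heisenberg group. -/
def heisDil (r : ℝ) (p : Heis d) : Heis d := (r • p.1, r ^ 2 * p.2)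

theorem contDiff_heisDil (r : ℝ) : ContDiff ℝ ∞ (heisDil r : Heis d → Heis d) :=
  (contDiff_fst.const_smul r).prodMk (contDiff_const.mul contDiff_snd)

/-- Horizontal fields are homogeneous of degree one under the dilations. The factor `r` makes the
gradients of the spreading cutoffs small, uniformly in `p`, although the coefficients of the fields
are unbounded. -/
theorem fderiv_comp_heisDil (r : ℝ) {θ : Heis d → ℝ} (hθ : ContDiff ℝ ∞ θ) (v : Horiz d)
    (p : Heis d) : fderiv ℝ (fun p => θ (heisDil r p)) p (hvec v p) =
      r * fderiv ℝ θ (heisDil r p) (hvec v (heisDil r p)) := by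
  have h1 : HasFDerivAt (heisDil r) ((r • ContinuousLinearMap.fst ℝ (Horiz d) ℝ).prod
      (r ^ 2 • ContinuousLinearMap.snd ℝ (Horiz d) ℝ)) p :=
    (hasFDerivAt_fst.const_smul r).prodMk (hasFDerivAt_snd.const_mul (r ^ 2))
  have h2 := ((hθ.differentiable (by simp) (heisDil r p)).hasFDerivAt.comp p h1).fderiv
  have h3 : (fun p => θ (heisDil r p)) = θ ∘ heisDil r := rfl
  rw [h3, h2, ContinuousLinearMap.comp_apply, ← smul_eq_mul r, ← map_smul]
  congr 1
  ext1
  · simp [hvec]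
  · simp [hvec, heisDil, symp_smul_left]
    ring

/-- A smooth square-integrable weak solution of `L g = g` vanishes. -/
theorem eq_zero_of_weak_solution {g : Heis d → ℂ} (hg : ContDiff ℝ ∞ g)
    (hg2 : Integrable fun p => ‖g p‖ ^ 2)
    (hw : ∀ φ ∈ testFun d, ∫ p, g p * (φ p - subLap φ p) = 0) : g = 0 := by
  set b : ContDiffBump (0 : Heis d) := default with hb
  set θ : Heis d → ℝ := fun p => b p with hθ
  have hθs : ContDiff ℝ ∞ θ := b.contDiff
  have hθc : HasCompactSupport θ := b.hasCompactSupport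
  have hθ0 : θ 0 = 1 := b.one_of_mem_closedBall (Metric.mem_closedBall_self b.rIn_pos.le)
  have hbound : ∀ j, ∃ C : ℝ, ∀ p, (fderiv ℝ θ p (hvec (hbasis j) p)) ^ 2 ≤ C := by
    intro j
    have hc : Continuous fun p => fderiv ℝ θ p (hvec (hbasis j) p) :=
      ((hθs.fderiv_right (m := ∞) le_rfl).clm_apply (contDiff_hvec (hbasis j))).continuous
    have hcs : HasCompactSupport fun p => fderiv ℝ θ p (hvec (hbasis j) p) := by
      refine (hθc.fderiv ℝ).mono' (fun p hp => subset_tsupport _ ?_)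
      intro h0
      apply hp
      simp only
      rw [h0]
      rfl
    obtain ⟨C, hC⟩ := hc.bounded_above_of_compact_support hcs
    refine ⟨C ^ 2, fun p => ?_⟩
    have := hC p
    rw [← sq_abs]
    exact pow_le_pow_left₀ (abs_nonneg _) this 2
  choose C hC using hbound
  have hkey : ∀ r : ℝ, r ≠ 0 → ∫ p, θ (heisDil r p) ^ 2 * ‖g p‖ ^ 2 ≤
      r ^ 2 * ((∑ j, C j) * ∫ p, ‖g p‖ ^ 2) := by
    intro r hr
    have hs : HasCompactSupport fun p => θ (heisDil r p) := by
      refine HasCompactSupport.intro (hθc.isCompact.image (contDiff_heisDil r⁻¹).continuous)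
        fun p hp => ?_
      by_contra h
      refine hp ⟨heisDil r p, subset_tsupport _ h, ?_⟩
      simp only [heisDil]
      ext1
      · simp [smul_smul, inv_mul_cancel₀ hr]
      · simp only [← mul_assoc, ← mul_pow, inv_mul_cancel₀ hr]
        simp
    refine (integral_sq_mul_le hg hw (hθs.comp (contDiff_heisDil r)) hs).trans ?_
    rw [Finset.sum_mul, Finset.mul_sum]
    refine Finset.sum_le_sum fun j _ => ?_
    rw [← integral_const_mul, ← integral_const_mul]
    refine integral_mono_of_nonneg (Eventually.of_forall fun p => by positivity)
      ((hg2.const_mul _).const_mul _) (Eventually.of_forall fun p => ?_)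
    simp only [Function.comp_def]
    rw [fderiv_comp_heisDil r hθs, mul_pow, mul_assoc]
    gcongr
    exact hC j _
  -- As `r → 0` the cutoffs tend to `θ 0 = 1`, whereas the bound `hkey` is `O(r²)`.
  have hlim : Tendsto (fun r : ℝ => ∫ p, θ (heisDil r p) ^ 2 * ‖g p‖ ^ 2) (𝓝[≠] 0)
      (𝓝 (∫ p, ‖g p‖ ^ 2)) := by
    refine tendsto_integral_filter_of_dominated_convergence (fun p => ‖g p‖ ^ 2)
      (Eventually.of_forall fun r => ?_) (Eventually.of_forall fun r => ?_) hg2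
      (Eventually.of_forall fun p => ?_)
    · exact ((hθs.continuous.comp (contDiff_heisDil r).continuous).pow 2 |>.mul
        (hg.continuous.norm.pow 2)).aestronglyMeasurable
    · refine Eventually.of_forall fun p => ?_
      have h1 : θ (heisDil r p) ^ 2 ≤ 1 := pow_le_one₀ b.nonneg b.le_one
      rw [Real.norm_of_nonneg (by positivity)]
      nlinarith [sq_nonneg ‖g p‖]
    · have h1 : Continuous fun r : ℝ => θ (heisDil r p) ^ 2 * ‖g p‖ ^ 2 := by
        refine ((hθs.continuous.comp ?_).pow 2).mul continuous_const
        unfold heisDil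
        fun_prop
      have h2 := h1.tendsto 0
      have h3 : heisDil 0 p = 0 := by
        simp [heisDil]
      simp only [h3, hθ0, one_pow, one_mul] at h2
      exact h2.mono_left nhdsWithin_le_nhds
  have hlim0 : Tendsto (fun r : ℝ => r ^ 2 * ((∑ j, C j) * ∫ p, ‖g p‖ ^ 2)) (𝓝[≠] 0) (𝓝 0) := by
    have h1 : Continuous fun r : ℝ => r ^ 2 * ((∑ j, C j) * ∫ p, ‖g p‖ ^ 2) := by fun_prop
    have h2 := h1.tendsto 0
    simp only [ne_eq, OfNat.ofNat_ne_zero, not_false_eq_true, zero_pow, zero_mul] at h2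
    exact h2.mono_left nhdsWithin_le_nhds
  have hle : ∫ p, ‖g p‖ ^ 2 ≤ 0 := le_of_tendsto_of_tendsto hlim hlim0
    (eventually_nhdsWithin_of_forall fun r hr => hkey r hr)
  have h0 : ∫ p, ‖g p‖ ^ 2 = 0 := le_antisymm hle (integral_nonneg fun p => by positivity)
  rw [integral_eq_zero_iff_of_nonneg (fun p => by positivity) hg2] at h0
  have h1 : (fun p => ‖g p‖ ^ 2) = 0 :=
    (Continuous.ae_eq_iff_eq volume (hg.continuous.norm.pow 2) continuous_const).1 h0
  funext p
  have := congrFun h1 p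
  simpa using this

end Energy

/-! ## Left convolution with a test function -/

theorem lintegral_mul_sq_le {α : Type*} [MeasurableSpace α] (μ : Measure α) {f g : α → ℝ≥0∞}
    (hf : AEMeasurable f μ) (hg : AEMeasurable g μ) :
    (∫⁻ a, f a * g a ∂μ) ^ 2 ≤ (∫⁻ a, f a ^ 2 ∂μ) * ∫⁻ a, g a ^ 2 ∂μ := by
  have h := ENNReal.lintegral_mul_le_Lp_mul_Lq μ (p := 2) (q := 2)
    ⟨by norm_num, by norm_num, by norm_num⟩ hf hg
  have h2 : ∀ x : ℝ≥0∞, (x ^ (1 / 2 : ℝ)) ^ 2 = x := fun x => by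
    rw [← ENNReal.rpow_natCast, ← ENNReal.rpow_mul]
    norm_num
  refine (pow_le_pow_left₀ zero_le h 2).trans_eq ?_
  rw [mul_pow, h2, h2]
  simp only [ENNReal.rpow_ofNat]

section Convolution

variable {d : ℕ}

/-- The convolution `k * f` on the Heisenberg group. -/
noncomputable def heisConv (k f : Heis d → ℂ) (p : Heis d) : ℂ :=
  ∫ q, k (heisMul p (heisInv q)) * f q

theorem measurePreserving_heisInv : MeasurePreserving (heisInv : Heis d → Heis d) :=
  Measure.measurePreserving_neg (volume : Measure (Heis d))

theorem heisInv_heisInv (p : Heis d) : heisInv (heisInv p) = p := by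
  simp [heisInv]

theorem heisInv_heisMul (p q : Heis d) :
    heisInv (heisMul p q) = heisMul (heisInv q) (heisInv p) := by
  simp only [heisMul, heisInv, symp_neg_left, symp_neg_right, neg_neg]
  rw [symp_swap q.1 p.1]
  ext1
  · simp [add_comm]
  · simp only; ring

/-- Left translations as homeomorphisms. -/
def heisMulHomeo (q : Heis d) : Heis d ≃ₜ Heis d where
  toFun := heisMul q
  invFun := heisMul (heisInv q)
  left_inv := heisMul_inv_cancel_left' q
  right_inv := heisMul_inv_cancel_left q
  continuous_toFun := continuous_heisMul continuous_const continuous_id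
  continuous_invFun := continuous_heisMul continuous_const continuous_id

/-- Substitution of `r = p · q⁻¹`. In this form `k * f` is a superposition of left translates of
`f`, so left-invariant equations pass to it. -/
theorem heisConv_eq (k f : Heis d → ℂ) (p : Heis d) :
    heisConv k f p = ∫ r, k r * f (heisMul (heisInv r) p) := by
  have h1 : MeasurePreserving (fun q => heisMul p (heisInv q)) :=
    (measurePreserving_heisMul p).comp measurePreserving_heisInv
  have h2 : MeasurableEmbedding fun q => heisMul p (heisInv q) :=
    ((Homeomorph.neg (Heis d)).trans (heisMulHomeo p)).measurableEmbedding
  rw [← h1.integral_comp h2]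
  unfold heisConv
  congr 1
  funext q
  rw [heisInv_heisMul, heisInv_heisInv]
  congr 2
  simp only [heisMul, heisInv, symp_neg_right, symp_add_left, symp_neg_left, symp_self]
  ext1
  · simp
  · simp only; ring

/-- At fixed `z` the group convolution is a Euclidean convolution with a sheared copy of `k`, and
the kernel depends smoothly on the parameter `z`; afterwards the parameter is set equal to the
horizontal part of the point. -/
theorem contDiff_heisConv {k f : Heis d → ℂ} (hk : k ∈ testFun d) (hf : LocallyIntegrable f) :
    ContDiff ℝ ∞ (heisConv k f) := by
  obtain ⟨R, hR⟩ := hk.2.isCompact.isBounded.subset_closedBall 0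
  set G : Horiz d → Heis d → ℂ := fun z u => k (u.1, u.2 + symp z u.1) with hG
  have hGs : ContDiff ℝ ∞ (fun x : Horiz d × Heis d => G x.1 x.2) :=
    hk.1.comp (contDiff_snd.fst.prodMk
      (contDiff_snd.snd.add (contDiff_symp contDiff_fst contDiff_snd.fst)))
  have hconv : ∀ p, heisConv k f p =
      convolution f (G p.1) (ContinuousLinearMap.mul ℝ ℂ) volume p := by
    intro p
    unfold heisConv convolution
    congr 1
    funext q
    rw [ContinuousLinearMap.mul_apply', mul_comm]
    congr 2
    simp only [heisMul, heisInv, Prod.fst_sub, Prod.snd_sub, symp_neg_right, symp_sub_right,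
      symp_self]
    ext1
    · simp [sub_eq_add_neg]
    · simp only; ring
  rw [contDiff_iff_contDiffAt]
  intro p₀
  set s : Set (Horiz d) := Metric.ball 0 (‖p₀.1‖ + 1) with hs
  -- For `‖z‖ < ‖p₀.1‖ + 1` the shear moves `s` by at most `(‖p₀.1‖ + 1) R` on the support, so one
  -- compact set serves all these `z`.
  set B : ℝ := R + (‖p₀.1‖ + 1) * R with hB
  have hconvd := contDiffOn_convolution_right_with_param (𝕜 := ℝ) (μ := (volume : Measure (Heis d)))
    (n := (⊤ : ℕ∞)) (f := f) (ContinuousLinearMap.mul ℝ ℂ) (g := G) (s := s)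
    (k := Metric.closedBall (0 : Horiz d) R ×ˢ Metric.closedBall (0 : ℝ) B)
    Metric.isOpen_ball ((isCompact_closedBall _ _).prod (isCompact_closedBall _ _))
    (fun z u hz hu => ?_) hf hGs.contDiffOn
  · have h1 : ContDiffAt ℝ ∞ (fun x : Horiz d × Heis d =>
        convolution f (G x.1) (ContinuousLinearMap.mul ℝ ℂ) volume x.2) (p₀.1, p₀) :=
      hconvd.contDiffAt ((Metric.isOpen_ball.prod isOpen_univ).mem_nhds
        ⟨by simp, trivial⟩)
    have h2 := ContDiffAt.comp (f := fun p : Heis d => (p.1, p)) p₀ h1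
      (contDiff_fst.prodMk contDiff_id).contDiffAt
    refine h2.congr_of_eventuallyEq (Eventually.of_forall fun p => ?_)
    exact hconv p
  · by_contra hne
    apply hu
    have h3 := hR (subset_tsupport _ hne)
    rw [mem_closedBall_zero_iff, Prod.norm_def, max_le_iff] at h3
    obtain ⟨h4, h5⟩ := h3
    simp only at h4 h5
    refine ⟨by simpa using h4, ?_⟩
    rw [mem_closedBall_zero_iff, hB]
    have h6 := abs_symp_le z u.1
    rw [hs, mem_ball_zero_iff] at hz
    have h7 : ‖z‖ * ‖u.1‖ ≤ (‖p₀.1‖ + 1) * R := by gcongr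
    rw [Real.norm_eq_abs] at h5 ⊢
    have h8 := abs_sub (u.2 + symp z u.1) (symp z u.1)
    rw [add_sub_cancel_right] at h8
    linarith

/-- Cauchy–Schwarz over the support of `k`, then Tonelli and the invariance of the measure under
left translations. -/
theorem integrable_sq_heisConv {k f : Heis d → ℂ} (hk : k ∈ testFun d) (hf : MemLp f 2)
    (hfm : StronglyMeasurable f) : Integrable fun p => ‖heisConv k f p‖ ^ 2 := by
  have hcont := (contDiff_heisConv hk (hf.locallyIntegrable (by norm_num))).continuous
  refine ⟨(hcont.norm.pow 2).aestronglyMeasurable, ?_⟩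
  set K := tsupport k with hK
  have hmul : Measurable fun x : Heis d × Heis d => heisMul (heisInv x.2) x.1 :=
    (continuous_heisMul (continuous_heisInv.comp continuous_snd) continuous_fst).measurable
  have hfm' : Measurable f := hfm.measurable
  have hk2 : ∫⁻ r, ‖k r‖ₑ ^ 2 < ⊤ := by
    have := (memLp_testFun ⟨k, hk⟩).eLpNorm_lt_top
    rw [eLpNorm_lt_top_iff_lintegral_rpow_enorm_lt_top (by norm_num) (by norm_num)] at this
    simpa using this
  have hf2 : ∫⁻ r, ‖f r‖ₑ ^ 2 < ⊤ := by
    have := hf.eLpNorm_lt_top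
    rw [eLpNorm_lt_top_iff_lintegral_rpow_enorm_lt_top (by norm_num) (by norm_num)] at this
    simpa using this
  have hpt : ∀ p, ‖heisConv k f p‖ₑ ^ 2 ≤
      (∫⁻ r, ‖k r‖ₑ ^ 2) * ∫⁻ r in K, ‖f (heisMul (heisInv r) p)‖ₑ ^ 2 := by
    intro p
    have hm : Measurable fun r => ‖f (heisMul (heisInv r) p)‖ₑ :=
      (hfm'.comp (hmul.comp (measurable_const.prodMk measurable_id))).enorm
    have h1 : ‖heisConv k f p‖ₑ ≤ ∫⁻ r in K, ‖k r‖ₑ * ‖f (heisMul (heisInv r) p)‖ₑ := by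
      rw [heisConv_eq, ← setIntegral_eq_integral_of_forall_compl_eq_zero (s := K)]
      · refine (enorm_integral_le_lintegral_enorm _).trans_eq ?_
        simp only [enorm_mul]
      · intro r hr
        rw [image_eq_zero_of_notMem_tsupport hr, zero_mul]
    refine (pow_le_pow_left₀ zero_le h1 2).trans ((lintegral_mul_sq_le _
      hk.1.continuous.measurable.enorm.aemeasurable hm.aemeasurable).trans ?_)
    gcongr
    exact Measure.restrict_le_self
  have h2 : ∫⁻ p, ∫⁻ r in K, ‖f (heisMul (heisInv r) p)‖ₑ ^ 2 =
      ∫⁻ r in K, ∫⁻ p, ‖f p‖ₑ ^ 2 := by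
    rw [lintegral_lintegral_swap ((hfm'.comp hmul).enorm.pow_const 2).aemeasurable]
    refine lintegral_congr fun r => ?_
    exact (measurePreserving_heisMul (heisInv r)).lintegral_comp (hfm'.enorm.pow_const 2)
  have h3 : ∫⁻ p, ‖heisConv k f p‖ₑ ^ 2 < ⊤ := by
    refine (lintegral_mono hpt).trans_lt ?_
    rw [lintegral_const_mul' _ _ hk2.ne, h2, lintegral_const, Measure.restrict_apply_univ]
    exact ENNReal.mul_lt_top hk2 (ENNReal.mul_lt_top hf2 hk.2.isCompact.measure_lt_top)
  rw [hasFiniteIntegral_iff_enorm]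
  simpa only [enorm_pow, enorm_norm] using h3

theorem integral_heisConv_mul {k f : Heis d → ℂ} (hk : k ∈ testFun d) (hf : LocallyIntegrable f)
    (hfm : StronglyMeasurable f) {Φ : Heis d → ℂ} (hΦ : Φ ∈ testFun d) :
    ∫ p, heisConv k f p * Φ p = ∫ r, k r * ∫ q, f q * Φ (heisMul r q) := by
  have hmp : MeasurePreserving (fun x : Heis d × Heis d => (x.1, heisMul (heisInv x.1) x.2)) := by
    refine (MeasurePreserving.id (volume : Measure (Heis d))).skew_product
      (g := fun r p => heisMul (heisInv r) p) ?_
      (Eventually.of_forall fun r => (measurePreserving_heisMul _).map_eq)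
    exact (continuous_heisMul (continuous_heisInv.comp continuous_fst) continuous_snd).measurable
  -- If `k r` and `Φ (r · q)` are nonzero, then `q = r⁻¹ · (r · q)` lies in this compact set, where
  -- `f` is integrable.
  set K' : Set (Heis d) := (fun x : Heis d × Heis d => heisMul (heisInv x.1) x.2) ''
    (tsupport k ×ˢ tsupport Φ) with hK'
  have hK'c : IsCompact K' := (hk.2.isCompact.prod hΦ.2.isCompact).image
    (continuous_heisMul (continuous_heisInv.comp continuous_fst) continuous_snd)
  obtain ⟨C, hC⟩ := hΦ.1.continuous.bounded_above_of_compact_support hΦ.2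
  set G : Heis d × Heis d → ℂ := fun x => k x.1 * f x.2 * Φ (heisMul x.1 x.2) with hG
  have hGint : Integrable G (volume.prod volume) := by
    have h1 : Integrable (fun x : Heis d × Heis d => ‖k x.1‖ * (K'.indicator (fun q => ‖f q‖) x.2))
        (volume.prod volume) := by
      refine Integrable.mul_prod (integrable_of_mem_testFun hk).norm ?_
      rw [integrable_indicator_iff hK'c.measurableSet]
      exact (hf.integrableOn_isCompact hK'c).norm
    refine (h1.const_mul C).mono' ?_ (Eventually.of_forall fun x => ?_)
    · refine Measurable.aestronglyMeasurable ?_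
      exact ((hk.1.continuous.measurable.comp measurable_fst).mul
        (hfm.measurable.comp measurable_snd)).mul (hΦ.1.continuous.comp
          (continuous_heisMul continuous_fst continuous_snd)).measurable
    · simp only [hG, norm_mul]
      by_cases h0 : k x.1 = 0
      · simp [h0]
      by_cases h0' : Φ (heisMul x.1 x.2) = 0
      · rw [h0', norm_zero, mul_zero]
        have : 0 ≤ C := (norm_nonneg _).trans (hC 0)
        have : 0 ≤ K'.indicator (fun q => ‖f q‖) x.2 :=
          Set.indicator_nonneg (fun _ _ => norm_nonneg _) _
        positivity
      have hx : x.2 ∈ K' := ⟨(x.1, heisMul x.1 x.2), ⟨subset_tsupport _ h0, subset_tsupport _ h0'⟩,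
        heisMul_inv_cancel_left' _ _⟩
      rw [Set.indicator_of_mem hx]
      have := hC (heisMul x.1 x.2)
      nlinarith [mul_nonneg (norm_nonneg (k x.1)) (norm_nonneg (f x.2))]
  have hFint : Integrable (fun x : Heis d × Heis d =>
      k x.1 * f (heisMul (heisInv x.1) x.2) * Φ x.2) (volume.prod volume) := by
    have h1 := hmp.integrable_comp_of_integrable hGint
    refine h1.congr (Eventually.of_forall fun x => ?_)
    simp only [Function.comp_apply, hG, heisMul_inv_cancel_left]
  calc ∫ p, heisConv k f p * Φ p
      = ∫ p, ∫ r, k r * f (heisMul (heisInv r) p) * Φ p := by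
        congr 1
        funext p
        rw [heisConv_eq, integral_mul_const]
    _ = ∫ r, ∫ p, k r * f (heisMul (heisInv r) p) * Φ p :=
        integral_integral_swap (hFint.swap)
    _ = ∫ r, k r * ∫ q, f q * Φ (heisMul r q) := by
        congr 1
        funext r
        simp only [mul_assoc]
        rw [integral_const_mul]
        congr 1
        rw [← (measurePreserving_heisMul r).integral_comp (heisMulHomeo r).measurableEmbedding]
        simp only [heisMul_inv_cancel_left']

/-- A square-integrable distributional solution of `L f = f` vanishes. -/
theorem ae_eq_zero_of_weak_solution {f : Heis d → ℂ} (hf : MemLp f 2) (hfm : StronglyMeasurable f)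
    (hw : ∀ φ ∈ testFun d, ∫ p, f p * (φ p - subLap φ p) = 0) : f =ᵐ[volume] 0 := by
  have hloc : LocallyIntegrable f := hf.locallyIntegrable (by norm_num)
  have hconv : ∀ k ∈ testFun d, heisConv k f = 0 := by
    intro k hk
    refine eq_zero_of_weak_solution (contDiff_heisConv hk hloc) (integrable_sq_heisConv hk hf hfm)
      fun φ hφ => ?_
    have h0 := integral_heisConv_mul hk hloc hfm (Submodule.sub_mem _ hφ (subLap_mem hφ))
    simp only [Pi.sub_apply] at h0
    rw [h0]
    have h1 : ∀ r, ∫ q, f q * (φ (heisMul r q) - subLap φ (heisMul r q)) = 0 := by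
      intro r
      have h2 := hw _ (comp_heisMul_mem r hφ)
      simpa only [subLap_comp_heisMul r hφ.1] using h2
    simp only [h1, mul_zero, integral_zero]
  refine ae_eq_zero_of_integral_contDiff_smul_eq_zero hloc fun χ hχ hs => ?_
  -- With this kernel the value of `k * f` at the origin is `∫ χ f`.
  set k : Heis d → ℂ := fun p => (χ (heisInv p) : ℂ) with hk
  have hkt : k ∈ testFun d := by
    refine ofReal_mem_testFun (χ := fun p => χ (heisInv p)) ?_ ?_
    · exact hχ.comp (contDiff_fst.neg.prodMk contDiff_snd.neg)
    · exact hs.comp_homeomorph (Homeomorph.neg (Heis d))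
  have h1 := congrFun (hconv k hkt) 0
  rw [heisConv, Pi.zero_apply] at h1
  rw [← h1]
  congr 1
  funext q
  have : heisInv (heisMul 0 (heisInv q)) = q := by
    simp [heisMul, heisInv, symp]
  rw [hk]
  simp only [this, Complex.real_smul]

end Convolution

/-! ## Self-adjointness of the horizontal Laplacian and of the Hamiltonian -/

section Hamiltonian

variable {d : ℕ}

theorem coeFn_testToL2 (f : testFun d) : testToL2 d f =ᵐ[volume] (f : Heis d → ℂ) :=
  (memLp_testFun f).coeFn_toLp

theorem testToL2_mem (f : testFun d) : testToL2 d f ∈ (L0 d).domain := ⟨f, rfl⟩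

theorem L0_apply (f : testFun d) :
    L0 d ⟨testToL2 d f, testToL2_mem f⟩ = testToL2 d (subLapTest d f) := by
  change testToL2 d (subLapTest d ((LinearEquiv.ofInjective (testToL2 d)
    (testToL2_injective d)).symm ⟨testToL2 d f, testToL2_mem f⟩)) = _
  congr 2
  rw [LinearEquiv.symm_apply_eq]
  rfl

theorem inner_testToL2_left (f : testFun d) (y : L2 d) :
    inner ℂ (testToL2 d f) y = ∫ p, y p * (starRingEnd ℂ) ((f : Heis d → ℂ) p) := by
  rw [L2.inner_def]
  refine integral_congr_ae ?_
  filter_upwards [coeFn_testToL2 f] with p hp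
  rw [hp, RCLike.inner_apply]

theorem inner_testToL2 (f g : testFun d) :
    inner ℂ (testToL2 d f) (testToL2 d g) =
      ∫ p, (g : Heis d → ℂ) p * (starRingEnd ℂ) ((f : Heis d → ℂ) p) := by
  rw [inner_testToL2_left]
  refine integral_congr_ae ?_
  filter_upwards [coeFn_testToL2 g] with p hp
  rw [hp]

theorem dense_L0_domain (d : ℕ) : Dense ((L0 d).domain : Set (L2 d)) := by
  refine (Lp.dense_hasCompactSupport_contDiff (μ := (volume : Measure (Heis d))) (F := ℂ)
    (p := 2) (by norm_num)).mono ?_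
  rintro f ⟨g, hfg, hg1, hg2⟩
  refine ⟨⟨g, hg2, hg1⟩, ?_⟩
  exact Lp.ext ((coeFn_testToL2 _).trans hfg.symm)

/-- The right side is minus the Dirichlet form; `inner_subLap_left` reaches the same expression, so
both symmetry and sign of `L₀` can be read off. -/
theorem inner_subLap_right (f g : testFun d) :
    inner ℂ (testToL2 d f) (testToL2 d (subLapTest d g)) =
      -∑ j, ∫ p, (starRingEnd ℂ) (alongField (hvec (hbasis j)) (f : Heis d → ℂ) p) *
        alongField (hvec (hbasis j)) (g : Heis d → ℂ) p := by
  rw [inner_testToL2]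
  have h := integral_subLap_mul (contDiff_conj f.2.1) g.2
  simp only [alongField_conj _ f.2.1] at h
  exact h

theorem inner_subLap_left (f g : testFun d) :
    inner ℂ (testToL2 d (subLapTest d f)) (testToL2 d g) =
      -∑ j, ∫ p, (starRingEnd ℂ) (alongField (hvec (hbasis j)) (f : Heis d → ℂ) p) *
        alongField (hvec (hbasis j)) (g : Heis d → ℂ) p := by
  rw [inner_testToL2]
  have h := integral_subLap_mul g.2.1 (conj_mem_testFun f.2)
  simp only [alongField_conj _ f.2.1, subLap_conj f.2.1] at h
  simp only [mul_comm ((g : Heis d → ℂ) _)]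
  refine h.trans ?_
  simp only [mul_comm]

theorem L0_symmetric (x y : (L0 d).domain) :
    inner ℂ (L0 d x) (y : L2 d) = inner ℂ (x : L2 d) (L0 d y) := by
  obtain ⟨_, f, rfl⟩ := x
  obtain ⟨_, g, rfl⟩ := y
  rw [L0_apply f, L0_apply g, inner_subLap_left, inner_subLap_right]

theorem L0_nonpos (x : (L0 d).domain) : (inner ℂ (x : L2 d) (L0 d x)).re ≤ 0 := by
  obtain ⟨_, f, rfl⟩ := x
  rw [L0_apply f, inner_subLap_right, Complex.neg_re, Complex.re_sum, neg_nonpos]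
  refine Finset.sum_nonneg fun j _ => ?_
  simp only [Complex.conj_mul', ← Complex.ofReal_pow]
  rw [integral_complex_ofReal, Complex.ofReal_re]
  exact integral_nonneg fun p => by positivity

/-- Orthogonality to the range is the weak equation `L y = y`; test functions enter conjugated
because the inner product is antilinear in its first slot. -/
theorem L0_dense_range (y : L2 d)
    (hy : ∀ x : (L0 d).domain, inner ℂ ((x : L2 d) - L0 d x) y = 0) : y = 0 := by
  rw [Lp.eq_zero_iff_ae_eq_zero]
  refine ae_eq_zero_of_weak_solution (Lp.memLp y) (Lp.stronglyMeasurable y) fun φ hφ => ?_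
  have h1 := hy ⟨_, testToL2_mem ⟨_, conj_mem_testFun hφ⟩⟩
  rw [L0_apply] at h1
  simp only [← map_sub] at h1
  rw [inner_testToL2_left] at h1
  rw [← h1]
  congr 1
  funext p
  congr 1
  simp [subLapTest, subLap_conj hφ.1]

theorem isClosable_L0 (d : ℕ) : (L0 d).IsClosable :=
  isClosable_of_symmetric (dense_L0_domain d) L0_symmetric

theorem isSelfAdjoint_horizLap (d : ℕ) : IsSelfAdjoint (horizLap d) :=
  isSelfAdjoint_closure (dense_L0_domain d) L0_symmetric L0_nonpos L0_dense_range

theorem coeFn_mulOp {g : Heis d → ℂ} (hg : MemLp g ⊤ (volume : Measure (Heis d))) (f : L2 d) :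
    mulOp g hg f =ᵐ[volume] fun p => g p * f p := by
  have h1 : mulOp g hg f =ᵐ[volume] fun p => (ContinuousLinearMap.mul ℂ ℂ) (hg.toLp g p) (f p) :=
    ContinuousLinearMap.coeFn_holder _ _ _
  filter_upwards [h1, hg.coeFn_toLp] with p h2 h3
  rw [h2, h3, ContinuousLinearMap.mul_apply']

theorem inner_mulOp_potential (v : Lp ℝ ⊤ (volume : Measure (Heis d))) (x y : L2 d) :
    inner ℂ (mulOp _ (memLp_potential v) x) y = inner ℂ x (mulOp _ (memLp_potential v) y) := by
  rw [L2.inner_def, L2.inner_def]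
  refine integral_congr_ae ?_
  filter_upwards [coeFn_mulOp (memLp_potential v) x, coeFn_mulOp (memLp_potential v) y]
    with p h1 h2
  rw [h1, h2, RCLike.inner_apply, RCLike.inner_apply, map_mul, Complex.conj_ofReal]
  ring

theorem hamiltonian_apply (v : Lp ℝ ⊤ (volume : Measure (Heis d))) {x : L2 d}
    (h : x ∈ (hamiltonian v).domain) :
    hamiltonian v ⟨x, h⟩ =
      ((-(1 / 2) : ℝ) : ℂ) • horizLap d ⟨x, h⟩ + mulOp _ (memLp_potential v) x := by
  have e : ((-(1 / 2) : ℝ) : ℂ) = -(1 / 2 : ℂ) := by push_cast; rfl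
  rw [e]
  rfl

theorem isSelfAdjoint_hamiltonian (v : Lp ℝ ⊤ (volume : Measure (Heis d))) :
    IsSelfAdjoint (hamiltonian v) :=
  isSelfAdjoint_smul_add (isSelfAdjoint_horizLap d) (inner_mulOp_potential v)
    (c := -(1 / 2)) (by norm_num) rfl fun _ h _ => hamiltonian_apply v h

theorem testToL2_mem_hamiltonian (v : Lp ℝ ⊤ (volume : Measure (Heis d))) (f : testFun d) :
    testToL2 d f ∈ (hamiltonian v).domain := (L0 d).le_closure.1 (testToL2_mem f)

theorem hamiltonian_testToL2 (v : Lp ℝ ⊤ (volume : Measure (Heis d))) (f : testFun d) :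
    hamiltonian v ⟨testToL2 d f, testToL2_mem_hamiltonian v f⟩ =
      ((-(1 / 2) : ℝ) : ℂ) • testToL2 d (subLapTest d f) +
        mulOp _ (memLp_potential v) (testToL2 d f) := by
  rw [hamiltonian_apply, ← L0_apply]
  congr 2
  exact ((L0 d).le_closure.2 rfl).symm

/-- Test functions form a core of the Hamiltonian. -/
theorem hamiltonian_core (v : Lp ℝ ⊤ (volume : Measure (Heis d))) (x : (hamiltonian v).domain)
    (ε : ℝ) (hε : 0 < ε) :
    ∃ y ∈ Set.range fun f : testFun d =>
      (⟨testToL2 d f, testToL2_mem_hamiltonian v f⟩ : (hamiltonian v).domain),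
      ‖(x : L2 d) - y‖ < ε ∧ ‖hamiltonian v x - hamiltonian v y‖ < ε := by
  obtain ⟨u, hu1, hu2⟩ := exists_seq_of_mem_closure (isClosable_L0 d) x
  choose f hf using fun n => (u n).2
  have h1 : ∀ n, L0 d (u n) = testToL2 d (subLapTest d (f n)) := by
    intro n
    rw [← L0_apply]
    congr 1
    exact Subtype.ext (hf n).symm
  simp only [h1] at hu2
  simp only [← hf] at hu1
  have h2 : Tendsto (fun n => hamiltonian v ⟨_, testToL2_mem_hamiltonian v (f n)⟩) atTop
      (𝓝 (hamiltonian v x)) := by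
    simp only [hamiltonian_testToL2]
    rw [hamiltonian_apply v x.2]
    exact (hu2.const_smul _).add (((mulOp _ (memLp_potential v)).continuous.tendsto _).comp hu1)
  obtain ⟨n, h3, h4⟩ := ((Metric.tendsto_nhds.1 hu1 ε hε).and (Metric.tendsto_nhds.1 h2 ε hε)).exists
  refine ⟨_, ⟨f n, rfl⟩, ?_, ?_⟩
  · rw [norm_sub_rev, ← dist_eq_norm]; exact h3
  · rw [norm_sub_rev, ← dist_eq_norm]; exact h4

end Hamiltonian

/-! ## Plancherel's theorem for integrable square-integrable functions -/

section Plancherel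

open FourierTransform

variable {V : Type*} [NormedAddCommGroup V] [InnerProductSpace ℝ V] [FiniteDimensional ℝ V]
  [MeasurableSpace V] [BorelSpace V]

theorem integral_fourier_mul_eq_of_integrable {f g : V → ℂ} (hf : Integrable f)
    (hg : Integrable g) : ∫ ξ, 𝓕 f ξ * g ξ = ∫ x, f x * 𝓕 g x := by
  simpa using! VectorFourier.integral_bilin_fourierIntegral_eq_flip (ContinuousLinearMap.mul ℂ ℂ)
    (L := innerₗ V) Real.continuous_fourierChar continuous_inner hf hg

theorem continuous_fourier {f : V → ℂ} (hf : Integrable f) : Continuous (𝓕 f) :=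
  VectorFourier.fourierIntegral_continuous Real.continuous_fourierChar continuous_inner hf

/-- The `L²` transform and the transform by integrals define the same distribution: in both, the
Fourier transform moves to the test function. -/
theorem fourier_toLp_ae_eq {f : V → ℂ} (h1 : Integrable f) (h2 : MemLp f 2) :
    (𝓕 (h2.toLp f) : Lp ℂ 2 (volume : Measure V)) =ᵐ[volume] 𝓕 f := by
  refine ae_eq_of_integral_contDiff_smul_eq ((Lp.memLp _).locallyIntegrable (by norm_num))
    (continuous_fourier h1).locallyIntegrable fun g hg hgs => ?_
  set G : 𝓢(V, ℂ) := (hgs.comp_left (g := fun x : ℝ => (x : ℂ)) Complex.ofReal_zero).toSchwartzMap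
    (Complex.ofRealCLM.contDiff.comp hg) with hG
  have hGa : ∀ x, G x = (g x : ℂ) := fun x => rfl
  have h3 := congrArg (fun T : 𝓢'(V, ℂ) => T G)
    (Lp.fourier_toTemperedDistribution_eq (h2.toLp f))
  simp only [TemperedDistribution.fourier_apply, Lp.toTemperedDistribution_apply] at h3
  have h4 : ∫ x, 𝓕 G x • (h2.toLp f) x = ∫ x, 𝓕 (G : V → ℂ) x * f x := by
    refine integral_congr_ae ?_
    filter_upwards [h2.coeFn_toLp] with x hx
    rw [hx]
    rfl
  rw [h4, integral_fourier_mul_eq_of_integrable G.integrable h1] at h3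
  simp only [hGa] at h3
  simp only [← Complex.coe_smul, smul_eq_mul] at h3 ⊢
  exact h3.symm

/-- Plancherel's theorem. -/
theorem lintegral_fourier_sq {f : V → ℂ} (h1 : Integrable f) (h2 : MemLp f 2) :
    ∫⁻ ξ, ‖𝓕 f ξ‖ₑ ^ 2 = ∫⁻ x, ‖f x‖ₑ ^ 2 := by
  have h3 : eLpNorm (𝓕 f) 2 volume = eLpNorm f 2 volume := by
    rw [← eLpNorm_congr_ae (fourier_toLp_ae_eq h1 h2), ← eLpNorm_congr_ae h2.coeFn_toLp,
      ← Lp.enorm_def, ← Lp.enorm_def, ← ofReal_norm, ← ofReal_norm, Lp.norm_fourier_eq]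
  have h4 := congrArg (fun x : ℝ≥0∞ => x ^ 2) h3
  have h5 : ∀ u : V → ℂ, eLpNorm u 2 volume ^ 2 = ∫⁻ x, ‖u x‖ₑ ^ 2 := fun u => by
    rw [eLpNorm_eq_lintegral_rpow_enorm_toReal (by norm_num) (by norm_num)]
    rw [← ENNReal.rpow_natCast, ← ENNReal.rpow_mul]
    simp
  simpa only [h5] using h4

end Plancherel

/-! ## Fresnel integrals of Schwartz functions -/

section Fresnel

open FourierTransform LineDeriv

variable {d : ℕ}

theorem finrank_horiz : Module.finrank ℝ (Horiz d) = 2 * d := by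
  simp [two_mul]

/-- The function `e^{iσΔ/2} u` at the origin, written as a Fourier integral. For `σ > 0` it is a
normalized Fresnel integral, see `fresnel_eq_of_pos`. -/
noncomputable def fresnel (σ : ℝ) (u : 𝓢(Horiz d, ℂ)) : ℂ :=
  ∫ ξ, 𝓕 u ξ * Complex.exp (-(2 * Real.pi ^ 2 * σ * ‖ξ‖ ^ 2 : ℝ) * Complex.I)

theorem norm_exp_real_mul_I (x : ℝ) : ‖Complex.exp (-(x : ℂ) * Complex.I)‖ = 1 := by
  rw [← Complex.ofReal_neg, Complex.norm_exp_ofReal_mul_I]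

theorem integrable_mul_exp {f : Horiz d → ℂ} (hf : Integrable f) {g : Horiz d → ℝ}
    (hg : Continuous g) :
    Integrable fun ξ => f ξ * Complex.exp (-(g ξ : ℂ) * Complex.I) := by
  refine (hf.norm).mono' (hf.1.mul (Continuous.aestronglyMeasurable (by fun_prop)))
    (Eventually.of_forall fun ξ => ?_)
  rw [norm_mul, norm_exp_real_mul_I, mul_one]

theorem integrable_fresnel (σ : ℝ) (u : 𝓢(Horiz d, ℂ)) :
    Integrable fun ξ => 𝓕 u ξ * Complex.exp (-(2 * Real.pi ^ 2 * σ * ‖ξ‖ ^ 2 : ℝ) * Complex.I) :=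
  integrable_mul_exp (𝓕 u).integrable (by fun_prop)

theorem fresnel_add (σ : ℝ) (u w : 𝓢(Horiz d, ℂ)) :
    fresnel σ (u + w) = fresnel σ u + fresnel σ w := by
  unfold fresnel
  rw [← integral_add (integrable_fresnel σ u) (integrable_fresnel σ w)]
  refine integral_congr_ae (Eventually.of_forall fun ξ => ?_)
  simp only [FourierTransform.fourier_add, add_apply]
  ring

theorem fresnel_smul (σ : ℝ) (c : ℂ) (u : 𝓢(Horiz d, ℂ)) :
    fresnel σ (c • u) = c * fresnel σ u := by
  unfold fresnel
  rw [← integral_const_mul]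
  refine integral_congr_ae (Eventually.of_forall fun ξ => ?_)
  simp only [FourierTransform.fourier_smul, smul_apply, smul_eq_mul]
  ring

/-- Fresnel integration as a linear functional. -/
noncomputable def fresnelₗ (σ : ℝ) : 𝓢(Horiz d, ℂ) →ₗ[ℂ] ℂ where
  toFun := fresnel σ
  map_add' := fresnel_add σ
  map_smul' := fresnel_smul σ

theorem fresnel_sum {ι : Type*} (s : Finset ι) (σ : ℝ) (u : ι → 𝓢(Horiz d, ℂ)) :
    fresnel σ (∑ j ∈ s, u j) = ∑ j ∈ s, fresnel σ (u j) :=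
  map_sum (fresnelₗ (d := d) σ) u s

theorem fresnel_zero (u : 𝓢(Horiz d, ℂ)) : fresnel 0 u = u 0 := by
  have h : 𝓕⁻ (𝓕 u) = u := FourierTransform.fourierInv_fourier_eq u
  have h2 := congrArg (fun w : 𝓢(Horiz d, ℂ) => w 0) h
  simp only [SchwartzMap.fourierInv_coe] at h2
  rw [Real.fourierInv_eq] at h2
  rw [← h2, fresnel]
  refine integral_congr_ae (Eventually.of_forall fun ξ => ?_)
  simp

theorem tendsto_fresnel (u : 𝓢(Horiz d, ℂ)) (σ : ℝ) :
    Tendsto (fun ε : ℝ => ∫ ξ, 𝓕 u ξ *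
      Complex.exp (-((ε : ℂ) + 2 * Real.pi ^ 2 * σ * Complex.I) * ‖ξ‖ ^ 2)) (𝓝[>] 0)
      (𝓝 (fresnel σ u)) := by
  refine tendsto_integral_filter_of_dominated_convergence (fun ξ => ‖𝓕 u ξ‖) ?_ ?_
    (𝓕 u).integrable.norm (Eventually.of_forall fun ξ => ?_)
  · refine Eventually.of_forall fun ε => Continuous.aestronglyMeasurable ?_
    exact (𝓕 u).continuous.mul (by fun_prop)
  · filter_upwards [self_mem_nhdsWithin] with ε hε
    refine Eventually.of_forall fun ξ => ?_
    rw [norm_mul]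
    refine mul_le_of_le_one_right (norm_nonneg _) ?_
    rw [Complex.norm_exp, Real.exp_le_one_iff]
    have h1 : (-((ε : ℂ) + 2 * Real.pi ^ 2 * σ * Complex.I) * ‖ξ‖ ^ 2).re = -(ε * ‖ξ‖ ^ 2) := by
      have : (-((ε : ℂ) + 2 * Real.pi ^ 2 * σ * Complex.I) * ‖ξ‖ ^ 2)
        = ((-(ε * ‖ξ‖ ^ 2) : ℝ) : ℂ) + ((-(2 * Real.pi ^ 2 * σ * ‖ξ‖ ^ 2) : ℝ) : ℂ) * Complex.I := by
        push_cast; ring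
      rw [this, Complex.add_re, Complex.re_ofReal_mul, Complex.I_re, Complex.ofReal_re]
      simp
    rw [h1]
    have : 0 < ε := hε
    have : 0 ≤ ε * ‖ξ‖ ^ 2 := by positivity
    linarith
  · have hc : Continuous fun ε : ℝ => 𝓕 u ξ *
      Complex.exp (-((ε : ℂ) + 2 * Real.pi ^ 2 * σ * Complex.I) * ‖ξ‖ ^ 2) := by fun_prop
    have := (hc.tendsto 0).mono_left (nhdsWithin_le_nhds (s := Set.Ioi 0))
    convert! this using 4
    push_cast
    ring

/-- The Fourier transform is moved onto the Gaussian. Since the dimension is `2d`, the prefactor is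
an integral power and no branch of a root has to be chosen. -/
theorem integral_fourier_mul_gaussian (u : 𝓢(Horiz d, ℂ)) {b : ℂ} (hb : 0 < b.re) :
    ∫ ξ, 𝓕 u ξ * Complex.exp (-b * ‖ξ‖ ^ 2) =
      (Real.pi / b) ^ d * ∫ x, u x * Complex.exp (-Real.pi ^ 2 * ‖x‖ ^ 2 / b) := by
  have h := integral_fourier_mul_eq_of_integrable u.integrable
    (g := fun ξ : Horiz d => Complex.exp (-b * ‖ξ‖ ^ 2))
    (by simpa using GaussianFourier.integrable_cexp_neg_mul_sq_norm_add hb 0 (0 : Horiz d))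
  rw [← integral_const_mul]
  refine h.trans (integral_congr_ae (Eventually.of_forall fun x => ?_))
  have hd : ((Module.finrank ℝ (Horiz d) : ℂ) / 2) = (d : ℕ) := by
    rw [finrank_horiz]; push_cast; ring
  simp only [fourier_gaussian_innerProductSpace hb, hd, Complex.cpow_natCast]
  ring

/-- The Fresnel integral on the physical side. -/
theorem fresnel_eq_of_pos {σ : ℝ} (hσ : 0 < σ) (u : 𝓢(Horiz d, ℂ)) :
    (2 * Real.pi * Complex.I * σ) ^ d * fresnel σ u =
      ∫ x, u x * Complex.exp (Complex.I * (‖x‖ ^ 2 / (2 * σ) : ℝ)) := by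
  have hpi : (Real.pi : ℂ) ≠ 0 := by exact_mod_cast Real.pi_ne_zero
  have hσ' : (σ : ℂ) ≠ 0 := by exact_mod_cast hσ.ne'
  -- The Fresnel phase is a Gaussian with imaginary parameter. The real part `ε` makes the Gaussian
  -- formula available, and dominated convergence as `ε ↓ 0` applies on both sides.
  set b : ℝ → ℂ := fun ε => (ε : ℂ) + 2 * Real.pi ^ 2 * σ * Complex.I with hb
  have hbre : ∀ ε, (b ε).re = ε := fun ε => by
    have : b ε = (ε : ℂ) + ((2 * Real.pi ^ 2 * σ : ℝ) : ℂ) * Complex.I := by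
      simp only [hb]; push_cast; ring
    rw [this, Complex.add_re, Complex.re_ofReal_mul, Complex.I_re, Complex.ofReal_re]
    simp
  have hb0 : b 0 = 2 * Real.pi ^ 2 * σ * Complex.I := by simp [hb]
  have hb0ne : b 0 ≠ 0 := by
    rw [hb0]
    exact mul_ne_zero (mul_ne_zero (mul_ne_zero two_ne_zero (pow_ne_zero _ hpi)) hσ')
      Complex.I_ne_zero
  have hbc : Tendsto b (𝓝[>] 0) (𝓝 (b 0)) :=
    ((by fun_prop : Continuous b).tendsto 0).mono_left nhdsWithin_le_nhds
  have h1 : Tendsto (fun ε => ∫ x, u x * Complex.exp (-Real.pi ^ 2 * ‖x‖ ^ 2 / b ε)) (𝓝[>] 0)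
      (𝓝 (∫ x, u x * Complex.exp (-Real.pi ^ 2 * ‖x‖ ^ 2 / b 0))) := by
    refine tendsto_integral_filter_of_dominated_convergence (fun x => ‖u x‖) ?_ ?_
      u.integrable.norm (Eventually.of_forall fun x => ?_)
    · refine Eventually.of_forall fun ε => Continuous.aestronglyMeasurable ?_
      exact u.continuous.mul (by fun_prop)
    · filter_upwards [self_mem_nhdsWithin] with ε hε
      refine Eventually.of_forall fun x => ?_
      rw [norm_mul]
      refine mul_le_of_le_one_right (norm_nonneg _) ?_
      rw [Complex.norm_exp, Real.exp_le_one_iff]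
      have h2 : (-Real.pi ^ 2 * ‖x‖ ^ 2 / b ε : ℂ)
          = ((-(Real.pi ^ 2 * ‖x‖ ^ 2) : ℝ) : ℂ) * (b ε)⁻¹ := by
        push_cast; ring
      rw [h2, Complex.re_ofReal_mul, Complex.inv_re, hbre]
      have : 0 < ε := hε
      have : 0 ≤ Real.pi ^ 2 * ‖x‖ ^ 2 * (ε / Complex.normSq (b ε)) :=
        mul_nonneg (by positivity) (div_nonneg this.le (Complex.normSq_nonneg _))
      linarith
    · refine (((Complex.continuous_exp.tendsto _).comp
        (tendsto_const_nhds.div hbc hb0ne)).const_mul (u x))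
  have h2 := ((tendsto_const_nhds (x := (Real.pi : ℂ))).div hbc hb0ne).pow d |>.mul h1
  have h3 : fresnel σ u = (Real.pi / b 0) ^ d *
      ∫ x, u x * Complex.exp (-Real.pi ^ 2 * ‖x‖ ^ 2 / b 0) := by
    refine tendsto_nhds_unique ((tendsto_fresnel u σ).congr' ?_) h2
    filter_upwards [self_mem_nhdsWithin] with ε hε
    exact integral_fourier_mul_gaussian u (b := b ε) (by rw [hbre]; exact hε)
  rw [h3, ← mul_assoc, ← mul_pow]
  have h4 : 2 * Real.pi * Complex.I * σ * (Real.pi / b 0) = 1 := by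
    rw [← mul_div_assoc, div_eq_one_iff_eq hb0ne, hb0]
    ring
  rw [h4, one_pow, one_mul]
  refine integral_congr_ae (Eventually.of_forall fun x => ?_)
  simp only
  congr 2
  rw [hb0, div_eq_iff (by rwa [← hb0])]
  push_cast
  field_simp
  linear_combination (-(‖x‖ : ℂ) ^ 2) * Complex.I_sq

theorem integral_comp_smul_mul_fresnel {r : ℝ} (hr : 0 < r) (u : 𝓢(Horiz d, ℂ)) :
    ∫ ζ, u (r • ζ) * Complex.exp (Complex.I * (‖ζ‖ ^ 2 / 2 : ℝ)) =
      (2 * Real.pi * Complex.I) ^ d * fresnel (r ^ 2) u := by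
  have h := Measure.integral_comp_smul (volume : Measure (Horiz d))
    (fun x => u x * Complex.exp (Complex.I * (‖x‖ ^ 2 / (2 * r ^ 2) : ℝ))) r
  rw [← fresnel_eq_of_pos (by positivity) u, finrank_horiz] at h
  convert! h using 1
  · refine integral_congr_ae (Eventually.of_forall fun ζ => ?_)
    simp only [norm_smul, Real.norm_of_nonneg hr.le]
    congr 4
    field_simp
  · have h1 : (r : ℂ) ^ (2 * d) ≠ 0 := pow_ne_zero _ (by exact_mod_cast hr.ne')
    rw [abs_of_nonneg (by positivity), Complex.real_smul, ← mul_assoc,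
      mul_pow (2 * Real.pi * Complex.I) (((r ^ 2 : ℝ) : ℂ))]
    push_cast
    rw [← pow_mul, mul_left_comm, inv_mul_cancel₀ h1, mul_one]

/-- The generator of the Fresnel family. -/
noncomputable def flatLap (u : 𝓢(Horiz d, ℂ)) : 𝓢(Horiz d, ℂ) :=
  ∑ j : Fin d ⊕ Fin d, ∂_{hbasis j} (∂_{hbasis j} u)

theorem fourier_flatLap (u : 𝓢(Horiz d, ℂ)) (ξ : Horiz d) :
    𝓕 (flatLap u) ξ = -(4 * Real.pi ^ 2 * ‖ξ‖ ^ 2 : ℝ) * 𝓕 u ξ := by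
  have h1 : ∀ (w : 𝓢(Horiz d, ℂ)) (j : Fin d ⊕ Fin d),
      𝓕 (∂_{hbasis j} w) ξ = (2 * Real.pi * Complex.I) * (ξ j : ℂ) * 𝓕 w ξ := fun w j => by
    rw [SchwartzMap.fourier_lineDerivOp_eq]
    rw [smul_apply, SchwartzMap.smulLeftCLM_apply_apply (by fun_prop)]
    simp [EuclideanSpace.inner_single_right, smul_eq_mul, mul_assoc]
  rw [flatLap, FourierTransform.fourier_sum, sum_apply]
  simp only [h1]
  rw [EuclideanSpace.norm_sq_eq]
  simp only [Real.norm_eq_abs, sq_abs]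
  push_cast
  simp only [Finset.mul_sum, Finset.sum_mul, ← Finset.sum_neg_distrib]
  refine Finset.sum_congr rfl fun j _ => ?_
  linear_combination (4 * Real.pi ^ 2 * (ξ j : ℂ) ^ 2 * 𝓕 u ξ) * Complex.I_sq

/-- Differentiation under the Fourier integral, where `-2π²i‖ξ‖²` is `i/2` times the symbol of the
Laplacian. No singularity appears at `σ = 0`, unlike in the physical integral. -/
theorem hasDerivAt_fresnel (u : 𝓢(Horiz d, ℂ)) (σ : ℝ) :
    HasDerivAt (fun σ => fresnel σ u) (Complex.I / 2 * fresnel σ (flatLap u)) σ := by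
  have h := hasDerivAt_integral_of_dominated_loc_of_deriv_le
    (μ := (volume : Measure (Horiz d))) (x₀ := σ) (s := Set.univ)
    (bound := fun ξ => 2 * Real.pi ^ 2 * (‖ξ‖ ^ 2 * ‖𝓕 u ξ‖))
    (F := fun σ ξ => 𝓕 u ξ * Complex.exp (-(2 * Real.pi ^ 2 * σ * ‖ξ‖ ^ 2 : ℝ) * Complex.I))
    (F' := fun σ ξ => 𝓕 u ξ * (Complex.exp (-(2 * Real.pi ^ 2 * σ * ‖ξ‖ ^ 2 : ℝ) * Complex.I) *
      (-(2 * Real.pi ^ 2 * ‖ξ‖ ^ 2 : ℝ) * Complex.I)))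
    univ_mem (Eventually.of_forall fun τ => (integrable_fresnel τ u).1) (integrable_fresnel σ u)
    (Continuous.aestronglyMeasurable ((𝓕 u).continuous.mul (by fun_prop)))
    (Eventually.of_forall fun ξ τ _ => ?_)
    (((𝓕 u).integrable_pow_mul volume 2).const_mul _)
    (Eventually.of_forall fun ξ τ _ => ?_)
  · refine h.2.congr_deriv ?_
    rw [fresnel, ← integral_const_mul]
    refine integral_congr_ae (Eventually.of_forall fun ξ => ?_)
    simp only [fourier_flatLap]
    push_cast
    ring
  · simp only [norm_mul, norm_exp_real_mul_I, norm_neg, Complex.norm_real, Complex.norm_I, mul_one,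
      one_mul]
    simp only [norm_pow, norm_norm, Real.norm_ofNat, Real.norm_of_nonneg Real.pi_pos.le]
    exact le_of_eq (by ring)
  · refine HasDerivAt.const_mul _ (HasDerivAt.cexp ?_)
    have h1 : HasDerivAt (fun y : ℝ => -(((2 * Real.pi ^ 2 * y * ‖ξ‖ ^ 2 : ℝ) : ℂ)) * Complex.I)
        (-(((2 * Real.pi ^ 2 * 1 * ‖ξ‖ ^ 2 : ℝ) : ℂ)) * Complex.I) τ :=
      (((((hasDerivAt_id τ).const_mul (2 * Real.pi ^ 2)).mul_const (‖ξ‖ ^ 2)).ofReal_comp).neg).mul_const _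
    simpa using h1

theorem continuous_fresnel (u : 𝓢(Horiz d, ℂ)) : Continuous fun σ => fresnel σ u :=
  continuous_iff_continuousAt.2 fun σ => (hasDerivAt_fresnel u σ).continuousAt

/-- The oscillatory integrals exist. -/
theorem hasOscIntegral_fresnel {σ : ℝ} (hσ : 0 ≤ σ) (u : 𝓢(Horiz d, ℂ)) :
    HasOscIntegral (fun ζ => Complex.exp (Complex.I * (‖ζ‖ ^ 2 / 2 : ℝ)) * u (Real.sqrt σ • ζ))
      ((2 * Real.pi * Complex.I) ^ d * fresnel σ u) := by
  intro φ hφ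
  rcases hσ.eq_or_lt with rfl | hσ
  -- For `σ = 0` the integrand is `u 0` times a pure phase, and only the cutoff decays. The cutoff
  -- integral is then itself a Fresnel integral, of `φ` at time `ε²`, and tends to a multiple of `φ
  -- 0 = 1`.
  · have h1 : Tendsto (fun ε : ℝ => u 0 * ((2 * Real.pi * Complex.I) ^ d * fresnel (ε ^ 2) φ))
        (𝓝[>] 0) (𝓝 ((2 * Real.pi * Complex.I) ^ d * fresnel 0 u)) := by
      have h2 : Continuous fun ε : ℝ => u 0 * ((2 * Real.pi * Complex.I) ^ d * fresnel (ε ^ 2) φ) :=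
        continuous_const.mul (continuous_const.mul ((continuous_fresnel φ).comp (by fun_prop)))
      have h3 := (h2.tendsto 0).mono_left (nhdsWithin_le_nhds (s := Set.Ioi 0))
      convert! h3 using 2
      simp [fresnel_zero, hφ, mul_comm]
    refine h1.congr' ?_
    filter_upwards [self_mem_nhdsWithin] with ε hε
    rw [← integral_comp_smul_mul_fresnel hε, ← integral_const_mul]
    refine integral_congr_ae (Eventually.of_forall fun ζ => ?_)
    simp only [Real.sqrt_zero, zero_smul]
    ring
  · have hs : 0 < Real.sqrt σ := Real.sqrt_pos.2 hσ
    have h1 := integral_comp_smul_mul_fresnel hs u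
    rw [Real.sq_sqrt hσ.le] at h1
    rw [← h1]
    have hint : Integrable fun ζ : Horiz d => u (Real.sqrt σ • ζ) :=
      u.integrable.comp_smul hs.ne'
    obtain ⟨C, hC⟩ : ∃ C, ∀ x, ‖φ x‖ ≤ C := ⟨_, SchwartzMap.norm_le_seminorm ℝ φ⟩
    refine tendsto_integral_filter_of_dominated_convergence
      (fun ζ => C * ‖u (Real.sqrt σ • ζ)‖) ?_ ?_ (hint.norm.const_mul _)
      (Eventually.of_forall fun ζ => ?_)
    · refine Eventually.of_forall fun ε => Continuous.aestronglyMeasurable ?_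
      exact (φ.continuous.comp (by fun_prop)).mul
        (Continuous.mul (by fun_prop) (u.continuous.comp (by fun_prop)))
    · refine Eventually.of_forall fun ε => Eventually.of_forall fun ζ => ?_
      rw [norm_mul, norm_mul, mul_comm Complex.I, Complex.norm_exp_ofReal_mul_I, one_mul]
      exact mul_le_mul_of_nonneg_right (hC _) (norm_nonneg _)
    · have h2 : Continuous fun ε : ℝ => φ (ε • ζ) *
          (Complex.exp (Complex.I * (‖ζ‖ ^ 2 / 2 : ℝ)) * u (Real.sqrt σ • ζ)) :=
        (φ.continuous.comp (by fun_prop)).mul continuous_const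
      have h3 := (h2.tendsto 0).mono_left (nhdsWithin_le_nhds (s := Set.Ioi 0))
      convert! h3 using 2
      simp [hφ, mul_comm]

/-- Integration by parts in Fresnel integrals. -/
theorem fresnel_coord_mul {σ : ℝ} (hσ : 0 ≤ σ) (u w : 𝓢(Horiz d, ℂ)) (k : Fin d ⊕ Fin d)
    (hw : ∀ x, w x = (x k : ℂ) * u x) :
    fresnel σ w = Complex.I * σ * fresnel σ (∂_{hbasis k} u) := by
  rcases hσ.eq_or_lt with rfl | hσ
  · simp [fresnel_zero, hw]
  have hσ' : (σ : ℂ) ≠ 0 := by exact_mod_cast hσ.ne'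
  have hpi : (Real.pi : ℂ) ≠ 0 := by exact_mod_cast Real.pi_ne_zero
  have h0 : (2 * Real.pi * Complex.I * σ : ℂ) ^ d ≠ 0 :=
    pow_ne_zero _ (mul_ne_zero (mul_ne_zero (mul_ne_zero two_ne_zero hpi) Complex.I_ne_zero) hσ')
  refine mul_left_cancel₀ h0 ?_
  rw [fresnel_eq_of_pos hσ, mul_left_comm, fresnel_eq_of_pos hσ]
  set e : Horiz d → ℂ := fun x => Complex.exp (Complex.I * (‖x‖ ^ 2 / (2 * σ) : ℝ)) with he
  have hec : Continuous e := by simp only [he]; fun_prop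
  have hen : ∀ x, ‖e x‖ = 1 := fun x => by
    simp only [he]
    rw [mul_comm Complex.I, Complex.norm_exp_ofReal_mul_I]
  have hint : ∀ f : 𝓢(Horiz d, ℂ), Integrable fun x => f x * e x := fun f =>
    f.integrable.norm.mono' (f.continuous.mul hec).aestronglyMeasurable
      (Eventually.of_forall fun x => by rw [norm_mul, hen, mul_one])
  have hed : ∀ x, HasFDerivAt e (e x • (Complex.I • (Complex.ofRealCLM.comp
      (σ⁻¹ • innerSL ℝ x)))) x := fun x => by
    have h1 : HasFDerivAt (fun x : Horiz d => ‖x‖ ^ 2 / (2 * σ)) (σ⁻¹ • innerSL ℝ x) x := by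
      have h2 := ((hasStrictFDerivAt_norm_sq x).hasFDerivAt.mul_const (2 * σ)⁻¹)
      refine h2.congr_fderiv ?_
      ext y
      simp
      field_simp
    exact ((Complex.ofRealCLM.hasFDerivAt.comp x h1).const_mul Complex.I).cexp
  have hk : ∀ x, fderiv ℝ e x (hbasis k) = Complex.I * (σ : ℂ)⁻¹ * (x k : ℂ) * e x := fun x => by
    rw [(hed x).fderiv]
    simp [EuclideanSpace.inner_single_right]
    ring
  have h3 := integral_mul_fderiv_eq_neg_fderiv_mul_of_integrable
    (μ := (volume : Measure (Horiz d))) (f := fun x => e x) (g := fun x => u x) (v := hbasis k)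
    ?_ ?_ ?_ (fun x _ => (hed x).differentiableAt) (fun x _ => u.differentiableAt)
  · have h4 : ∫ x, (∂_{hbasis k} u) x * e x = ∫ x, e x * fderiv ℝ u x (hbasis k) := by
      refine integral_congr_ae (Eventually.of_forall fun x => ?_)
      simp only [SchwartzMap.lineDerivOp_apply_eq_fderiv]
      ring
    rw [h4, h3, ← integral_neg, ← integral_const_mul]
    refine integral_congr_ae (Eventually.of_forall fun x => ?_)
    simp only [hk, hw]
    field_simp
    linear_combination (x k * u x * e x : ℂ) * Complex.I_sq
  · refine ((hint w).const_mul (Complex.I * (σ : ℂ)⁻¹)).congr (Eventually.of_forall fun x => ?_)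
    simp only [hk, hw]
    ring
  · refine (hint (∂_{hbasis k} u)).congr (Eventually.of_forall fun x => ?_)
    simp only [SchwartzMap.lineDerivOp_apply_eq_fderiv]
    ring
  · exact (hint u).congr (Eventually.of_forall fun x => mul_comm _ _)

end Fresnel

/-! ## An `L²` bound for twisted Fourier integrals -/

section Twisted

open FourierTransform

variable {d : ℕ}

theorem memLp_two_of_integrable_of_bound {α : Type*} [MeasurableSpace α] {μ : Measure α}
    {f : α → ℂ} (hf : Integrable f μ) {C : ℝ} (hC : ∀ x, ‖f x‖ ≤ C) : MemLp f 2 μ := by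
  rw [memLp_two_iff_integrable_sq_norm hf.1]
  refine (hf.norm.const_mul C).mono' (hf.1.norm.pow 2) (Eventually.of_forall fun x => ?_)
  rw [Real.norm_of_nonneg (by positivity), sq]
  exact mul_le_mul_of_nonneg_right (hC x) (norm_nonneg _)

/-- `A` is `ρ` times a linear isometry of a space of dimension `2d`. -/
theorem lintegral_comp_of_norm_eq {A : Horiz d →ₗ[ℝ] Horiz d} {ρ : ℝ} (hρ : 0 < ρ)
    (hA : ∀ z, ‖A z‖ = ρ * ‖z‖) {F : Horiz d → ℝ≥0∞} (hF : Measurable F) :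
    ∫⁻ z, F (A z) = ENNReal.ofReal ((ρ ^ (2 * d))⁻¹) * ∫⁻ z, F z := by
  let U : Horiz d →ₗᵢ[ℝ] Horiz d :=
    { toLinearMap := ρ⁻¹ • A
      norm_map' := fun z => by
        rw [LinearMap.smul_apply, norm_smul, hA, norm_inv, Real.norm_of_nonneg hρ.le]
        field_simp }
  let V : Horiz d ≃ₗᵢ[ℝ] Horiz d := U.toLinearIsometryEquiv rfl
  have h1 : ∀ z, A z = ρ • V z := fun z => by
    change A z = ρ • (ρ⁻¹ • A z)
    rw [smul_smul, mul_inv_cancel₀ hρ.ne', one_smul]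
  simp only [h1]
  rw [V.measurePreserving.lintegral_comp (f := fun z => F (ρ • z))
    (hF.comp (measurable_const_smul ρ))]
  have h2 := Measure.map_addHaar_smul (volume : Measure (Horiz d)) hρ.ne'
  rw [← lintegral_map hF (measurable_const_smul ρ), h2, lintegral_smul_measure, finrank_horiz,
    abs_of_nonneg (by positivity)]
  rfl

theorem norm_smul_sub_smul_sympJ (c l : ℝ) (z : Horiz d) :
    ‖c • z - l • sympJ d z‖ = Real.sqrt (c ^ 2 + l ^ 2) * ‖z‖ := by
  have h1 : inner ℝ z (sympJ d z) = 0 := by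
    rw [real_inner_comm, ← symp_eq_inner, symp_self]
  rw [← sq_eq_sq₀ (norm_nonneg _) (by positivity), mul_pow, Real.sq_sqrt (by positivity),
    norm_sub_sq_real, norm_smul, norm_smul, norm_sympJ, real_inner_smul_left,
    inner_smul_right, h1, mul_pow, mul_pow, Real.norm_eq_abs, Real.norm_eq_abs, sq_abs, sq_abs]
  ring

/-- Continuity of `χ`, and decay in both variables separately. -/
structure DominatedBy (χ : Heis d → ℂ) (a : Horiz d → ℝ) (b : ℝ → ℝ) (C : ℝ) : Prop where
  continuous : Continuous χ
  norm_le : ∀ w s, ‖χ (w, s)‖ ≤ a w * b s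
  integrable_left : Integrable a
  integrable_right : Integrable b
  left_nonneg : ∀ w, 0 ≤ a w
  left_le : ∀ w, a w ≤ 1
  right_nonneg : ∀ s, 0 ≤ b s
  right_le : ∀ s, b s ≤ C

/-- Integration of `χ` over the graph of `z ·_σ ·`, against a character. -/
noncomputable def twisted (c : ℝ) (χ : Heis d → ℂ) (z : Horiz d) (s : ℝ) : ℂ :=
  ∫ w, χ (w, s + symp z w) * Complex.exp (-(2 * Real.pi * c * inner ℝ z w : ℝ) * Complex.I)

namespace DominatedBy

variable {χ : Heis d → ℂ} {a : Horiz d → ℝ} {b : ℝ → ℝ} {C : ℝ} (h : DominatedBy χ a b C)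

include h

theorem integrable : Integrable χ ((volume : Measure (Horiz d)).prod (volume : Measure ℝ)) :=
  (h.integrable_left.mul_prod h.integrable_right).mono' h.continuous.aestronglyMeasurable
    (Eventually.of_forall fun p => h.norm_le p.1 p.2)

theorem integrable_shear (z : Horiz d) :
    Integrable (fun p : Horiz d × ℝ => χ (p.1, p.2 + symp z p.1))
      ((volume : Measure (Horiz d)).prod (volume : Measure ℝ)) := by
  have h1 : MeasurePreserving (fun p : Horiz d × ℝ => (p.1, p.2 + symp z p.1))
      ((volume : Measure (Horiz d)).prod (volume : Measure ℝ))
      ((volume : Measure (Horiz d)).prod (volume : Measure ℝ)) := by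
    refine (MeasurePreserving.id (volume : Measure (Horiz d))).skew_product
      (g := fun w s => s + symp z w) ?_ (Eventually.of_forall fun w => ?_)
    · exact (continuous_snd.add (continuous_symp continuous_const continuous_fst)).measurable
    · exact (measurePreserving_add_right (volume : Measure ℝ) _).map_eq
  exact h1.integrable_comp_of_integrable h.integrable

theorem integrable_section (w : Horiz d) : Integrable fun s => χ (w, s) :=
  (h.integrable_right.const_mul (a w)).mono'
    (h.continuous.comp (by fun_prop)).aestronglyMeasurable
    (Eventually.of_forall fun s => h.norm_le w s)

theorem memLp_section (w : Horiz d) : MemLp (fun s => χ (w, s)) 2 :=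
  memLp_two_of_integrable_of_bound (C := a w * C) (h.integrable_section w) fun s =>
    (h.norm_le w s).trans (mul_le_mul_of_nonneg_left (h.right_le s) (h.left_nonneg w))

theorem norm_fourier_section_le (w : Horiz d) (l : ℝ) :
    ‖𝓕 (fun s => χ (w, s)) l‖ ≤ a w * ∫ s, b s := by
  rw [Real.fourier_eq', ← integral_const_mul]
  refine norm_integral_le_of_norm_le (h.integrable_right.const_mul _)
    (Eventually.of_forall fun s => ?_)
  rw [norm_smul, Complex.norm_exp_ofReal_mul_I, one_mul]
  exact h.norm_le w s

theorem stronglyMeasurable_fourier_section :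
    StronglyMeasurable fun p : Horiz d × ℝ => 𝓕 (fun s => χ (p.1, s)) p.2 := by
  simp only [Real.fourier_eq']
  refine StronglyMeasurable.integral_prod_right'
    (f := fun q : (Horiz d × ℝ) × ℝ =>
      Complex.exp ((-2 * Real.pi * inner ℝ q.2 q.1.2 : ℝ) * Complex.I) • χ (q.1.1, q.2)) ?_
  have := h.continuous
  refine Continuous.stronglyMeasurable ?_
  have h1 : Continuous fun q : (Horiz d × ℝ) × ℝ => χ (q.1.1, q.2) := this.comp (by fun_prop)
  fun_prop

theorem integrable_fourier_section (l : ℝ) :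
    Integrable fun w => 𝓕 (fun s => χ (w, s)) l :=
  (h.integrable_left.mul_const (∫ s, b s)).mono'
    (h.stronglyMeasurable_fourier_section.comp_measurable
      (measurable_id.prodMk measurable_const)).aestronglyMeasurable
    (Eventually.of_forall fun w => h.norm_fourier_section_le w l)

theorem memLp_fourier_section (l : ℝ) : MemLp (fun w => 𝓕 (fun s => χ (w, s)) l) 2 :=
  memLp_two_of_integrable_of_bound (C := ∫ s, b s) (h.integrable_fourier_section l) fun w =>
    (h.norm_fourier_section_le w l).trans
      (mul_le_of_le_one_left (integral_nonneg h.right_nonneg) (h.left_le w))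

theorem integrable_twisted (c : ℝ) (z : Horiz d) : Integrable (twisted c χ z) := by
  have h1 : Integrable (fun p : Horiz d × ℝ => χ (p.1, p.2 + symp z p.1) *
      Complex.exp (-(2 * Real.pi * c * inner ℝ z p.1 : ℝ) * Complex.I))
      ((volume : Measure (Horiz d)).prod (volume : Measure ℝ)) := by
    refine (h.integrable_shear z).norm.mono' ((h.integrable_shear z).1.mul
      (Continuous.aestronglyMeasurable (by fun_prop))) (Eventually.of_forall fun p => ?_)
    rw [norm_mul, norm_exp_real_mul_I, mul_one]
  exact h1.integral_prod_right

theorem norm_twisted_le (c : ℝ) (z : Horiz d) (s : ℝ) :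
    ‖twisted c χ z s‖ ≤ (∫ w, a w) * C := by
  rw [twisted, ← integral_mul_const]
  refine norm_integral_le_of_norm_le (h.integrable_left.mul_const _)
    (Eventually.of_forall fun w => ?_)
  rw [norm_mul, norm_exp_real_mul_I, mul_one]
  exact (h.norm_le w _).trans (mul_le_mul_of_nonneg_left (h.right_le _) (h.left_nonneg w))

theorem memLp_twisted (c : ℝ) (z : Horiz d) : MemLp (twisted c χ z) 2 :=
  memLp_two_of_integrable_of_bound (h.integrable_twisted c z) (h.norm_twisted_le c z)

/-- Under the Fourier transform in `s`, the shift by `z ·_σ w = ⟨J z, w⟩` becomes a character in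
`w`, which merges with the one already present. -/
theorem fourier_twisted (c : ℝ) (z : Horiz d) (l : ℝ) :
    𝓕 (twisted c χ z) l = 𝓕 (fun w => 𝓕 (fun s => χ (w, s)) l) (c • z - l • sympJ d z) := by
  rw [Real.fourier_eq', Real.fourier_eq']
  simp only [twisted, ← integral_const_mul, smul_eq_mul]
  rw [integral_integral_swap]
  · refine integral_congr_ae (Eventually.of_forall fun w => ?_)
    simp only
    rw [← integral_add_right_eq_self _ (-symp z w), Real.fourier_eq', ← integral_const_mul]
    refine integral_congr_ae (Eventually.of_forall fun s => ?_)
    simp only [neg_add_cancel_right, smul_eq_mul]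
    rw [mul_left_comm, ← Complex.exp_add, mul_comm, ← mul_assoc, ← Complex.exp_add]
    congr 2
    rw [inner_sub_right, inner_smul_right, inner_smul_right, symp_eq_inner,
      real_inner_comm w z, real_inner_comm w (sympJ d z)]
    simp only [RCLike.inner_apply, conj_trivial]
    push_cast
    ring
  · refine ((h.integrable_shear z).swap.norm).mono' ?_ (Eventually.of_forall fun p => ?_)
    · refine Continuous.aestronglyMeasurable ?_
      have h1 : Continuous fun p : ℝ × Horiz d => χ (p.2, p.1 + symp z p.2) :=
        h.continuous.comp (continuous_snd.prodMk
          (continuous_fst.add (continuous_symp continuous_const continuous_snd)))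
      exact Continuous.mul (by fun_prop) (h1.mul (by fun_prop))
    · simp only [Function.uncurry_def, norm_mul, norm_exp_real_mul_I, mul_one,
        Complex.norm_exp_ofReal_mul_I, one_mul]
      exact le_rfl

theorem stronglyMeasurable_fourier_fourier :
    StronglyMeasurable fun p : Horiz d × ℝ => 𝓕 (fun w => 𝓕 (fun s => χ (w, s)) p.2) p.1 := by
  simp only [Real.fourier_eq' (V := Horiz d)]
  refine StronglyMeasurable.integral_prod_right'
    (f := fun q : (Horiz d × ℝ) × Horiz d =>
      Complex.exp ((-2 * Real.pi * inner ℝ q.2 q.1.1 : ℝ) * Complex.I) •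
        𝓕 (fun s => χ (q.2, s)) q.1.2) ?_
  have h1 : Continuous fun q : (Horiz d × ℝ) × Horiz d =>
    Complex.exp ((-2 * Real.pi * inner ℝ q.2 q.1.1 : ℝ) * Complex.I) := by fun_prop
  refine h1.stronglyMeasurable.smul ?_
  exact h.stronglyMeasurable_fourier_section.comp_measurable
    (measurable_snd.prodMk (measurable_snd.comp measurable_fst))

/-- As `J z` is orthogonal to `z` and of equal length, `z ↦ c z - l J z` scales norms by `√(c² +
l²)`; Plancherel's theorem gives the factor `(c² + l²)^{-d} ≤ c^{-2d}`. This is where only an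
inequality remains. -/
theorem lintegral_fourier_fourier_le {c : ℝ} (hc : 0 < c) (l : ℝ) :
    ∫⁻ z, ‖𝓕 (fun w => 𝓕 (fun s => χ (w, s)) l) (c • z - l • sympJ d z)‖ₑ ^ 2 ≤
      ENNReal.ofReal ((c ^ (2 * d))⁻¹) * ∫⁻ w, ‖𝓕 (fun s => χ (w, s)) l‖ₑ ^ 2 := by
  have hρ : c ≤ Real.sqrt (c ^ 2 + l ^ 2) := Real.le_sqrt_of_sq_le (by nlinarith [sq_nonneg l])
  have hF : Measurable fun ξ => ‖𝓕 (fun w => 𝓕 (fun s => χ (w, s)) l) ξ‖ₑ ^ 2 :=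
    ((h.stronglyMeasurable_fourier_fourier.comp_measurable
      (measurable_id.prodMk measurable_const)).enorm).pow_const 2
  obtain ⟨A, hA⟩ : ∃ A : Horiz d →ₗ[ℝ] Horiz d, ∀ z, A z = c • z - l • sympJ d z :=
    ⟨c • LinearMap.id - l • (sympJ d).toLinearMap, fun z => rfl⟩
  have h1 := lintegral_comp_of_norm_eq (A := A) (hc.trans_le hρ)
    (fun z => by rw [hA, norm_smul_sub_smul_sympJ]) hF
  rw [lintegral_fourier_sq (h.integrable_fourier_section l) (h.memLp_fourier_section l)] at h1
  simp only [hA] at h1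
  rw [h1]
  refine mul_le_mul_left (ENNReal.ofReal_le_ofReal ?_) _
  exact inv_anti₀ (by positivity) (pow_le_pow_left₀ hc.le hρ _)

theorem lintegral_twisted_eq (c : ℝ) (z : Horiz d) : ∫⁻ s, ‖twisted c χ z s‖ₑ ^ 2 =
    ∫⁻ l, ‖𝓕 (fun w => 𝓕 (fun s => χ (w, s)) l) (c • z - l • sympJ d z)‖ₑ ^ 2 := by
  rw [← lintegral_fourier_sq (h.integrable_twisted c z) (h.memLp_twisted c z)]
  exact lintegral_congr fun l => by rw [h.fourier_twisted c z]

theorem lintegral_twisted_le {c : ℝ} (hc : 0 < c) :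
    ∫⁻ z, ∫⁻ s, ‖twisted c χ z s‖ₑ ^ 2 ≤
      ENNReal.ofReal ((c ^ (2 * d))⁻¹) * ∫⁻ w, ∫⁻ s, ‖χ (w, s)‖ₑ ^ 2 := by
  calc ∫⁻ z, ∫⁻ s, ‖twisted c χ z s‖ₑ ^ 2
      = ∫⁻ z, ∫⁻ l, ‖𝓕 (fun w => 𝓕 (fun s => χ (w, s)) l) (c • z - l • sympJ d z)‖ₑ ^ 2 :=
        lintegral_congr fun z => h.lintegral_twisted_eq c z
    _ = ∫⁻ l : ℝ, ∫⁻ z, ‖𝓕 (fun w => 𝓕 (fun s => χ (w, s)) l) (c • z - l • sympJ d z)‖ₑ ^ 2 := by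
        refine lintegral_lintegral_swap (Measurable.aemeasurable ?_)
        have h1 : Measurable fun p : Horiz d × ℝ => (c • p.1 - p.2 • sympJ d p.1, p.2) :=
          Continuous.measurable (by fun_prop)
        exact ((h.stronglyMeasurable_fourier_fourier.comp_measurable h1).enorm).pow_const 2
    _ ≤ ∫⁻ l : ℝ, ENNReal.ofReal ((c ^ (2 * d))⁻¹) * ∫⁻ w, ‖𝓕 (fun s => χ (w, s)) l‖ₑ ^ 2 :=
        lintegral_mono fun l => h.lintegral_fourier_fourier_le hc l
    _ = ENNReal.ofReal ((c ^ (2 * d))⁻¹) * ∫⁻ l : ℝ, ∫⁻ w, ‖𝓕 (fun s => χ (w, s)) l‖ₑ ^ 2 :=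
        lintegral_const_mul' _ _ ENNReal.ofReal_ne_top
    _ = ENNReal.ofReal ((c ^ (2 * d))⁻¹) * ∫⁻ w, ∫⁻ l : ℝ, ‖𝓕 (fun s => χ (w, s)) l‖ₑ ^ 2 := by
        congr 1
        refine (lintegral_lintegral_swap (f := fun w l => ‖𝓕 (fun s => χ (w, s)) l‖ₑ ^ 2)
          (Measurable.aemeasurable ?_)).symm
        exact (h.stronglyMeasurable_fourier_section.enorm).pow_const 2
    _ = _ := by
        congr 1
        refine lintegral_congr fun w => ?_
        exact lintegral_fourier_sq (h.integrable_section w) (h.memLp_section w)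

end DominatedBy

end Twisted

/-! ## The operators `S(τ)` -/

section Feynman

variable {d : ℕ}

/-- Decay of order `2d + 3` is split into `2d + 1`, more than the dimension of the horizontal layer,
and `2`, more than that of the center. -/
theorem exists_dominatedBy (ψ : 𝓢(Heis d, ℂ)) {e : Horiz d → ℂ} (hec : Continuous e)
    (he : ∀ w, ‖e w‖ = 1) : ∃ a b C, DominatedBy (fun p : Heis d => ψ p * e p.1) a b C := by
  obtain ⟨C, hC⟩ : ∃ C, ∀ p, (1 + ‖p‖) ^ (2 * d + 3) * ‖ψ p‖ ≤ C := by
    refine ⟨2 ^ (2 * d + 3) * (Finset.Iic ((2 * d + 3, 0) : ℕ × ℕ)).sup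
      (fun m => SchwartzMap.seminorm ℝ m.1 m.2) ψ, fun p => ?_⟩
    have h1 := SchwartzMap.one_add_le_sup_seminorm_apply (𝕜 := ℝ) (m := (2 * d + 3, 0))
      (k := 2 * d + 3) (n := 0) le_rfl le_rfl ψ p
    rwa [norm_iteratedFDeriv_zero] at h1
  have hC0 : 0 ≤ C := le_trans (by positivity) (hC 0)
  refine ⟨fun w => (1 + ‖w‖) ^ (-(2 * d + 1 : ℝ)), fun s => C * (1 + ‖s‖) ^ (-(2 : ℝ)), C,
    ψ.continuous.mul (hec.comp continuous_fst), fun w s => ?_, ?_, ?_, fun w => by positivity,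
    fun w => ?_, fun s => by positivity, fun s => ?_⟩
  · rw [norm_mul, he, mul_one, Real.rpow_neg (by positivity), Real.rpow_neg (by positivity),
      ← mul_assoc, mul_comm _ C, mul_assoc, ← mul_inv, ← div_eq_mul_inv, le_div_iff₀ (by positivity)]
    refine le_trans ?_ (hC (w, s))
    rw [mul_comm]
    refine mul_le_mul_of_nonneg_right ?_ (norm_nonneg _)
    have h1 : (1 + ‖w‖) ^ (2 * d + 1 : ℝ) = (1 + ‖w‖) ^ (2 * d + 1) := by
      rw [← Real.rpow_natCast]; push_cast; rfl
    have h2 : (1 + ‖s‖) ^ (2 : ℝ) = (1 + ‖s‖) ^ 2 := by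
      rw [← Real.rpow_natCast]; push_cast; rfl
    rw [h1, h2, show 2 * d + 3 = 2 * d + 1 + 2 from rfl,
      pow_add (1 + ‖((w, s) : Heis d)‖)]
    have h3 : ‖w‖ ≤ ‖((w, s) : Heis d)‖ := norm_fst_le (w, s)
    have h4 : ‖s‖ ≤ ‖((w, s) : Heis d)‖ := norm_snd_le (w, s)
    exact mul_le_mul (pow_le_pow_left₀ (by positivity) (by linarith) _)
      (pow_le_pow_left₀ (by positivity) (by linarith) _) (by positivity) (by positivity)
  · refine integrable_one_add_norm ?_
    rw [finrank_horiz]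
    push_cast
    linarith
  · refine (integrable_one_add_norm ?_).const_mul C
    simp
  · exact Real.rpow_le_one_of_one_le_of_nonpos (by linarith [norm_nonneg w])
      (by have : (0 : ℝ) ≤ d := d.cast_nonneg
          linarith)
  · exact mul_le_of_le_one_right hC0
      (Real.rpow_le_one_of_one_le_of_nonpos (by linarith [norm_nonneg s]) (by norm_num))

theorem heisMul_horizontal (p : Heis d) (ζ : Horiz d) : heisMul p (ζ, 0) = p +
    ((ContinuousLinearMap.id ℝ (Horiz d)).prod (innerSL ℝ (sympJ d p.1))) ζ := by
  simp only [heisMul, symp_eq_inner, add_zero]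
  rfl

theorem hasTemperateGrowth_slice (p : Heis d) :
    Function.HasTemperateGrowth (fun ζ : Horiz d => heisMul p (ζ, 0)) := by
  simp only [heisMul_horizontal]
  exact (Function.HasTemperateGrowth.const p).add (ContinuousLinearMap.hasTemperateGrowth _)

theorem antilipschitz_slice (p : Heis d) :
    AntilipschitzWith 1 (fun ζ : Horiz d => heisMul p (ζ, 0)) := by
  refine AntilipschitzWith.of_le_mul_dist fun ζ ζ' => ?_
  rw [NNReal.coe_one, one_mul, Prod.dist_eq]
  refine le_trans (le_of_eq ?_) (le_max_left _ _)
  simp [heisMul]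

/-- The restriction of a Schwartz function to the horizontal plane through `p`. -/
noncomputable def hslice (p : Heis d) : 𝓢(Heis d, ℂ) →L[ℂ] 𝓢(Horiz d, ℂ) :=
  SchwartzMap.compCLMOfAntilipschitz ℂ (hasTemperateGrowth_slice p) (antilipschitz_slice p)

theorem hslice_apply (p : Heis d) (ψ : 𝓢(Heis d, ℂ)) (ζ : Horiz d) :
    hslice p ψ ζ = ψ (heisMul p (ζ, 0)) := rfl

/-- The function `S(σ)ψ`. -/
noncomputable def feynman (σ : ℝ) (ψ : 𝓢(Heis d, ℂ)) (p : Heis d) : ℂ := fresnel σ (hslice p ψ)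

theorem feynman_add (σ : ℝ) (ψ χ : 𝓢(Heis d, ℂ)) (p : Heis d) :
    feynman σ (ψ + χ) p = feynman σ ψ p + feynman σ χ p := by
  simp only [feynman, map_add, fresnel_add]

theorem feynman_smul (σ : ℝ) (c : ℂ) (ψ : 𝓢(Heis d, ℂ)) (p : Heis d) :
    feynman σ (c • ψ) p = c * feynman σ ψ p := by
  simp only [feynman, map_smul, fresnel_smul]

theorem feynman_zero (ψ : 𝓢(Heis d, ℂ)) : feynman 0 ψ = ψ := by
  funext p
  rw [feynman, fresnel_zero, hslice_apply]
  congr 1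
  simp [heisMul, symp_eq_inner]

theorem hasOscIntegral_feynman {σ : ℝ} (hσ : 0 ≤ σ) (ψ : 𝓢(Heis d, ℂ)) (p : Heis d) :
    HasOscIntegral (fun ζ => Complex.exp (Complex.I * (‖ζ‖ ^ 2 / 2 : ℝ)) *
        ψ (heisMul p (Real.sqrt σ • ζ, 0)))
      ((2 * Real.pi * Complex.I) ^ d * feynman σ ψ p) :=
  hasOscIntegral_fresnel hσ (hslice p ψ)

theorem two_pi_I_pow_ne_zero : (2 * Real.pi * Complex.I : ℂ) ^ d ≠ 0 :=
  pow_ne_zero _ Complex.two_pi_I_ne_zero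

/-- Joint measurability in `(σ, p)`, needed for Tonelli in time, is read off the physical integral,
which represents `feynman` for `σ > 0` only. -/
theorem exists_stronglyMeasurable_feynman (ψ : 𝓢(Heis d, ℂ)) :
    ∃ m : ℝ × Heis d → ℂ, StronglyMeasurable m ∧ ∀ σ > 0, ∀ p, feynman σ ψ p = m (σ, p) := by
  refine ⟨fun q => ((2 * Real.pi * Complex.I : ℂ) ^ d)⁻¹ *
    ∫ ζ, ψ (heisMul q.2 (Real.sqrt q.1 • ζ, 0)) * Complex.exp (Complex.I * (‖ζ‖ ^ 2 / 2 : ℝ)),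
    ?_, fun σ hσ p => ?_⟩
  · refine StronglyMeasurable.const_mul ?_ _
    refine StronglyMeasurable.integral_prod_right' (f := fun r : (ℝ × Heis d) × Horiz d =>
      ψ (heisMul r.1.2 (Real.sqrt r.1.1 • r.2, 0)) * Complex.exp (Complex.I * (‖r.2‖ ^ 2 / 2 : ℝ)))
      ?_
    have h1 : Continuous fun r : (ℝ × Heis d) × Horiz d =>
        ψ (heisMul r.1.2 (Real.sqrt r.1.1 • r.2, 0)) := by
      refine ψ.continuous.comp (continuous_heisMul (by fun_prop) ?_)
      exact (((Real.continuous_sqrt.comp (continuous_fst.comp continuous_fst)).smul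
        continuous_snd).prodMk continuous_const)
    exact (h1.mul (by fun_prop)).stronglyMeasurable
  · have h1 := integral_comp_smul_mul_fresnel (Real.sqrt_pos.2 hσ) (hslice p ψ)
    rw [Real.sq_sqrt hσ.le] at h1
    simp only [hslice_apply] at h1
    simp only
    rw [h1, inv_mul_cancel_left₀ two_pi_I_pow_ne_zero]
    rfl

theorem measurable_feynman {σ : ℝ} (hσ : 0 ≤ σ) (ψ : 𝓢(Heis d, ℂ)) :
    StronglyMeasurable (feynman σ ψ) := by
  rcases hσ.eq_or_lt with rfl | hσ
  · rw [feynman_zero]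
    exact ψ.continuous.stronglyMeasurable
  · obtain ⟨m, hm, h⟩ := exists_stronglyMeasurable_feynman ψ
    have h1 : feynman σ ψ = fun p => m (σ, p) := funext fun p => h σ hσ p
    rw [h1]
    exact hm.comp_measurable (measurable_const.prodMk measurable_id)

/-- Substitution of `w = z + ζ` and expansion of `‖w - z‖²`: the squares give unimodular factors in
`z` and in `w`, the cross term the character with `c = (2πσ)⁻¹`. The central coordinate is
unaffected by the shift because `z ·_σ z = 0`. -/
theorem feynman_eq_twisted {σ : ℝ} (hσ : 0 < σ) (ψ : 𝓢(Heis d, ℂ)) (z : Horiz d) (s : ℝ) :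
    (2 * Real.pi * Complex.I * σ) ^ d * feynman σ ψ (z, s) =
      Complex.exp ((‖z‖ ^ 2 / (2 * σ) : ℝ) * Complex.I) *
        twisted (2 * Real.pi * σ)⁻¹ (fun p => ψ p *
          Complex.exp ((‖p.1‖ ^ 2 / (2 * σ) : ℝ) * Complex.I)) z s := by
  rw [feynman, fresnel_eq_of_pos hσ, twisted, ← integral_const_mul,
    ← integral_add_left_eq_self _ (-z)]
  refine integral_congr_ae (Eventually.of_forall fun w => ?_)
  have h1 : heisMul (z, s) (-z + w, 0) = (w, s + symp z w) := by
    simp only [heisMul, symp_add_right, symp_neg_right, symp_self]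
    ext1
    · simp
    · simp
  simp only [hslice_apply, h1]
  have h2 : ‖-z + w‖ ^ 2 = ‖z‖ ^ 2 + ‖w‖ ^ 2 - 2 * inner ℝ z w := by
    rw [neg_add_eq_sub, norm_sub_sq_real, real_inner_comm w z]
    ring
  rw [h2, mul_left_comm, mul_assoc (ψ _), mul_left_comm, ← Complex.exp_add, mul_left_comm,
    ← Complex.exp_add]
  congr 2
  have h3 : (σ : ℂ) ≠ 0 := by exact_mod_cast hσ.ne'
  have h4 : (Real.pi : ℂ) ≠ 0 := by exact_mod_cast Real.pi_ne_zero
  push_cast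
  field_simp
  ring

/-- `S(σ)` does not increase the `L²` norm. -/
theorem lintegral_feynman_le {σ : ℝ} (hσ : 0 ≤ σ) (ψ : 𝓢(Heis d, ℂ)) :
    ∫⁻ p, ‖feynman σ ψ p‖ₑ ^ 2 ≤ ∫⁻ p, ‖ψ p‖ₑ ^ 2 := by
  rcases hσ.eq_or_lt with rfl | hσ
  · rw [feynman_zero]
  have hc : 0 < 2 * Real.pi * σ := by positivity
  obtain ⟨a, b, C, h⟩ := exists_dominatedBy ψ
    (e := fun w => Complex.exp ((‖w‖ ^ 2 / (2 * σ) : ℝ) * Complex.I)) (by fun_prop)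
    (fun w => Complex.norm_exp_ofReal_mul_I _)
  have h1 := h.lintegral_twisted_le (inv_pos.2 hc)
  -- This constant is `c^{2d}` for `c = (2πσ)⁻¹` and exactly compensates the bound for `twisted`.
  have h2 : ∀ z s, ‖feynman σ ψ (z, s)‖ₑ ^ 2 = ENNReal.ofReal (((2 * Real.pi * σ) ^ (2 * d))⁻¹) *
      ‖twisted (2 * Real.pi * σ)⁻¹ (fun p => ψ p *
          Complex.exp ((‖p.1‖ ^ 2 / (2 * σ) : ℝ) * Complex.I)) z s‖ₑ ^ 2 := fun z s => by
    have h3 := congrArg (fun x : ℂ => ‖x‖) (feynman_eq_twisted hσ ψ z s)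
    simp only [norm_mul, norm_pow, Complex.norm_exp_ofReal_mul_I, one_mul, Complex.norm_I,
      Complex.norm_real, mul_one, Complex.norm_ofNat, Real.norm_of_nonneg Real.pi_pos.le,
      Real.norm_of_nonneg hσ.le] at h3
    rw [← ofReal_norm, ← ofReal_norm, ← ENNReal.ofReal_pow (norm_nonneg _),
      ← ENNReal.ofReal_pow (norm_nonneg _), ← ENNReal.ofReal_mul (by positivity), ← h3]
    congr 1
    field_simp
    ring
  have h5 : ∀ w s, ‖ψ (w, s) * Complex.exp ((‖w‖ ^ 2 / (2 * σ) : ℝ) * Complex.I)‖ₑ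
      = ‖ψ (w, s)‖ₑ := fun w s => by
    rw [← ofReal_norm, norm_mul, Complex.norm_exp_ofReal_mul_I, mul_one, ofReal_norm]
  calc ∫⁻ p, ‖feynman σ ψ p‖ₑ ^ 2 = ∫⁻ z, ∫⁻ s, ‖feynman σ ψ (z, s)‖ₑ ^ 2 :=
        lintegral_prod _ ((measurable_feynman hσ.le ψ).enorm.pow_const 2).aemeasurable
    _ ≤ ∫⁻ w, ∫⁻ s, ‖ψ (w, s)‖ₑ ^ 2 := by
        simp only [h2]
        simp only [lintegral_const_mul' _ _ ENNReal.ofReal_ne_top]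
        refine (mul_le_mul_right h1 _).trans (le_of_eq ?_)
        simp only [h5]
        rw [← mul_assoc, ← ENNReal.ofReal_mul (by positivity), inv_pow, inv_inv,
          inv_mul_cancel₀ (by positivity), ENNReal.ofReal_one, one_mul]
    _ = ∫⁻ p, ‖ψ p‖ₑ ^ 2 :=
        (lintegral_prod _ (ψ.continuous.enorm.measurable.pow_const 2).aemeasurable).symm

theorem sq_eLpNorm_two {α : Type*} [MeasurableSpace α] {μ : Measure α} (u : α → ℂ) :
    eLpNorm u 2 μ ^ 2 = ∫⁻ x, ‖u x‖ₑ ^ 2 ∂μ := by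
  rw [eLpNorm_eq_lintegral_rpow_enorm_toReal (by norm_num) (by norm_num), ← ENNReal.rpow_natCast,
    ← ENNReal.rpow_mul]
  simp

theorem eLpNorm_feynman_le {σ : ℝ} (hσ : 0 ≤ σ) (ψ : 𝓢(Heis d, ℂ)) :
    eLpNorm (feynman σ ψ) 2 volume ≤ eLpNorm ψ 2 volume := by
  rw [← ENNReal.pow_le_pow_left_iff two_ne_zero, sq_eLpNorm_two, sq_eLpNorm_two]
  exact lintegral_feynman_le hσ ψ

theorem memLp_feynman {σ : ℝ} (hσ : 0 ≤ σ) (ψ : 𝓢(Heis d, ℂ)) :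
    MemLp (feynman σ ψ) 2 volume :=
  ⟨(measurable_feynman hσ ψ).aestronglyMeasurable,
    (eLpNorm_feynman_le hσ ψ).trans_lt (ψ.memLp 2 volume).eLpNorm_lt_top⟩

/-- `S(τ)` on Schwartz functions. -/
noncomputable def feynmanₗ (d : ℕ) (τ : ℝ≥0) : 𝓢(Heis d, ℂ) →ₗ[ℂ] L2 d where
  toFun ψ := (memLp_feynman τ.coe_nonneg ψ).toLp _
  map_add' ψ χ := by
    rw [← MemLp.toLp_add]
    exact MemLp.toLp_congr _ _ (Eventually.of_forall fun p => feynman_add τ ψ χ p)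
  map_smul' c ψ := by
    rw [RingHom.id_apply, ← MemLp.toLp_const_smul]
    exact MemLp.toLp_congr _ _ (Eventually.of_forall fun p => feynman_smul τ c ψ p)

theorem norm_feynmanₗ_le (τ : ℝ≥0) (ψ : 𝓢(Heis d, ℂ)) :
    ‖feynmanₗ d τ ψ‖ ≤ 1 * ‖SchwartzMap.toLpCLM ℂ ℂ 2 volume ψ‖ := by
  rw [one_mul, SchwartzMap.toLpCLM_apply, SchwartzMap.norm_toLp]
  exact (Lp.norm_toLp _ (memLp_feynman τ.coe_nonneg ψ)).trans_le
    (ENNReal.toReal_mono (ψ.memLp 2 volume).eLpNorm_lt_top.ne (eLpNorm_feynman_le τ.coe_nonneg ψ))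

theorem denseRange_schwartz :
    DenseRange (SchwartzMap.toLpCLM ℂ ℂ 2 (volume : Measure (Heis d))).toLinearMap :=
  SchwartzMap.denseRange_toLpCLM (by norm_num)

/-- The operators `S(τ)`. -/
noncomputable def feynmanOp (d : ℕ) (τ : ℝ≥0) : L2 d →L[ℂ] L2 d :=
  (feynmanₗ d τ).extendOfNorm (SchwartzMap.toLpCLM ℂ ℂ 2 volume).toLinearMap

theorem norm_feynmanOp_apply_le (τ : ℝ≥0) (f : L2 d) : ‖feynmanOp d τ f‖ ≤ ‖f‖ :=
  (LinearMap.norm_extendOfNorm_apply_le denseRange_schwartz 1 (norm_feynmanₗ_le τ) f).trans_eq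
    (one_mul _)

theorem feynmanOp_toLp (τ : ℝ≥0) (ψ : 𝓢(Heis d, ℂ)) :
    feynmanOp d τ (ψ.toLp 2 volume) = (memLp_feynman τ.coe_nonneg ψ).toLp _ :=
  LinearMap.extendOfNorm_eq denseRange_schwartz ⟨1, norm_feynmanₗ_le τ⟩ ψ

theorem isFeynmanOp_feynmanOp (τ : ℝ≥0) : IsFeynmanOp τ (feynmanOp d τ) := fun ψ =>
  ⟨feynman τ ψ, fun p => hasOscIntegral_feynman τ.coe_nonneg ψ p, by
    rw [feynmanOp_toLp]; exact MemLp.coeFn_toLp _⟩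

theorem HasOscIntegral.unique {f : Horiz d → ℂ} {a b : ℂ} (ha : HasOscIntegral f a)
    (hb : HasOscIntegral f b) : a = b := by
  let B : ContDiffBump (0 : Horiz d) := ⟨1, 2, one_pos, one_lt_two⟩
  let φ : 𝓢(Horiz d, ℂ) := (B.hasCompactSupport.comp_left (g := fun x : ℝ => (x : ℂ))
    Complex.ofReal_zero).toSchwartzMap (Complex.ofRealCLM.contDiff.comp B.contDiff)
  have hφ : φ 0 = 1 := by
    change ((B 0 : ℝ) : ℂ) = 1
    rw [B.one_of_mem_closedBall (by simp [B.rIn_pos.le]), Complex.ofReal_one]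
  exact tendsto_nhds_unique (ha φ hφ) (hb φ hφ)

theorem IsFeynmanOp.eq {τ : ℝ≥0} {A : L2 d →L[ℂ] L2 d} (hA : IsFeynmanOp τ A) :
    A = feynmanOp d τ := by
  refine ContinuousLinearMap.ext fun f => ?_
  refine congrFun (denseRange_schwartz.equalizer A.continuous (feynmanOp d τ).continuous
    (funext fun ψ => ?_)) f
  obtain ⟨g, hg, hAg⟩ := hA ψ
  have h1 : g = feynman τ ψ := funext fun p =>
    mul_left_cancel₀ two_pi_I_pow_ne_zero ((hg p).unique (hasOscIntegral_feynman τ.coe_nonneg ψ p))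
  change A (ψ.toLp 2 volume) = feynmanOp d τ (ψ.toLp 2 volume)
  rw [feynmanOp_toLp]
  exact Lp.ext (hAg.trans (by rw [h1]; exact (MemLp.coeFn_toLp _).symm))

theorem feynmanOp_zero : feynmanOp d 0 = 1 := by
  refine ContinuousLinearMap.ext fun f => ?_
  refine congrFun (denseRange_schwartz.equalizer (feynmanOp d 0).continuous
    (1 : L2 d →L[ℂ] L2 d).continuous (funext fun ψ => ?_)) f
  change feynmanOp d 0 (ψ.toLp 2 volume) = ψ.toLp 2 volume
  rw [feynmanOp_toLp]
  exact MemLp.toLp_congr _ _ (Eventually.of_forall fun p => congrFun (feynman_zero ψ) p)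

end Feynman

/-! ## Derivatives and weights of `S(σ)ψ` -/

section Weights

open LineDeriv

variable {d : ℕ}

/-- The partial derivatives in the horizontal coordinates. -/
noncomputable def dHoriz (k : Fin d ⊕ Fin d) (ψ : 𝓢(Heis d, ℂ)) : 𝓢(Heis d, ℂ) :=
  ∂_{((hbasis k, 0) : Heis d)} ψ

/-- The derivative in the direction of the center. -/
noncomputable def dCenter (ψ : 𝓢(Heis d, ℂ)) : 𝓢(Heis d, ℂ) :=
  ∂_{((0, 1) : Heis d)} ψ

theorem fderiv_schwartz_apply (ψ : 𝓢(Heis d, ℂ)) (p : Heis d) (k : Fin d ⊕ Fin d) (c : ℝ) :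
    fderiv ℝ ψ p (hbasis k, c) = dHoriz k ψ p + c * dCenter ψ p := by
  have h1 : ((hbasis k, c) : Heis d) = (hbasis k, 0) + c • (0, 1) := by
    ext1 <;> simp
  rw [h1, map_add, map_smul, dHoriz, dCenter, SchwartzMap.lineDerivOp_apply_eq_fderiv,
    SchwartzMap.lineDerivOp_apply_eq_fderiv, Complex.real_smul]

theorem lineDeriv_hslice (p : Heis d) (ψ : 𝓢(Heis d, ℂ)) (k : Fin d ⊕ Fin d) :
    ∂_{hbasis k} (hslice p ψ) =
      hslice p (dHoriz k ψ) + (symp p.1 (hbasis k) : ℂ) • hslice p (dCenter ψ) := by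
  ext ζ
  rw [SchwartzMap.lineDerivOp_apply_eq_fderiv, add_apply, smul_apply, hslice_apply, hslice_apply,
    smul_eq_mul, ← fderiv_schwartz_apply]
  have h1 : HasFDerivAt (fun ζ : Horiz d => heisMul p (ζ, 0))
      ((ContinuousLinearMap.id ℝ (Horiz d)).prod (innerSL ℝ (sympJ d p.1))) ζ := by
    simp only [heisMul_horizontal]
    exact (ContinuousLinearMap.hasFDerivAt _).const_add p
  have h2 := (ψ.differentiable (heisMul p (ζ, 0))).hasFDerivAt.comp ζ h1
  have h3 : (⇑(hslice p ψ)) = ψ ∘ fun ζ : Horiz d => heisMul p (ζ, 0) := rfl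
  rw [h3, h2.fderiv, ContinuousLinearMap.comp_apply, symp_eq_inner]
  rfl

/-- The derivative of `S(σ)ψ` in `σ` is `i/2` times this function. -/
noncomputable def feynmanDeriv (σ : ℝ) (ψ : 𝓢(Heis d, ℂ)) (p : Heis d) : ℂ :=
  fresnel σ (flatLap (hslice p ψ))

theorem hasDerivAt_feynman (ψ : 𝓢(Heis d, ℂ)) (p : Heis d) (σ : ℝ) :
    HasDerivAt (fun σ => feynman σ ψ p) (Complex.I / 2 * feynmanDeriv σ ψ p) σ :=
  hasDerivAt_fresnel (hslice p ψ) σ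

theorem continuous_feynmanDeriv (ψ : 𝓢(Heis d, ℂ)) (p : Heis d) :
    Continuous fun σ => feynmanDeriv σ ψ p :=
  continuous_fresnel _

/-- A derivative of the slice through `p` is the slice of `∂_k ψ + (z ·_σ e_k) ∂_s ψ`, where the
coefficient is constant on the slice. Two derivatives cost weights of order up to `‖z‖²`. -/
theorem feynmanDeriv_eq (σ : ℝ) (ψ : 𝓢(Heis d, ℂ)) (p : Heis d) :
    feynmanDeriv σ ψ p = ∑ k, (feynman σ (dHoriz k (dHoriz k ψ)) p +
      (symp p.1 (hbasis k) : ℂ) * feynman σ (dCenter (dHoriz k ψ) + dHoriz k (dCenter ψ)) p +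
      (symp p.1 (hbasis k) : ℂ) ^ 2 * feynman σ (dCenter (dCenter ψ)) p) := by
  rw [feynmanDeriv, flatLap, fresnel_sum]
  refine Finset.sum_congr rfl fun k _ => ?_
  rw [lineDeriv_hslice, lineDerivOp_add, lineDerivOp_smul, lineDeriv_hslice, lineDeriv_hslice]
  simp only [fresnel_add, fresnel_smul, feynman_add]
  simp only [feynman]
  ring

/-- The coefficient `z ·_σ e_k` is constant along its own field, since `e_k ·_σ e_k = 0`; so
squaring the field yields no first-order term. -/
theorem feynmanDeriv_zero (ψ : 𝓢(Heis d, ℂ)) (p : Heis d) :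
    feynmanDeriv 0 ψ p = subLap ψ p := by
  rw [feynmanDeriv_eq, subLap_eq_sum]
  refine Finset.sum_congr rfl fun k _ => ?_
  simp only [feynman_zero]
  have h1 : alongField (hvec (hbasis k)) ψ =
      fun p => dHoriz k ψ p + (symp p.1 (hbasis k) : ℂ) * dCenter ψ p :=
    funext fun p => fderiv_schwartz_apply ψ p k _
  have h2 : HasFDerivAt (fun p : Heis d => (symp p.1 (hbasis k) : ℂ))
      (-(Complex.ofRealCLM.comp ((innerSL ℝ (sympJ d (hbasis k))).comp
        (ContinuousLinearMap.fst ℝ (Horiz d) ℝ)))) p := by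
    have : (fun p : Heis d => (symp p.1 (hbasis k) : ℂ)) =
        ⇑(-(Complex.ofRealCLM.comp ((innerSL ℝ (sympJ d (hbasis k))).comp
        (ContinuousLinearMap.fst ℝ (Horiz d) ℝ)))) := by
      funext q
      rw [symp_swap, symp_eq_inner]
      simp
    rw [this]
    exact ContinuousLinearMap.hasFDerivAt _
  have h3 := ((dHoriz k ψ).differentiable p).hasFDerivAt.add
    (h2.mul ((dCenter ψ).differentiable p).hasFDerivAt)
  rw [h1, alongField]
  have h4 : (fun p : Heis d => dHoriz k ψ p + (symp p.1 (hbasis k) : ℂ) * dCenter ψ p) =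
    (⇑(dHoriz k ψ) + (fun p : Heis d => (symp p.1 (hbasis k) : ℂ)) * ⇑(dCenter ψ)) := rfl
  rw [h4, h3.fderiv]
  have h5 : inner ℝ (sympJ d (hbasis k)) (hbasis k) = (0 : ℝ) := by
    rw [← symp_eq_inner, symp_self]
  simp [hvec, fderiv_schwartz_apply, h5]
  ring

/-- Multiplication by a horizontal coordinate. -/
noncomputable def coordMul (k : Fin d ⊕ Fin d) (ψ : 𝓢(Heis d, ℂ)) : 𝓢(Heis d, ℂ) :=
  SchwartzMap.smulLeftCLM ℂ (fun p : Heis d => p.1 k) ψ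

theorem coordMul_apply (k : Fin d ⊕ Fin d) (ψ : 𝓢(Heis d, ℂ)) (p : Heis d) :
    coordMul k ψ p = (p.1 k : ℂ) * ψ p := by
  have h : Function.HasTemperateGrowth fun p : Heis d => p.1 k :=
    ((EuclideanSpace.proj k).comp (ContinuousLinearMap.fst ℝ (Horiz d) ℝ)).hasTemperateGrowth
  rw [coordMul, SchwartzMap.smulLeftCLM_apply_apply h, Complex.real_smul]

/-- On the slice the coordinate is `z_k + ζ_k`, and `ζ_k` is integrated by parts against the Fresnel
phase. -/
theorem feynman_coordMul {σ : ℝ} (hσ : 0 ≤ σ) (ψ : 𝓢(Heis d, ℂ)) (k : Fin d ⊕ Fin d)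
    (p : Heis d) : feynman σ (coordMul k ψ) p = (p.1 k : ℂ) * feynman σ ψ p +
      Complex.I * σ * (feynman σ (dHoriz k ψ) p +
        (symp p.1 (hbasis k) : ℂ) * feynman σ (dCenter ψ) p) := by
  have h1 : ∀ x, (hslice p (coordMul k ψ) - (p.1 k : ℂ) • hslice p ψ) x
      = (x k : ℂ) * hslice p ψ x := fun x => by
    rw [sub_apply, smul_apply, hslice_apply, hslice_apply, coordMul_apply]
    simp only [heisMul, smul_eq_mul, PiLp.add_apply]
    push_cast
    ring
  have h2 := fresnel_coord_mul hσ _ _ k h1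
  rw [lineDeriv_hslice, fresnel_add, fresnel_smul, sub_eq_add_neg, fresnel_add, ← neg_smul,
    fresnel_smul] at h2
  simp only [feynman]
  linear_combination h2

theorem sum_coord_mul_symp (z : Horiz d) : ∑ k, z k * symp z (hbasis k) = 0 := by
  have h1 : ∀ k, z k * symp z (hbasis k) = z k * sympJ d z k := fun k => by
    rw [symp_eq_inner]
    simp [EuclideanSpace.inner_single_right]
  have h2 := symp_self z
  rw [symp_eq_inner, PiLp.inner_apply] at h2
  simp only [h1]
  simpa using! h2

/-- Solving `feynman_coordMul` for `z_k S(σ)ψ` leaves a central term with the growing coefficient `z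
·_σ e_k`, which would block any induction on weights. Multiplying by `z_k` and summing removes it,
by `sum_coord_mul_symp`; one factor `‖z‖` is then divided out. -/
theorem norm_fst_mul_feynman_le {σ : ℝ} (hσ : σ ∈ Set.Icc (0 : ℝ) 1) (ψ : 𝓢(Heis d, ℂ))
    (p : Heis d) : ‖p.1‖ * ‖feynman σ ψ p‖ ≤
      ∑ k, (‖feynman σ (coordMul k ψ) p‖ + ‖feynman σ (dHoriz k ψ) p‖) := by
  set R : Fin d ⊕ Fin d → ℂ := fun k =>
    feynman σ (coordMul k ψ) p - Complex.I * σ * feynman σ (dHoriz k ψ) p with hR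
  have hRle : ∀ k, ‖R k‖ ≤ ‖feynman σ (coordMul k ψ) p‖ + ‖feynman σ (dHoriz k ψ) p‖ := fun k => by
    refine (norm_sub_le _ _).trans (add_le_add le_rfl ?_)
    rw [norm_mul, norm_mul, Complex.norm_I, one_mul, Complex.norm_real, Real.norm_of_nonneg hσ.1]
    exact mul_le_of_le_one_left (norm_nonneg _) hσ.2
  have h1 : ((‖p.1‖ ^ 2 : ℝ) : ℂ) * feynman σ ψ p = ∑ k, (p.1 k : ℂ) * R k := by
    have h2 : ∀ k, (p.1 k : ℂ) * R k = ((p.1 k ^ 2 : ℝ) : ℂ) * feynman σ ψ p +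
        ((p.1 k * symp p.1 (hbasis k) : ℝ) : ℂ) *
          (Complex.I * σ * feynman σ (dCenter ψ) p) := fun k => by
      simp only [hR, feynman_coordMul hσ.1]
      push_cast
      ring
    simp only [h2]
    rw [Finset.sum_add_distrib, ← Finset.sum_mul, ← Finset.sum_mul, ← Complex.ofReal_sum,
      ← Complex.ofReal_sum, sum_coord_mul_symp, EuclideanSpace.norm_sq_eq]
    simp
  rcases (norm_nonneg p.1).eq_or_lt with h0 | h0
  · rw [← h0, zero_mul]
    positivity
  have h3 : ‖p.1‖ ^ 2 * ‖feynman σ ψ p‖ ≤ ‖p.1‖ * ∑ k, ‖R k‖ := by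
    have h4 := congrArg (fun x : ℂ => ‖x‖) h1
    simp only [norm_mul, Complex.norm_real, Real.norm_of_nonneg (sq_nonneg ‖p.1‖)] at h4
    rw [h4, Finset.mul_sum]
    refine (norm_sum_le _ _).trans (Finset.sum_le_sum fun k _ => ?_)
    rw [norm_mul, Complex.norm_real]
    exact mul_le_mul_of_nonneg_right (PiLp.norm_apply_le p.1 k) (norm_nonneg _)
  refine le_trans ?_ (Finset.sum_le_sum fun k _ => hRle k)
  refine le_of_mul_le_mul_left ?_ h0
  linarith

end Weights

/-! ## Integration in time of `L²`-bounds -/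

section TimeIntegration

variable {α : Type*} [MeasurableSpace α] {μ : Measure α} [SFinite μ]

/-- Minkowski's inequality, for the increments of a differentiable family of functions. -/
theorem eLpNorm_sub_le_of_hasDerivAt {f g : ℝ → α → ℂ} {σ : ℝ} (hσ : 0 ≤ σ)
    (hf : ∀ p τ, HasDerivAt (fun τ => f τ p) (g τ p) τ) (hgc : ∀ p, Continuous fun τ => g τ p)
    (hgm : AEStronglyMeasurable (Function.uncurry g)
      (((volume : Measure ℝ).restrict (Set.Ioi 0)).prod μ))
    {K : ℝ≥0∞} (hK : ∀ τ ∈ Set.Ioc 0 σ, eLpNorm (g τ) 2 μ ≤ K) :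
    eLpNorm (fun p => f σ p - f 0 p) 2 μ ≤ ENNReal.ofReal σ * K := by
  have hgm' : AEStronglyMeasurable (Function.uncurry g)
      (((volume : Measure ℝ).restrict (Set.Ioc 0 σ)).prod μ) :=
    hgm.mono_ac ((Measure.absolutelyContinuous_of_le
      (Measure.restrict_mono Set.Ioc_subset_Ioi_self le_rfl)).prod .rfl)
  -- Cauchy–Schwarz in time gives one factor `σ`; Tonelli and the uniform bound give the other.
  have h1 : ∀ p, ‖f σ p - f 0 p‖ₑ ^ 2 ≤
      ENNReal.ofReal σ * ∫⁻ τ in Set.Ioc 0 σ, ‖g τ p‖ₑ ^ 2 := fun p => by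
    rw [← intervalIntegral.integral_eq_sub_of_hasDerivAt (fun τ _ => hf p τ)
      ((hgc p).intervalIntegrable _ _), intervalIntegral.integral_of_le hσ]
    have h2 := lintegral_mul_sq_le (volume.restrict (Set.Ioc 0 σ)) (f := fun _ => 1)
      (g := fun τ => ‖g τ p‖ₑ) aemeasurable_const (hgc p).enorm.measurable.aemeasurable
    simp only [one_mul, one_pow, lintegral_const, Measure.restrict_apply_univ, Real.volume_Ioc,
      sub_zero] at h2
    exact (pow_le_pow_left' (enorm_integral_le_lintegral_enorm _) 2).trans h2
  rw [← ENNReal.pow_le_pow_left_iff two_ne_zero, sq_eLpNorm_two]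
  calc ∫⁻ p, ‖f σ p - f 0 p‖ₑ ^ 2 ∂μ
      ≤ ∫⁻ p, (ENNReal.ofReal σ * ∫⁻ τ in Set.Ioc 0 σ, ‖g τ p‖ₑ ^ 2) ∂μ := lintegral_mono h1
    _ = ENNReal.ofReal σ * ∫⁻ τ in Set.Ioc 0 σ, ∫⁻ p, ‖g τ p‖ₑ ^ 2 ∂μ := by
        rw [lintegral_const_mul' _ _ ENNReal.ofReal_ne_top]
        congr 1
        exact (lintegral_lintegral_swap (f := fun τ p => ‖g τ p‖ₑ ^ 2)
          (hgm'.enorm.pow_const 2)).symm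
    _ ≤ ENNReal.ofReal σ * ∫⁻ _ in Set.Ioc 0 σ, K ^ 2 := by
        gcongr ENNReal.ofReal σ * ?_
        refine setLIntegral_mono' measurableSet_Ioc fun τ hτ => ?_
        rw [← sq_eLpNorm_two]
        exact pow_le_pow_left' (hK τ hτ) 2
    _ = (ENNReal.ofReal σ * K) ^ 2 := by
        rw [setLIntegral_const, Real.volume_Ioc, sub_zero]
        ring

end TimeIntegration

/-! ## Weighted `L²` norms -/

section WeightedNorms

variable {d : ℕ}

/-- The `L²` norm with the weight `‖z‖ ^ m`. -/
noncomputable def wNorm (m : ℕ) (f : Heis d → ℂ) : ℝ≥0∞ :=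
  eLpNorm (fun p => ((‖p.1‖ ^ m : ℝ) : ℂ) * f p) 2 volume

theorem wNorm_zero (f : Heis d → ℂ) : wNorm 0 f = eLpNorm f 2 volume := by
  simp [wNorm]

theorem aestronglyMeasurable_weight_mul (m : ℕ) {f : Heis d → ℂ}
    (hf : AEStronglyMeasurable f volume) :
    AEStronglyMeasurable (fun p => ((‖p.1‖ ^ m : ℝ) : ℂ) * f p) (volume : Measure (Heis d)) :=
  (Continuous.aestronglyMeasurable (by fun_prop)).mul hf

theorem wNorm_add_le (m : ℕ) {f g : Heis d → ℂ} (hf : AEStronglyMeasurable f volume)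
    (hg : AEStronglyMeasurable g volume) :
    wNorm m (fun p => f p + g p) ≤ wNorm m f + wNorm m g := by
  refine le_trans (le_of_eq ?_) (eLpNorm_add_le (aestronglyMeasurable_weight_mul m hf)
    (aestronglyMeasurable_weight_mul m hg) (by norm_num))
  refine congrArg (fun u => eLpNorm u 2 volume) (funext fun p => ?_)
  simp only [Pi.add_apply]
  ring

theorem wNorm_sum_le {ι : Type*} (s : Finset ι) (m : ℕ) {f : ι → Heis d → ℂ}
    (hf : ∀ k ∈ s, AEStronglyMeasurable (f k) volume) :
    wNorm m (fun p => ∑ k ∈ s, f k p) ≤ ∑ k ∈ s, wNorm m (f k) := by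
  refine le_trans (le_of_eq ?_) (eLpNorm_sum_le
    (fun k hk => aestronglyMeasurable_weight_mul m (hf k hk)) (by norm_num))
  refine congrArg (fun u => eLpNorm u 2 volume) (funext fun p => ?_)
  simp only [Finset.sum_apply, Finset.mul_sum]

theorem wNorm_mul_le (m j : ℕ) {c f : Heis d → ℂ} (hc : ∀ p, ‖c p‖ ≤ ‖p.1‖ ^ j) :
    wNorm m (fun p => c p * f p) ≤ wNorm (m + j) f := by
  refine eLpNorm_mono fun p => ?_
  simp only [norm_mul, Complex.norm_real, norm_pow, norm_norm]
  rw [pow_add, mul_assoc]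
  gcongr
  exact hc p

theorem wNorm_const_mul (m : ℕ) (c : ℂ) (f : Heis d → ℂ) :
    wNorm m (fun p => c * f p) = ‖c‖ₑ * wNorm m f := by
  rw [wNorm, wNorm, ← eLpNorm_const_smul]
  refine congrArg (fun u => eLpNorm u 2 volume) (funext fun p => ?_)
  simp only [Pi.smul_apply, smul_eq_mul]
  ring

theorem norm_symp_hbasis_le (p : Heis d) (k : Fin d ⊕ Fin d) :
    ‖(symp p.1 (hbasis k) : ℂ)‖ ≤ ‖p.1‖ := by
  rw [Complex.norm_real]
  simpa using abs_symp_le p.1 (hbasis k)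

theorem wNorm_succ_feynman_le (m : ℕ) {σ : ℝ} (hσ : σ ∈ Set.Icc (0 : ℝ) 1)
    (ψ : 𝓢(Heis d, ℂ)) : wNorm (m + 1) (feynman σ ψ) ≤
      ∑ k, (wNorm m (feynman σ (coordMul k ψ)) + wNorm m (feynman σ (dHoriz k ψ))) := by
  have hm : ∀ χ : 𝓢(Heis d, ℂ), AEStronglyMeasurable
      (fun p => ‖((‖p.1‖ ^ m : ℝ) : ℂ) * feynman σ χ p‖) (volume : Measure (Heis d)) := fun χ =>
    (aestronglyMeasurable_weight_mul m (measurable_feynman hσ.1 χ).aestronglyMeasurable).norm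
  have h1 : wNorm (m + 1) (feynman σ ψ) ≤ eLpNorm (fun p => ∑ k,
      (‖((‖p.1‖ ^ m : ℝ) : ℂ) * feynman σ (coordMul k ψ) p‖ +
        ‖((‖p.1‖ ^ m : ℝ) : ℂ) * feynman σ (dHoriz k ψ) p‖)) 2 volume := by
    refine eLpNorm_mono_real fun p => ?_
    simp only [norm_mul, Complex.norm_real, norm_pow, norm_norm, ← mul_add, ← Finset.mul_sum]
    rw [pow_succ, mul_assoc]
    gcongr
    exact norm_fst_mul_feynman_le hσ ψ p
  refine h1.trans ?_
  have h2 := eLpNorm_sum_le (s := (Finset.univ : Finset (Fin d ⊕ Fin d)))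
    (fun k _ => (hm (coordMul k ψ)).add (hm (dHoriz k ψ))) (p := 2) (by norm_num)
  refine le_trans (le_of_eq ?_) (h2.trans (Finset.sum_le_sum fun k _ => ?_))
  · refine congrArg (fun u => eLpNorm u 2 volume) (funext fun p => ?_)
    simp only [Finset.sum_apply, Pi.add_apply]
  · refine (eLpNorm_add_le (hm _) (hm _) (by norm_num)).trans (le_of_eq ?_)
    rw [eLpNorm_norm, eLpNorm_norm, wNorm, wNorm]

/-- Each power of the weight is traded for coordinate multiplications and horizontal derivatives of
`ψ`, which stay Schwartz; without a weight, contractivity suffices. -/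
theorem exists_wNorm_feynman_le (m : ℕ) (ψ : 𝓢(Heis d, ℂ)) :
    ∃ C : ℝ≥0, ∀ σ ∈ Set.Icc (0 : ℝ) 1, wNorm m (feynman σ ψ) ≤ C := by
  induction m generalizing ψ with
  | zero =>
    refine ⟨(eLpNorm ψ 2 volume).toNNReal, fun σ hσ => ?_⟩
    rw [wNorm_zero, ENNReal.coe_toNNReal (ψ.memLp 2 volume).eLpNorm_lt_top.ne]
    exact eLpNorm_feynman_le hσ.1 ψ
  | succ m ih =>
    choose A hA using fun k => ih (coordMul k ψ)
    choose B hB using fun k => ih (dHoriz k ψ)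
    refine ⟨∑ k, (A k + B k), fun σ hσ => (wNorm_succ_feynman_le m hσ ψ).trans ?_⟩
    push_cast
    exact Finset.sum_le_sum fun k _ => add_le_add (hA k σ hσ) (hB k σ hσ)

end WeightedNorms

/-! ## The expansion of `S(σ)ψ` at `σ = 0` -/

section Expansion

variable {d : ℕ}

theorem aestronglyMeasurable_feynman_prod (ψ : 𝓢(Heis d, ℂ)) :
    AEStronglyMeasurable (Function.uncurry fun σ p => feynman σ ψ p)
      (((volume : Measure ℝ).restrict (Set.Ioi 0)).prod (volume : Measure (Heis d))) := by
  obtain ⟨M, hM, h⟩ := exists_stronglyMeasurable_feynman ψ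
  refine hM.aestronglyMeasurable.congr ?_
  have h1 : ((volume : Measure ℝ).restrict (Set.Ioi 0)).prod (volume : Measure (Heis d)) =
      (volume.prod volume).restrict (Set.Ioi 0 ×ˢ Set.univ) := by
    rw [← Measure.prod_restrict, Measure.restrict_univ]
  rw [h1]
  filter_upwards [ae_restrict_mem (measurableSet_Ioi.prod MeasurableSet.univ)] with q hq
  exact (h q.1 hq.1 q.2).symm

theorem aestronglyMeasurable_feynmanDeriv_prod (ψ : 𝓢(Heis d, ℂ)) :
    AEStronglyMeasurable (Function.uncurry fun σ p => feynmanDeriv σ ψ p)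
      (((volume : Measure ℝ).restrict (Set.Ioi 0)).prod (volume : Measure (Heis d))) := by
  have h1 : (Function.uncurry fun σ p => feynmanDeriv σ ψ p) = fun q : ℝ × Heis d =>
      ∑ k, (feynman q.1 (dHoriz k (dHoriz k ψ)) q.2 + (symp q.2.1 (hbasis k) : ℂ) *
        feynman q.1 (dCenter (dHoriz k ψ) + dHoriz k (dCenter ψ)) q.2 +
      (symp q.2.1 (hbasis k) : ℂ) ^ 2 * feynman q.1 (dCenter (dCenter ψ)) q.2) :=
    funext fun q => feynmanDeriv_eq q.1 ψ q.2
  rw [h1]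
  have hc : ∀ k, Continuous fun q : ℝ × Heis d => (symp q.2.1 (hbasis k) : ℂ) := fun k =>
    Complex.continuous_ofReal.comp (continuous_symp (by fun_prop) continuous_const)
  refine Finset.aestronglyMeasurable_fun_sum _ fun k _ => ?_
  exact ((aestronglyMeasurable_feynman_prod _).add
    ((hc k).aestronglyMeasurable.mul (aestronglyMeasurable_feynman_prod _))).add
    (((hc k).pow 2).aestronglyMeasurable.mul (aestronglyMeasurable_feynman_prod _))

theorem wNorm_expansion_le (m : ℕ) {A B E : Fin d ⊕ Fin d → Heis d → ℂ}
    (hA : ∀ k, AEStronglyMeasurable (A k) volume) (hB : ∀ k, AEStronglyMeasurable (B k) volume)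
    (hE : ∀ k, AEStronglyMeasurable (E k) volume) :
    wNorm m (fun p => ∑ k, (A k p + (symp p.1 (hbasis k) : ℂ) * B k p +
      (symp p.1 (hbasis k) : ℂ) ^ 2 * E k p)) ≤
      ∑ k, (wNorm m (A k) + wNorm (m + 1) (B k) + wNorm (m + 2) (E k)) := by
  have hc : ∀ k, Continuous fun p : Heis d => (symp p.1 (hbasis k) : ℂ) := fun k =>
    Complex.continuous_ofReal.comp (continuous_symp (by fun_prop) continuous_const)
  have hB' := fun k => (hc k).aestronglyMeasurable.mul (hB k)
  have hE' := fun k => ((hc k).pow 2).aestronglyMeasurable.mul (hE k)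
  refine (wNorm_sum_le _ m fun k _ => ((hA k).add (hB' k)).add (hE' k)).trans
    (Finset.sum_le_sum fun k _ => ?_)
  refine (wNorm_add_le m ((hA k).add (hB' k)) (hE' k)).trans (add_le_add ?_ ?_)
  · refine (wNorm_add_le m (hA k) (hB' k)).trans (add_le_add le_rfl ?_)
    exact wNorm_mul_le m 1 fun p => by rw [pow_one]; exact norm_symp_hbasis_le p k
  · exact wNorm_mul_le m 2 fun p => by
      rw [Pi.pow_apply, norm_pow]; exact pow_le_pow_left₀ (norm_nonneg _) (norm_symp_hbasis_le p k) 2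

theorem exists_wNorm_feynmanDeriv_le (m : ℕ) (ψ : 𝓢(Heis d, ℂ)) :
    ∃ C : ℝ≥0, ∀ σ ∈ Set.Icc (0 : ℝ) 1, wNorm m (feynmanDeriv σ ψ) ≤ C := by
  choose A hA using fun k => exists_wNorm_feynman_le m (dHoriz k (dHoriz k ψ))
  choose B hB using fun k =>
    exists_wNorm_feynman_le (m + 1) (dCenter (dHoriz k ψ) + dHoriz k (dCenter ψ))
  obtain ⟨E, hE⟩ := exists_wNorm_feynman_le (m + 2) (dCenter (dCenter ψ))
  refine ⟨∑ k : Fin d ⊕ Fin d, (A k + B k + E), fun σ hσ => ?_⟩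
  have hm := fun χ : 𝓢(Heis d, ℂ) => (measurable_feynman hσ.1 χ).aestronglyMeasurable (μ := volume)
  rw [show feynmanDeriv σ ψ = _ from funext fun p => feynmanDeriv_eq σ ψ p]
  refine (wNorm_expansion_le m (fun k => hm _) (fun k => hm _) (fun _ => hm _)).trans ?_
  push_cast
  exact Finset.sum_le_sum fun k _ => add_le_add (add_le_add (hA k σ hσ) (hB k σ hσ)) (hE σ hσ)

theorem exists_wNorm_feynman_sub_le (m : ℕ) (ψ : 𝓢(Heis d, ℂ)) :
    ∃ C : ℝ≥0, ∀ σ ∈ Set.Icc (0 : ℝ) 1,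
      wNorm m (fun p => feynman σ ψ p - ψ p) ≤ ENNReal.ofReal σ * C := by
  obtain ⟨C, hC⟩ := exists_wNorm_feynmanDeriv_le m ψ
  refine ⟨‖Complex.I / 2‖₊ * C, fun σ hσ => ?_⟩
  have hw : Continuous fun q : ℝ × Heis d => ((‖q.2.1‖ ^ m : ℝ) : ℂ) := by fun_prop
  have h1 := eLpNorm_sub_le_of_hasDerivAt (μ := (volume : Measure (Heis d)))
    (f := fun τ p => ((‖p.1‖ ^ m : ℝ) : ℂ) * feynman τ ψ p)
    (g := fun τ p => ((‖p.1‖ ^ m : ℝ) : ℂ) * (Complex.I / 2 * feynmanDeriv τ ψ p)) hσ.1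
    (fun p τ => (hasDerivAt_feynman ψ p τ).const_mul _)
    (fun p => continuous_const.mul (continuous_const.mul (continuous_feynmanDeriv ψ p)))
    (hw.aestronglyMeasurable.mul
      (aestronglyMeasurable_const.mul (aestronglyMeasurable_feynmanDeriv_prod ψ)))
    (K := (‖Complex.I / 2‖₊ * C : ℝ≥0)) (fun τ hτ => ?_)
  · refine le_trans (le_of_eq ?_) h1
    refine congrArg (fun u => eLpNorm u 2 volume) (funext fun p => ?_)
    simp only [feynman_zero]
    ring
  · refine (wNorm_const_mul m (Complex.I / 2) (feynmanDeriv τ ψ)).trans_le ?_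
    rw [ENNReal.coe_mul]
    exact mul_le_mul_right (hC τ ⟨hτ.1.le, hτ.2.trans hσ.2⟩) _

/-- Expand the derivative at times `σ` and `0` by `feynmanDeriv_eq` and subtract: only increments of
`feynman` remain, needed with weights of order `0`, `1` and `2`. -/
theorem exists_feynmanDeriv_sub_le (ψ : 𝓢(Heis d, ℂ)) :
    ∃ C : ℝ≥0, ∀ σ ∈ Set.Icc (0 : ℝ) 1,
      wNorm 0 (fun p => feynmanDeriv σ ψ p - subLap ψ p) ≤ ENNReal.ofReal σ * C := by
  choose A hA using fun k => exists_wNorm_feynman_sub_le 0 (dHoriz k (dHoriz k ψ))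
  choose B hB using fun k =>
    exists_wNorm_feynman_sub_le (0 + 1) (dCenter (dHoriz k ψ) + dHoriz k (dCenter ψ))
  obtain ⟨E, hE⟩ := exists_wNorm_feynman_sub_le (0 + 2) (dCenter (dCenter ψ))
  refine ⟨∑ k : Fin d ⊕ Fin d, (A k + B k + E), fun σ hσ => ?_⟩
  have hm : ∀ χ : 𝓢(Heis d, ℂ), AEStronglyMeasurable (fun p => feynman σ χ p - χ p) volume :=
    fun χ => (measurable_feynman hσ.1 χ).aestronglyMeasurable.sub χ.continuous.aestronglyMeasurable
  have h1 : (fun p => feynmanDeriv σ ψ p - subLap ψ p) = fun p => ∑ k,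
      ((feynman σ (dHoriz k (dHoriz k ψ)) p - dHoriz k (dHoriz k ψ) p) +
        (symp p.1 (hbasis k) : ℂ) * (feynman σ (dCenter (dHoriz k ψ) + dHoriz k (dCenter ψ)) p -
          (dCenter (dHoriz k ψ) + dHoriz k (dCenter ψ)) p) +
        (symp p.1 (hbasis k) : ℂ) ^ 2 * (feynman σ (dCenter (dCenter ψ)) p -
          dCenter (dCenter ψ) p)) := by
    funext p
    rw [← feynmanDeriv_zero, feynmanDeriv_eq, feynmanDeriv_eq, ← Finset.sum_sub_distrib]
    refine Finset.sum_congr rfl fun k _ => ?_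
    simp only [feynman_zero]
    ring
  rw [h1]
  refine (wNorm_expansion_le 0 (fun k => hm _) (fun k => hm _) (fun _ => hm _)).trans ?_
  push_cast
  rw [Finset.mul_sum]
  refine Finset.sum_le_sum fun k _ => ?_
  rw [mul_add, mul_add]
  exact add_le_add (add_le_add (hA k σ hσ) (hB k σ hσ)) (hE σ hσ)

/-- The Taylor expansion of `S(σ)ψ` to first order. -/
theorem exists_feynman_expansion (ψ : 𝓢(Heis d, ℂ)) :
    ∃ C : ℝ≥0, ∀ σ ∈ Set.Icc (0 : ℝ) 1,
      eLpNorm (fun p => feynman σ ψ p - ψ p - σ * (Complex.I / 2 * subLap ψ p)) 2 volume ≤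
        ENNReal.ofReal σ * (ENNReal.ofReal σ * C) := by
  obtain ⟨C, hC⟩ := exists_feynmanDeriv_sub_le ψ
  refine ⟨‖Complex.I / 2‖₊ * C, fun σ hσ => ?_⟩
  have hL : StronglyMeasurable (subLap ψ) := by
    have h1 : subLap ψ = fun p => feynmanDeriv 0 ψ p :=
      funext fun p => (feynmanDeriv_zero ψ p).symm
    rw [h1]
    simp only [feynmanDeriv_eq]
    refine Finset.stronglyMeasurable_fun_sum _ fun k _ => ?_
    have hc : Continuous fun p : Heis d => (symp p.1 (hbasis k) : ℂ) :=
      Complex.continuous_ofReal.comp (continuous_symp (by fun_prop) continuous_const)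
    exact ((measurable_feynman le_rfl _).add
      (hc.stronglyMeasurable.mul (measurable_feynman le_rfl _))).add
      ((hc.pow 2).stronglyMeasurable.mul (measurable_feynman le_rfl _))
  have h1 := eLpNorm_sub_le_of_hasDerivAt (μ := (volume : Measure (Heis d)))
    (f := fun τ p => feynman τ ψ p - τ * (Complex.I / 2 * subLap ψ p))
    (g := fun τ p => Complex.I / 2 * feynmanDeriv τ ψ p - Complex.I / 2 * subLap ψ p) hσ.1
    (fun p τ => ?_)
    (fun p => (continuous_const.mul (continuous_feynmanDeriv ψ p)).sub continuous_const)
    ((aestronglyMeasurable_const.mul (aestronglyMeasurable_feynmanDeriv_prod ψ)).sub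
      (aestronglyMeasurable_const.mul
        (hL.comp_measurable measurable_snd).aestronglyMeasurable))
    -- The integrand is already `O(τ)` in `L²`, so integrating over `[0, σ]` gives the error
    -- `O(σ²)`.
    (K := ENNReal.ofReal σ * (‖Complex.I / 2‖₊ * C : ℝ≥0)) (fun τ hτ => ?_)
  · refine le_trans (le_of_eq ?_) h1
    refine congrArg (fun u => eLpNorm u 2 volume) (funext fun p => ?_)
    simp only [feynman_zero]
    push_cast
    ring
  · refine (hasDerivAt_feynman ψ p τ).sub ?_
    simpa using (hasDerivAt_id τ).ofReal_comp.mul_const (Complex.I / 2 * subLap ψ p)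
  · have h2 : wNorm 0 (fun p => Complex.I / 2 * (feynmanDeriv τ ψ p - subLap ψ p)) ≤
        ENNReal.ofReal σ * (‖Complex.I / 2‖₊ * C : ℝ≥0) := by
      rw [wNorm_const_mul, ENNReal.coe_mul, mul_left_comm]
      refine mul_le_mul_right ((hC τ ⟨hτ.1.le, hτ.2.trans hσ.2⟩).trans ?_) _
      exact mul_le_mul_left (ENNReal.ofReal_le_ofReal hτ.2) _
    rw [wNorm_zero] at h2
    simpa only [mul_sub] using h2

end Expansion

/-! ## Consistency of the Feynman approximations -/

section Consistency

variable {d : ℕ}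

/-- A test function as a Schwartz function. -/
noncomputable def testSchwartz (f : testFun d) : 𝓢(Heis d, ℂ) := f.2.2.toSchwartzMap f.2.1

theorem toLp_testSchwartz (f : testFun d) : (testSchwartz f).toLp 2 volume = testToL2 d f := rfl

theorem exists_norm_feynmanOp_sub_le (f : testFun d) : ∃ C : ℝ≥0, ∀ τ : ℝ≥0, τ ≤ 1 →
    ‖feynmanOp d τ (testToL2 d f) - testToL2 d f -
      ((τ : ℝ) : ℂ) • ((Complex.I / 2) • testToL2 d (subLapTest d f))‖ ≤ τ * (τ * C) := by
  obtain ⟨C, hC⟩ := exists_feynman_expansion (testSchwartz f)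
  refine ⟨C, fun τ hτ => ?_⟩
  have h1 := hC τ ⟨τ.coe_nonneg, by exact_mod_cast hτ⟩
  rw [Lp.norm_def]
  refine ENNReal.toReal_le_of_le_ofReal (by positivity) ?_
  refine (le_of_eq (eLpNorm_congr_ae ?_)).trans (h1.trans (le_of_eq ?_))
  · rw [← toLp_testSchwartz f, feynmanOp_toLp]
    filter_upwards [Lp.coeFn_sub ((memLp_feynman τ.coe_nonneg (testSchwartz f)).toLp _ -
        (testSchwartz f).toLp 2 volume)
        (((τ : ℝ) : ℂ) • ((Complex.I / 2) • testToL2 d (subLapTest d f))),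
      Lp.coeFn_sub ((memLp_feynman τ.coe_nonneg (testSchwartz f)).toLp _)
        ((testSchwartz f).toLp 2 volume),
      Lp.coeFn_smul ((τ : ℝ) : ℂ) ((Complex.I / 2) • testToL2 d (subLapTest d f)),
      Lp.coeFn_smul (Complex.I / 2) (testToL2 d (subLapTest d f)),
      (memLp_feynman τ.coe_nonneg (testSchwartz f)).coeFn_toLp,
      (testSchwartz f).coeFn_toLp 2 volume, coeFn_testToL2 (subLapTest d f)] with p h1 h2 h3 h4 h5 h6 h7
    rw [h1, Pi.sub_apply, h2, Pi.sub_apply, h3, Pi.smul_apply, h4, Pi.smul_apply, h5, h6, h7]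
    rfl
  · rw [ENNReal.ofReal_mul (by positivity), ENNReal.ofReal_mul (by positivity)]
    simp only [ENNReal.ofReal_coe_nnreal]

theorem tendsto_coe_nhdsGT_zero : Tendsto (fun h : ℝ≥0 => (h : ℝ)) (𝓝[>] 0) (𝓝 0) :=
  (NNReal.continuous_coe.tendsto 0).mono_left nhdsWithin_le_nhds

theorem eventually_pos_le {a : ℝ≥0} (ha : 0 < a) : ∀ᶠ h : ℝ≥0 in 𝓝[>] 0, 0 < h ∧ h ≤ a :=
  (eventually_mem_nhdsWithin).and (nhdsWithin_le_nhds (Iic_mem_nhds ha))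

/-- A first-order expansion with quadratic error gives the derivative at `0`. -/
theorem tendsto_slope_of_norm_le {E : Type*} [NormedAddCommGroup E] [NormedSpace ℂ E]
    {u : ℝ≥0 → E} {x y : E} {a : ℝ≥0} (ha : 0 < a) {C : ℝ}
    (h : ∀ τ : ℝ≥0, τ ≤ a → ‖u τ - x - ((τ : ℝ) : ℂ) • y‖ ≤ τ * (τ * C)) :
    Tendsto (fun τ : ℝ≥0 => (((τ : ℝ) : ℂ)⁻¹) • (u τ - x)) (𝓝[>] 0) (𝓝 y) := by
  rw [tendsto_iff_norm_sub_tendsto_zero]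
  have h1 : Tendsto (fun τ : ℝ≥0 => (τ : ℝ) * C) (𝓝[>] 0) (𝓝 0) := by
    simpa using tendsto_coe_nhdsGT_zero.mul_const C
  refine squeeze_zero' (Eventually.of_forall fun τ => norm_nonneg _) ?_ h1
  filter_upwards [eventually_pos_le ha] with τ hτ
  have h0 : (0 : ℝ) < τ := by exact_mod_cast hτ.1
  have h0' : ((τ : ℝ) : ℂ) ≠ 0 := by exact_mod_cast h0.ne'
  have h2 : (((τ : ℝ) : ℂ)⁻¹) • (u τ - x) - y =
      (((τ : ℝ) : ℂ)⁻¹) • (u τ - x - ((τ : ℝ) : ℂ) • y) := by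
    rw [smul_sub _ (u τ - x), smul_smul, inv_mul_cancel₀ h0', one_smul]
  rw [h2, norm_smul, norm_inv, Complex.norm_real, Real.norm_of_nonneg h0.le, inv_mul_le_iff₀ h0]
  exact h τ hτ.2

theorem tendsto_feynmanOp_slope (f : testFun d) :
    Tendsto (fun h : ℝ≥0 => (((h : ℝ) : ℂ)⁻¹) • (feynmanOp d h (testToL2 d f) - testToL2 d f))
      (𝓝[>] 0) (𝓝 ((Complex.I / 2) • testToL2 d (subLapTest d f))) := by
  obtain ⟨C, hC⟩ := exists_norm_feynmanOp_sub_le f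
  exact tendsto_slope_of_norm_le one_pos hC

theorem tendsto_feynmanOp (x : L2 d) :
    Tendsto (fun h : ℝ≥0 => feynmanOp d h x) (𝓝[>] 0) (𝓝 x) := by
  rw [Metric.tendsto_nhds]
  intro ε hε
  obtain ⟨y, ⟨f, rfl⟩, hy⟩ := Metric.mem_closure_iff.1 (dense_L0_domain d x) (ε / 3) (by positivity)
  have h1 : Tendsto (fun h : ℝ≥0 => feynmanOp d h (testToL2 d f) - testToL2 d f) (𝓝[>] 0)
      (𝓝 0) := by
    have h2 := (Complex.continuous_ofReal.tendsto 0 |>.comp tendsto_coe_nhdsGT_zero).smul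
      (tendsto_feynmanOp_slope f)
    rw [Complex.ofReal_zero, zero_smul] at h2
    refine h2.congr' ?_
    filter_upwards [self_mem_nhdsWithin] with h hh
    have h0' : ((h : ℝ) : ℂ) ≠ 0 := by
      have : (0 : ℝ≥0) < h := hh
      exact_mod_cast this.ne'
    simp only [Function.comp_apply]
    rw [smul_smul, mul_inv_cancel₀ h0', one_smul]
  filter_upwards [(Metric.tendsto_nhds.1 h1) (ε / 3) (by positivity)] with h hh
  rw [dist_zero_right] at hh
  rw [dist_eq_norm] at hy ⊢
  have h3 : feynmanOp d h x - x = feynmanOp d h (x - testToL2 d f) +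
      (feynmanOp d h (testToL2 d f) - testToL2 d f) - (x - testToL2 d f) := by
    rw [map_sub]; abel
  rw [h3]
  have h4 := norm_feynmanOp_apply_le h (x - testToL2 d f)
  refine ((norm_sub_le _ _).trans (add_le_add (norm_add_le _ _) le_rfl)).trans_lt ?_
  linarith

theorem tendsto_feynmanOp_apply {u : ℝ≥0 → L2 d} {x : L2 d} (hu : Tendsto u (𝓝[>] 0) (𝓝 x)) :
    Tendsto (fun h : ℝ≥0 => feynmanOp d h (u h)) (𝓝[>] 0) (𝓝 x) := by
  have h1 : Tendsto (fun h : ℝ≥0 => feynmanOp d h (u h - x)) (𝓝[>] 0) (𝓝 0) := by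
    refine squeeze_zero_norm (fun h => norm_feynmanOp_apply_le h _) ?_
    exact tendsto_iff_norm_sub_tendsto_zero.1 hu
  have h2 := h1.add (tendsto_feynmanOp x)
  simpa using h2

/-! ### The phase -/

theorem exists_ae_abs_le (v : Lp ℝ ⊤ (volume : Measure (Heis d))) :
    ∃ M : ℝ≥0, ∀ᵐ p, ‖v p‖ ≤ M := by
  refine ⟨(eLpNorm v ⊤ volume).toNNReal, ?_⟩
  have h1 : ∀ᵐ p, ‖v p‖ₑ ≤ eLpNorm v ⊤ volume := by
    rw [eLpNorm_exponent_top]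
    exact ae_le_eLpNormEssSup
  filter_upwards [h1] with p hp
  rw [← ENNReal.coe_toNNReal (Lp.memLp v).eLpNorm_lt_top.ne] at hp
  exact_mod_cast hp

theorem norm_phaseOp_apply_le (v : Lp ℝ ⊤ (volume : Measure (Heis d))) (τ : ℝ) (x : L2 d) :
    ‖phaseOp v τ x‖ ≤ ‖x‖ := by
  refine Lp.norm_le_norm_of_ae_le ?_
  filter_upwards [coeFn_mulOp (memLp_phase v τ) x] with p hp
  rw [phaseOp, hp, norm_mul, Complex.norm_exp]
  simp

theorem phaseOp_zero (v : Lp ℝ ⊤ (volume : Measure (Heis d))) : phaseOp v 0 = 1 := by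
  refine ContinuousLinearMap.ext fun x => Lp.ext ?_
  filter_upwards [coeFn_mulOp (memLp_phase v 0) x] with p hp
  rw [phaseOp, hp]
  simp

/-- Pointwise this is `|e^w - 1 - w| ≤ |w|²` for `|w| ≤ 1`, with `w = -iτv`. -/
theorem norm_phaseOp_sub_le (v : Lp ℝ ⊤ (volume : Measure (Heis d))) {M : ℝ≥0}
    (hM : ∀ᵐ p, ‖v p‖ ≤ M) (x : L2 d) {τ : ℝ≥0} (hτ : τ * M ≤ 1) :
    ‖phaseOp v τ x - x - ((τ : ℝ) : ℂ) • (-Complex.I • mulOp _ (memLp_potential v) x)‖ ≤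
      τ * (τ * (M ^ 2 * ‖x‖)) := by
  have h1 : (τ : ℝ) * (τ * (M ^ 2 * ‖x‖)) = ((τ * M) ^ 2 : ℝ) * ‖x‖ := by ring
  rw [h1]
  refine Lp.norm_le_mul_norm_of_ae_le_mul ?_
  filter_upwards [hM, coeFn_mulOp (memLp_phase v τ) x, coeFn_mulOp (memLp_potential v) x,
    Lp.coeFn_sub (phaseOp v τ x - x)
      (((τ : ℝ) : ℂ) • (-Complex.I • mulOp _ (memLp_potential v) x)),
    Lp.coeFn_sub (phaseOp v τ x) x,
    Lp.coeFn_smul ((τ : ℝ) : ℂ) (-Complex.I • mulOp _ (memLp_potential v) x),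
    Lp.coeFn_smul (-Complex.I) (mulOp _ (memLp_potential v) x)] with p hp h1 h2 h3 h4 h5 h6
  rw [h3, Pi.sub_apply, h4, Pi.sub_apply, h5, Pi.smul_apply, h6, Pi.smul_apply, h2, phaseOp, h1]
  set w : ℂ := -Complex.I * ((τ : ℝ) : ℂ) * (v p : ℂ) with hw
  have h7 : ‖w‖ = τ * ‖v p‖ := by
    rw [hw, norm_mul, norm_mul, norm_neg, Complex.norm_I, one_mul, Complex.norm_real,
      Complex.norm_real, Real.norm_of_nonneg τ.coe_nonneg]
  have h8 : ‖w‖ ≤ τ * M := by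
    rw [h7]
    exact mul_le_mul_of_nonneg_left hp τ.coe_nonneg
  have h9 : Complex.exp w * x p - x p - ((τ : ℝ) : ℂ) • (-Complex.I • ((v p : ℂ) * x p)) =
      (Complex.exp w - 1 - w) * x p := by
    simp only [smul_eq_mul, hw]
    ring
  rw [h9, norm_mul]
  refine mul_le_mul_of_nonneg_right ?_ (norm_nonneg _)
  refine (Complex.norm_exp_sub_one_sub_id_le (h8.trans (by exact_mod_cast hτ))).trans ?_
  exact pow_le_pow_left₀ (norm_nonneg _) h8 2

theorem tendsto_phaseOp_slope (v : Lp ℝ ⊤ (volume : Measure (Heis d))) (x : L2 d) :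
    Tendsto (fun h : ℝ≥0 => (((h : ℝ) : ℂ)⁻¹) • (phaseOp v h x - x)) (𝓝[>] 0)
      (𝓝 (-Complex.I • mulOp _ (memLp_potential v) x)) := by
  obtain ⟨M, hM⟩ := exists_ae_abs_le v
  -- The `1` covers the case `M = 0`.
  refine tendsto_slope_of_norm_le (a := (M + 1)⁻¹) (by positivity) fun τ hτ =>
    norm_phaseOp_sub_le v hM x ?_
  calc τ * M ≤ (M + 1)⁻¹ * (M + 1) := mul_le_mul' hτ (le_add_of_nonneg_right zero_le_one)
    _ = 1 := inv_mul_cancel₀ (by positivity)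

/-- The slope of the product is `S(h)` applied to the slope of the phase, plus the slope of `S`; the
first summand converges because the contractions `S(h)` tend strongly to `1`. The sum of the limits
is `-iv + (i/2) L = -iH`. -/
theorem tendsto_feynmanOp_mul_phaseOp_slope (v : Lp ℝ ⊤ (volume : Measure (Heis d)))
    (f : testFun d) :
    Tendsto (fun h : ℝ≥0 => (((h : ℝ) : ℂ)⁻¹) •
        ((feynmanOp d h * phaseOp v h) (testToL2 d f) - testToL2 d f)) (𝓝[>] 0)
      (𝓝 (-Complex.I • hamiltonian v ⟨testToL2 d f, testToL2_mem_hamiltonian v f⟩)) := by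
  have h1 := (tendsto_feynmanOp_apply (tendsto_phaseOp_slope v (testToL2 d f))).add
    (tendsto_feynmanOp_slope f)
  convert! h1 using 2 with h
  · rw [map_smul, map_sub, ← smul_add, sub_add_sub_cancel]
    rfl
  · rw [hamiltonian_testToL2, smul_add, smul_smul, add_comm]
    congr 2
    push_cast
    ring

end Consistency

/-! ### The main theorem -/

theorem mainTheorem4 (d : ℕ) (v : Lp ℝ ⊤ (volume : Measure (Heis d))) :
    IsSelfAdjoint (hamiltonian v) ∧
    (∃! U : ℝ → L2 d →L[ℂ] L2 d, IsUnitaryGroupOf (hamiltonian v) U) ∧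
    (∃! S : ℝ≥0 → L2 d →L[ℂ] L2 d, ∀ τ, IsFeynmanOp τ (S τ)) ∧
    ∀ (U : ℝ → L2 d →L[ℂ] L2 d) (S : ℝ≥0 → L2 d →L[ℂ] L2 d),
      IsUnitaryGroupOf (hamiltonian v) U → (∀ τ, IsFeynmanOp τ (S τ)) →
        ChernoffEquivalent (fun τ => S τ * phaseOp v τ) (fun τ => U τ) ∧
        ∀ ψ₀ ∈ (hamiltonian v).domain,
          IsClassicalSolution (hamiltonian v) ψ₀ (fun t => U t ψ₀) := by
  have hH := isSelfAdjoint_hamiltonian v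
  obtain ⟨U₀, hU₀⟩ := exists_isUnitaryGroupOf hH
  refine ⟨hH, ⟨U₀, hU₀, fun U hU => hU.eq_of_isSelfAdjoint hH hU₀⟩,
    ⟨feynmanOp d, isFeynmanOp_feynmanOp, fun S hS => funext fun τ => (hS τ).eq⟩,
    fun U S hU hS => ⟨?_, fun ψ₀ hψ₀ => hU.isClassicalSolution hψ₀⟩⟩
  obtain rfl : S = feynmanOp d := funext fun τ => (hS τ).eq
  refine chernoffEquivalent hH hU (S := fun τ => feynmanOp d τ * phaseOp v τ) ?_ (fun h x => ?_)
    (hamiltonian_core v) ?_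
  · rw [feynmanOp_zero, NNReal.coe_zero, phaseOp_zero, one_mul]
  · exact (norm_feynmanOp_apply_le h _).trans (norm_phaseOp_apply_le v h x)
  · rintro _ ⟨f, rfl⟩
    exact tendsto_feynmanOp_mul_phaseOp_slope v f
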